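/- **Model.** There are $N\ge 2$ players and a state $\theta\in\{0,1\}$ with $\mathbb P[\theta=1]=p$. The safe arm pays the flow $s>0$. In state $\theta$, player $n$'s risky arm generates the payoff process $X^n_t=\alpha_\theta t+\sigma Z^n_t+hN^n_t$, where $Z^n$ is a standard Wiener process and $N^n$ is a Poisson process with intensity $\lambda_\theta$, all independent conditional on $\theta$; here $\sigma>0$, $h>0$, $\lambda_1\ge\lambda_0\ge 0$, and $m_0<s<m_1$ with $m_\theta=\alpha_\theta+\lambda_\theta h$. Put $m(p)=p\,m_1+(1-p)\,m_0$. The discount rate is $r>0$, actions can be changed only at $t=0,\Delta,2\Delta,\dots$ for a fixed $\Delta>0$, and $\delta=e^{-r\Delta}$. In each period every player chooses the risky arm ($k=1$) or the safe arm ($k=0$) as a measurable function of the public history: all past actions, the sample paths over each past period of all risky arms in use, and the past and current draws of a public randomization device (independent and uniform on $[0,1]$). The players share the Bayesian posterior belief $p_t$ about $\theta=1$, which is defined after all histories (it equals $1$ after a lump sum if $\lambda_1>\lambda_0=0$). Player $n$ maximizes $(1-\delta)\,\mathbb E\big[\sum_{\ell\ge0}\delta^\ell\{(1-k_{n,\ell\Delta})s+k_{n,\ell\Delta}m_\theta\}\big]$.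 A strongly symmetric equilibrium (SSE) is a perfect Bayesian equilibrium (no player can gain, after any history, by deviating to another, possibly mixed, strategy) in which all players' strategies prescribe the same behavior after every history. For $p\in[0,1]$, let $\overline W^\Delta(p)$ and $\underline W^\Delta(p)$ be the supremum and infimum of the set of payoffs over all pure-strategy SSEs, given prior belief $p$. Let $\mathcal E^\Delta_K w(p)$ be the expectation of $w(p_\Delta)$ when $p_0=p$ and $K$ players use the risky arm on $[0,\Delta)$. **Proposition.** Suppose that the discrete game with time increment $\Delta>0$ admits a pure-strategy SSE for every prior belief $p\in[0,1]$. Then $\overline W^\Delta$ and $\underline W^\Delta$ are bounded and Borel measurable, and the pair $(\overline w,\underline w)=(\overline W^\Delta,\underline W^\Delta)$ solves, for all $p\in[0,1]$, $$\overline w(p)=\max_{\kappa\in\mathcal K(p;\overline w,\underline w)}\Big\{(1-\delta)[(1-\kappa)s+\kappa m(p)]+\delta\,\mathcal E^\Delta_{N\kappa}\overline w(p)\Big\},$$ $$\underline w(p)=\min_{\kappa\in\mathcal K(p;\overline w,\underline w)}\ \max_{k\in\{0,1\}}\Big\{(1-\delta)[(1-k)s+k\,m(p)]+\delta\,\mathcal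 E^\Delta_{(N-1)\kappa+k}\underline w(p)\Big\},$$ where $\mathcal K(p;\overline w,\underline w)\subseteq\{0,1\}$, nonempty for a solution, is the set of all $\kappa\in\{0,1\}$ such that $$(1-\delta)[(1-\kappa)s+\kappa m(p)]+\delta\,\mathcal E^\Delta_{N\kappa}\overline w(p)\ \ge\ \max_{k\in\{0,1\}}\Big\{(1-\delta)[(1-k)s+k\,m(p)]+\delta\,\mathcal E^\Delta_{(N-1)\kappa+k}\underline w(p)\Big\}.$$ Moreover, $\underline W^\Delta\le\underline w\le\overline w\le\overline W^\Delta$ on $[0,1]$ for any solution $(\overline w,\underline w)$ consisting of bounded Borel measurable functions on $[0,1]$. -/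

import Mathlib

open MeasureTheory ProbabilityTheory
open scoped NNReal

noncomputable section

/-! ### Primitives -/

/-- Parameters of the experimentation game with period length `Δ`.  States of the world are
`θ : Fin 2`.  Player `n`'s risky arm yields, in state `θ`, the payoff process
`α θ * t + σ * Z t + h * J t`, with `Z` a Wiener process and `J` a Poisson process of intensity
`lam θ`; the safe arm yields the flow payoff `s`; `r` is the discount rate. -/
structure BanditGame where
  N : ℕ
  r : ℝ
  s : ℝ
  σ : ℝ
  h : ℝ
  α : Fin 2 → ℝ
  lam : Fin 2 → ℝ≥0
  Δ : ℝ≥0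
  two_le_N : 2 ≤ N
  r_pos : 0 < r
  s_pos : 0 < s
  σ_pos : 0 < σ
  h_pos : 0 < h
  lam_le : lam 0 ≤ lam 1
  Δ_pos : 0 < Δ
  m_zero_lt : α 0 + lam 0 * h < s
  lt_m_one : s < α 1 + lam 1 * h

/-- Standard Wiener process: all paths are continuous and start at `0`. -/
structure IsWienerMotion {Ω : Type*} [MeasurableSpace Ω] (Z : ℝ≥0 → Ω → ℝ) (P : Measure Ω) : Prop
    extends IsPreBrownianReal Z P where
  measurable : ∀ t, Measurable (Z t)
  zero : ∀ ω, Z 0 ω = 0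
  continuous : ∀ ω, Continuous fun t => Z t ω

/-- Poisson process of intensity `l`: a counting process (nondecreasing right-continuous paths
started at `0`) with independent increments that have Poisson laws. -/
structure IsPoissonCounting {Ω : Type*} [MeasurableSpace Ω] (J : ℝ≥0 → Ω → ℕ) (l : ℝ≥0)
    (P : Measure Ω) : Prop where
  measurable : ∀ t, Measurable (J t)
  zero : ∀ ω, J 0 ω = 0
  monotone : ∀ ω, Monotone fun t => J t ω
  rightContinuous : ∀ ω t, ContinuousWithinAt (fun u => J u ω) (Set.Ici t) t
  hasLaw_increment : ∀ t u, HasLaw (fun ω => J (t + u) ω - J t ω) (poissonMeasure (l * u)) P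
  indepIncrements : HasIndepIncrements J P

/-- A probability space carrying the noise that drives a single risky arm: a Wiener process `Z`
and, for each state `θ`, an independent Poisson process `J θ` of intensity `lam θ`. -/
structure ArmNoise (G : BanditGame) (Ω : Type*) [MeasurableSpace Ω] where
  P : Measure Ω
  isProb : IsProbabilityMeasure P
  Z : ℝ≥0 → Ω → ℝ
  J : Fin 2 → ℝ≥0 → Ω → ℕ
  wiener : IsWienerMotion Z P
  poisson : ∀ θ, IsPoissonCounting (J θ) (G.lam θ) P
  indep : ∀ θ, IndepFun (fun ω t => Z t ω) (fun ω t => J θ t ω) P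

namespace BanditGame

variable (G : BanditGame)

/-- One-period discount factor `δ = exp (-r Δ)`. -/
def δ : ℝ := Real.exp (-G.r * G.Δ)

/-- Expected flow payoff of the risky arm in state `θ`. -/
def mState (θ : Fin 2) : ℝ := G.α θ + G.lam θ * G.h

/-- Expected flow payoff of the risky arm at belief `p` (the probability of state `1`). -/
def m (p : unitInterval) : ℝ := p * G.mState 1 + (1 - p) * G.mState 0

/-! ### Observed sample paths -/

/-- `(x, j)` is a sample path of a risky arm over one period: `x` is the path of the cumulative
payoff since the beginning of the period, `j` the path of the number of lump sums it contains.
As `h ≠ 0`, the path `j` is determined by `x`. -/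
def IsSamplePath (y : (Set.Iic G.Δ → ℝ) × (Set.Iic G.Δ → ℕ)) : Prop :=
  y.1 ⟨0, Set.mem_Iic.2 zero_le⟩ = 0 ∧ y.2 ⟨0, Set.mem_Iic.2 zero_le⟩ = 0 ∧ Monotone y.2 ∧
    (∀ t, ContinuousWithinAt y.2 (Set.Ici t) t) ∧ Continuous fun t => y.1 t - G.h * y.2 t

/-- One-period sample paths of a risky arm, with the σ-algebra generated by the evaluations. -/
def SamplePath : Type := {y : (Set.Iic G.Δ → ℝ) × (Set.Iic G.Δ → ℕ) // G.IsSamplePath y}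

instance : MeasurableSpace G.SamplePath :=
  inferInstanceAs (MeasurableSpace
    {y : (Set.Iic G.Δ → ℝ) × (Set.Iic G.Δ → ℕ) // G.IsSamplePath y})

variable {G}

/-- Cumulative payoff over the period. -/
def SamplePath.total (y : G.SamplePath) : ℝ := y.1.1 ⟨G.Δ, Set.mem_Iic.2 le_rfl⟩

/-- Number of lump sums over the period. -/
def SamplePath.jumps (y : G.SamplePath) : ℕ := y.1.2 ⟨G.Δ, Set.mem_Iic.2 le_rfl⟩

end BanditGame

namespace ArmNoise

open BanditGame

variable {G : BanditGame} {Ω : Type*} [MeasurableSpace Ω] (X : ArmNoise G Ω)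

/-- The payoff process of a risky arm in state `θ`. -/
def cumPayoff (θ : Fin 2) (t : ℝ≥0) (ω : Ω) : ℝ :=
  G.α θ * t + G.σ * X.Z t ω + G.h * X.J θ t ω

/-- The sample path of the payoff process over a period of length `Δ`. -/
def samplePath (θ : Fin 2) (ω : Ω) : G.SamplePath :=
  ⟨(fun t => X.cumPayoff θ t ω, fun t => X.J θ t ω), by
    refine ⟨?_, ?_, ?_, ?_, ?_⟩
    · simp [cumPayoff, X.wiener.zero, (X.poisson θ).zero]
    · exact (X.poisson θ).zero ω
    · exact fun a b hab => (X.poisson θ).monotone ω hab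
    · intro t
      exact ((X.poisson θ).rightContinuous ω t).comp continuous_subtype_val.continuousWithinAt
        (fun u hu => hu)
    · have hc := X.wiener.continuous ω
      have : (fun t : Set.Iic G.Δ => X.cumPayoff θ t ω - G.h * (X.J θ t ω : ℝ)) =
          fun t : Set.Iic G.Δ => G.α θ * ((t : ℝ≥0) : ℝ) + G.σ * X.Z t ω := by
        funext t
        simp [cumPayoff]
      change Continuous (fun t : Set.Iic G.Δ => X.cumPayoff θ t ω - G.h * (X.J θ t ω : ℝ))
      rw [this]
      fun_prop⟩

theorem measurable_samplePath (θ : Fin 2) : Measurable (X.samplePath θ) := by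
  have hJ : Measurable fun ω => fun t : Set.Iic G.Δ => X.J θ t ω :=
    measurable_pi_lambda _ fun t => (X.poisson θ).measurable t
  have hY : Measurable fun ω => fun t : Set.Iic G.Δ => X.cumPayoff θ t ω := ?_
  · exact (hY.prodMk hJ).subtype_mk
  refine measurable_pi_lambda _ fun t => ?_
  have h1 := X.wiener.measurable t
  have h2 := (X.poisson θ).measurable t
  have h3 : Measurable fun ω => (X.J θ t ω : ℝ) := measurable_from_top.comp h2
  unfold cumPayoff
  fun_prop

/-- Law of the one-period sample path of a risky arm, conditional on the state `θ`. -/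
def pathLaw (θ : Fin 2) : Measure G.SamplePath := X.P.map (X.samplePath θ)

instance (θ : Fin 2) : IsProbabilityMeasure (X.pathLaw θ) :=
  haveI := X.isProb
  Measure.isProbabilityMeasure_map (X.measurable_samplePath θ).aemeasurable

end ArmNoise

namespace BanditGame

variable (G : BanditGame)

/-! ### Beliefs -/

/-- What a period reveals about one player: `inl ()` if that player used the safe arm, and
`inr y` if that player used the risky arm and generated the sample path `y`. -/
abbrev Obs : Type := Unit ⊕ G.SamplePath

variable {G}

/-- Likelihood ratio (state `1` against state `0`) of one player's observation, where
`lam 1 / lam 0` is read as `1` if `lam 0 = 0` (if also `lam 1 > 0`, this matters only in the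
absence of lump sums; see `bayesUpdate`). -/
def likelihoodRatio : G.Obs → ℝ
  | .inl _ => 1
  | .inr y =>
      Real.exp ((G.α 1 - G.α 0) / G.σ ^ 2 * (y.total - G.α 0 * G.Δ - G.h * y.jumps)
          - ((G.α 1 - G.α 0) ^ 2 / (2 * G.σ ^ 2) + (G.lam 1 - G.lam 0)) * G.Δ)
        * (if G.lam 0 = 0 then 1 else (G.lam 1 / G.lam 0 : ℝ)) ^ y.jumps

/-- The observation shows that some lump sum has arrived. -/
def HasJump : G.Obs → Prop
  | .inl _ => False
  | .inr y => 0 < y.jumps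

theorem likelihoodRatio_pos (o : G.Obs) : 0 < likelihoodRatio o := by
  rcases o with _ | y
  · exact one_pos
  · refine mul_pos (Real.exp_pos _) (pow_pos ?_ _)
    split_ifs with h0
    · exact one_pos
    · have h1 : 0 < G.lam 0 := pos_iff_ne_zero.2 h0
      have h2 : 0 < G.lam 1 := h1.trans_le G.lam_le
      positivity

theorem bayes_mem (p : unitInterval) {L : ℝ} (hL : 0 < L) :
    (p : ℝ) * L / (p * L + (1 - p)) ∈ Set.Icc (0 : ℝ) 1 := by
  have h0 := p.2.1
  have h1 : (0 : ℝ) ≤ 1 - p := sub_nonneg.2 p.2.2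
  have h2 : 0 ≤ (p : ℝ) * L := mul_nonneg h0 hL.le
  exact ⟨by positivity, div_le_one_of_le₀ (by linarith) (by positivity)⟩

open Classical in
/-- Bayesian updating of the belief `p` after the observations `o` in one period.  If lump sums
arrive in state `1` only, the belief is `1` once a lump sum has been observed. -/
def bayesUpdate {ι : Type} [Fintype ι] (p : unitInterval) (o : ι → G.Obs) : unitInterval :=
  if G.lam 0 = 0 ∧ 0 < G.lam 1 ∧ ∃ i, HasJump (o i) then 1
  else ⟨p * (∏ i, likelihoodRatio (o i)) / (p * (∏ i, likelihoodRatio (o i)) + (1 - p)),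
    bayes_mem p (Finset.prod_pos fun i _ => likelihoodRatio_pos (o i))⟩

section Law

variable {Ω : Type*} [MeasurableSpace Ω] (X : ArmNoise G Ω)

/-- Distribution `F_K(· | p)` of the belief at the end of a period that starts with belief `p`
and during which `K` players use the risky arm. -/
def beliefLaw (K : ℕ) (p : unitInterval) : Measure unitInterval :=
  (ENNReal.ofReal p • Measure.pi (fun _ : Fin K => X.pathLaw 1) +
      ENNReal.ofReal (1 - p) • Measure.pi (fun _ : Fin K => X.pathLaw 0)).map
    fun y => bayesUpdate p fun i => (Sum.inr (y i) : G.Obs)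

/-- `𝓔_K w (p)`: expectation of `w` at the end-of-period belief. -/
def expect (K : ℕ) (w : unitInterval → ℝ) (p : unitInterval) : ℝ :=
  ∫ q, w q ∂(beliefLaw X K p)

end Law

variable (G)

/-! ### Histories, strategies, and play -/

/-- Public record of one period: the draw of the public randomization device and the
observations about all players (which reveal their actions). -/
abbrev Stage : Type := unitInterval × (Fin G.N → G.Obs)

/-- Histories of length `t` (in periods). -/
abbrev Hist (t : ℕ) : Type := Fin t → G.Stage

/-- What is publicly known when actions are chosen in period `t`: the history and the current
draw of the public randomization device. -/
abbrev Node (t : ℕ) : Type := G.Hist t × unitInterval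

/-- A behavioral strategy: the probability of using the risky arm, as a measurable function of
the history. -/
structure Strategy where
  act : ∀ t, G.Node t → unitInterval
  measurable_act : ∀ t, Measurable (act t)

variable {G}

/-- A pure strategy takes values in the degenerate distributions only. -/
def Strategy.IsPure (τ : G.Strategy) : Prop := ∀ t x, τ.act t x = 0 ∨ τ.act t x = 1

/-- The common belief after a history, starting from the prior `p`. -/
def belief (p : unitInterval) : {t : ℕ} → G.Hist t → unitInterval
  | 0, _ => p
  | _ + 1, g => bayesUpdate (belief p (Fin.init g)) (g (Fin.last _)).2

variable (G)

/-- Random draws used to move from one decision node to the next: private randomizations of the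
players, potential sample paths of all risky arms, next draw of the public device. -/
abbrev Draws : Type := (Fin G.N → unitInterval) × (Fin G.N → G.SamplePath) × unitInterval

variable {G}

open Classical in
/-- What is observed about a player who uses the risky arm with probability `q`, given a private
draw `v` from the uniform distribution on `[0,1]` and the potential sample path `y`. -/
def observe (q v : unitInterval) (y : G.SamplePath) : G.Obs :=
  if v < q ∨ q = 1 then .inr y else .inl ()

/-- The decision node reached `ℓ` periods after the node `x` under the profile `σ`, as a
function of the random draws. -/
def play (σ : Fin G.N → G.Strategy) {t : ℕ} (x : G.Node t) (d : ℕ → G.Draws) :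
    (ℓ : ℕ) → G.Node (t + ℓ)
  | 0 => x
  | ℓ + 1 =>
      let z := play σ x d ℓ
      (Fin.snoc z.1
        (z.2, fun n => observe ((σ n).act (t + ℓ) z) ((d ℓ).1 n) ((d ℓ).2.1 n)), (d ℓ).2.2)

/-! ### Payoffs and equilibria -/

section Payoffs

variable {Ω : Type*} [MeasurableSpace Ω] (X : ArmNoise G Ω)

/-- Law of the sequence of random draws conditional on the state: independent across periods and
players; randomization devices are uniform on `[0,1]`. -/
def drawsLaw (θ : Fin 2) : Measure (ℕ → G.Draws) :=
  Measure.infinitePi fun _ : ℕ =>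
    (Measure.pi fun _ : Fin G.N => (volume : Measure unitInterval)).prod
      ((Measure.pi fun _ : Fin G.N => X.pathLaw θ).prod (volume : Measure unitInterval))

/-- Expected discounted payoff of player `n`, in per-period units, from the node `x` onwards,
conditional on the state `θ`. -/
def statePayoff (θ : Fin 2) (σ : Fin G.N → G.Strategy) {t : ℕ} (x : G.Node t) (n : Fin G.N) : ℝ :=
  ∫ d, (1 - G.δ) * ∑' ℓ : ℕ, G.δ ^ ℓ *
      ((1 - ((σ n).act (t + ℓ) (play σ x d ℓ) : ℝ)) * G.s +
        ((σ n).act (t + ℓ) (play σ x d ℓ) : ℝ) * G.mState θ) ∂(drawsLaw X θ)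

/-- Continuation payoff of player `n` at the node `x` when the prior is `p`, evaluated with the
belief that corresponds to the history at `x`. -/
def payoffAt (p : unitInterval) (σ : Fin G.N → G.Strategy) {t : ℕ} (x : G.Node t)
    (n : Fin G.N) : ℝ :=
  (belief p x.1 : ℝ) * statePayoff X 1 σ x n + (1 - belief p x.1) * statePayoff X 0 σ x n

/-- Payoff of player `n` in the game with prior `p`. -/
def payoff (p : unitInterval) (σ : Fin G.N → G.Strategy) (n : Fin G.N) : ℝ :=
  ∫ u : unitInterval, payoffAt X p σ (((Fin.elim0 : G.Hist 0), u) : G.Node 0) n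

/-- Perfect Bayesian equilibrium for the prior `p`: after every history, on or off the path of
play, no player can gain by switching to another strategy. -/
def IsPBE (p : unitInterval) (σ : Fin G.N → G.Strategy) : Prop :=
  ∀ (t : ℕ) (x : G.Node t) (n : Fin G.N) (τ : G.Strategy),
    payoffAt X p (Function.update σ n τ) x n ≤ payoffAt X p σ x n

/-- Strongly symmetric equilibrium: a PBE in which all players use the same strategy. -/
def IsSSE (p : unitInterval) (σ : Fin G.N → G.Strategy) : Prop :=
  IsPBE X p σ ∧ ∀ n n' t x, (σ n).act t x = (σ n').act t x

/-- Strongly symmetric equilibrium in pure strategies. -/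
def IsPureSSE (p : unitInterval) (σ : Fin G.N → G.Strategy) : Prop :=
  IsSSE X p σ ∧ ∀ n, (σ n).IsPure

/-- The set of (common) payoffs over all pure-strategy SSE, given the prior `p`. -/
def pureSSEPayoffs (p : unitInterval) : Set ℝ :=
  {v | ∃ σ, IsPureSSE X p σ ∧ ∀ n, payoff X p σ n = v}

/-- Best pure-strategy SSE payoff. -/
def Wsup (p : unitInterval) : ℝ := sSup (pureSSEPayoffs X p)

/-- Worst pure-strategy SSE payoff. -/
def Winf (p : unitInterval) : ℝ := sInf (pureSSEPayoffs X p)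

/-! ### The functional equations -/

/-- `(1-δ)[(1-k)s + k m(p)] + δ 𝓔_K w (p)`: use action `k` for one period while `K` players in
total use the risky arm, with continuation payoffs `w`. -/
def oneStep (k K : ℕ) (w : unitInterval → ℝ) (p : unitInterval) : ℝ :=
  (1 - G.δ) * ((1 - k) * G.s + k * G.m p) + G.δ * expect X K w p

/-- Payoff of the best action against opponents who all use `κ`, with continuation payoffs `w`:
the maximum of `oneStep` over `k ∈ {0, 1}`. -/
def bestReply (κ : ℕ) (w : unitInterval → ℝ) (p : unitInterval) : ℝ :=
  max (oneStep X 0 ((G.N - 1) * κ + 0) w p) (oneStep X 1 ((G.N - 1) * κ + 1) w p)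

/-- The set `𝓚(p; w̄, w̲)` of enforceable common actions. -/
def enforceable (wbar wlow : unitInterval → ℝ) (p : unitInterval) : Set ℕ :=
  {κ | κ ∈ ({0, 1} : Set ℕ) ∧ bestReply X κ wlow p ≤ oneStep X κ (G.N * κ) wbar p}

/-- The pair of bounded Borel functions `(w̄, w̲)` solves the coupled functional equations; the
maximum and the minimum are over a nonempty set and are attained. -/
structure IsSolution (wbar wlow : unitInterval → ℝ) : Prop where
  measurable_bar : Measurable wbar
  measurable_low : Measurable wlow
  bounded_bar : ∃ C, ∀ p, |wbar p| ≤ C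
  bounded_low : ∃ C, ∀ p, |wlow p| ≤ C
  eq_bar : ∀ p, IsGreatest
    ((fun κ => oneStep X κ (G.N * κ) wbar p) '' enforceable X wbar wlow p) (wbar p)
  eq_low : ∀ p, IsLeast
    ((fun κ => bestReply X κ wlow p) '' enforceable X wbar wlow p) (wlow p)

end Payoffs

end BanditGame

end

/-!
Since histories are public, the game starts over after one period at the posterior belief. A
common action `κ` can therefore open an SSE only if playing it, rewarded with the best
continuation payoffs, is at least as good as the best response to `κ` when a deviation is met with
the worst ones. Iterating the two functional equations from constant bounds on all payoffs thus
gives monotone sequences of bounds on the SSE payoffs. Their limits solve the equations, because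
the extrema range over subsets of `{0, 1}`, which are eventually constant.

Conversely, a solution `(w̄, w̲)` is the pair of payoffs of a two-state automaton. It uses a
maximizing action in the good state and a minimizing one in the bad state, and any deviation leads
to the bad state. After compliance in the bad state, the public randomization device sends play to
the good state with the probability that makes the payoff equal to `w̲`. Hence every solution lies
between the worst and the best SSE payoff, and the limit of the iteration attains both.

That the game starts over rests on Bayes' rule: the likelihood ratio of a sample path is
Girsanov's density for the drift of the Wiener part times the density of one Poisson law against
another.
-/

/-! ### Densities, images and products -/

section Densities

variable {α β : Type*} [MeasurableSpace α] [MeasurableSpace β]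

theorem map_withDensity_comp (μ : Measure α) {g : α → β} (hg : Measurable g) {f : β → ENNReal}
    (hf : Measurable f) :
    (μ.withDensity fun a => f (g a)).map g = (μ.map g).withDensity f := by
  ext s hs
  rw [Measure.map_apply hg hs, withDensity_apply _ (hg hs), withDensity_apply _ hs,
    setLIntegral_map hs hf hg]

theorem eq_of_map_eq_of_comap_le {α β : Type*} {mα : MeasurableSpace α} {mβ : MeasurableSpace β}
    {μ ν : Measure α} {g : α → β} (hg : Measurable g) (hle : mα ≤ mβ.comap g)
    (h : μ.map g = ν.map g) : μ = ν := by
  ext s hs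
  obtain ⟨t, ht, rfl⟩ := hle s hs
  rw [← Measure.map_apply hg ht, h, Measure.map_apply hg ht]

theorem indicator_univ_pi_prod {ι : Type*} [Fintype ι] {E : ι → Type*} (s : ∀ i, Set (E i))
    (f : ∀ i, E i → ENNReal) (x : ∀ i, E i) :
    (Set.univ.pi s).indicator (fun x => ∏ i, f i (x i)) x =
      ∏ i, (s i).indicator (f i) (x i) := by
  by_cases hx : x ∈ Set.univ.pi s
  · rw [Set.indicator_of_mem hx]
    exact Finset.prod_congr rfl fun i _ => (Set.indicator_of_mem (hx i trivial) _).symm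
  · obtain ⟨i, hi⟩ : ∃ i, x i ∉ s i := by simpa [Set.mem_pi] using hx
    rw [Set.indicator_of_notMem hx]
    exact (Finset.prod_eq_zero (Finset.mem_univ i) (Set.indicator_of_notMem hi _)).symm

theorem pi_withDensity {ι : Type*} [Fintype ι] {E : ι → Type*} [∀ i, MeasurableSpace (E i)]
    (μ : ∀ i, Measure (E i)) [∀ i, IsProbabilityMeasure (μ i)] {f : ∀ i, E i → ENNReal}
    (hf : ∀ i, Measurable (f i)) [∀ i, SigmaFinite ((μ i).withDensity (f i))] :
    Measure.pi (fun i => (μ i).withDensity (f i)) =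
      (Measure.pi μ).withDensity fun x => ∏ i, f i (x i) := by
  refine Measure.pi_eq fun s hs => ?_
  have hm : ∀ i, Measurable ((s i).indicator (f i)) := fun i => (hf i).indicator (hs i)
  calc (Measure.pi μ).withDensity (fun x => ∏ i, f i (x i)) (Set.univ.pi s)
      = ∫⁻ x, ∏ i, (s i).indicator (f i) (x i) ∂Measure.pi μ := by
        rw [withDensity_apply _ (.univ_pi hs), ← lintegral_indicator (.univ_pi hs)]
        simp_rw [indicator_univ_pi_prod]
    _ = ∏ i, ∫⁻ x, (s i).indicator (f i) (x i) ∂Measure.pi μ :=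
        lintegral_prod_eq_prod_lintegral_of_indepFun Finset.univ
          (fun i (x : ∀ i, E i) => (s i).indicator (f i) (x i))
          (iIndepFun_pi fun i => (hm i).aemeasurable) fun i => (hm i).comp (measurable_pi_apply i)
    _ = ∏ i, (μ i).withDensity (f i) (s i) := by
        refine Finset.prod_congr rfl fun i _ => ?_
        rw [withDensity_apply _ (hs i), ← lintegral_indicator (hs i)]
        exact (measurePreserving_eval μ i).lintegral_comp (hm i)

end Densities

/-! ### Change of measure for processes with independent increments -/

theorem exists_monotone_nat_enumeration {T : Type*} [LinearOrder T] [OrderBot T] (I : Finset T) :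
    ∃ (t : ℕ → T) (n : ℕ), Monotone t ∧ t 0 = ⊥ ∧ t '' Set.Iic n = insert ⊥ (I : Set T) := by
  obtain ⟨n, hn⟩ : ∃ n, (insert ⊥ I).card = n + 1 :=
    Nat.exists_eq_succ_of_ne_zero (Finset.insert_nonempty _ _).card_ne_zero
  let e := (insert ⊥ I).orderEmbOfFin hn
  refine ⟨fun k => e (Fin.clamp k n), n, fun j k hjk => e.monotone ?_, ?_, ?_⟩
  · exact min_le_min_right n hjk
  · exact ((insert ⊥ I).orderEmbOfFin_zero hn (Nat.succ_pos n)).trans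
      (le_bot_iff.1 (Finset.min'_le _ _ (Finset.mem_insert_self _ _)))
  · rw [← Finset.coe_insert, ← (insert ⊥ I).range_orderEmbOfFin hn]
    ext x
    constructor
    · rintro ⟨k, -, rfl⟩
      exact ⟨_, rfl⟩
    · rintro ⟨k, rfl⟩
      exact ⟨k, Nat.lt_succ_iff.1 k.2, congrArg e (Fin.ext (min_eq_left (Nat.lt_succ_iff.1 k.2)))⟩

/-- Exponential density `exp (c x - d u)`: the density at time `u`, as a function of the current
value `x`, that turns the law of a Lévy process into that of a tilted one. -/
noncomputable def expDensity (c d u x : ℝ) : ENNReal := ENNReal.ofReal (Real.exp (c * x - d * u))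

@[fun_prop]
theorem measurable_expDensity (c d u : ℝ) : Measurable (expDensity c d u) := by
  unfold expDensity
  fun_prop

theorem prod_expDensity {ι : Type*} [Fintype ι] (c d : ℝ) (u x : ι → ℝ) :
    ∏ i, expDensity c d (u i) (x i) = expDensity c d (∑ i, u i) (∑ i, x i) := by
  simp_rw [expDensity]
  rw [← ENNReal.ofReal_prod_of_nonneg fun _ _ => (Real.exp_pos _).le, ← Real.exp_sum,
    Finset.sum_sub_distrib, ← Finset.mul_sum, ← Finset.mul_sum]

section Paths

variable {Ω : Type*} {D : ℝ≥0}

/-- Path of the process `Y` up to time `D`. -/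
def pathUpTo (D : ℝ≥0) (Y : ℝ≥0 → Ω → ℝ) (ω : Ω) (s : Set.Iic D) : ℝ := Y s ω

/-- Terminal value of a path up to time `D`. -/
def terminal (y : Set.Iic D → ℝ) : ℝ := y ⟨D, Set.mem_Iic.2 le_rfl⟩

/-- Increments of the process `Y` over the first `n` intervals of the grid `t`. -/
def gridIncrements (t : ℕ → ℝ≥0) (n : ℕ) (Y : ℝ≥0 → Ω → ℝ) (ω : Ω) (j : Fin n) : ℝ :=
  Y (t (j + 1)) ω - Y (t j) ω

/-- Sum of the first `k` of `n` increments. -/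
def partialSum {n : ℕ} (x : Fin n → ℝ) (k : ℕ) : ℝ := ∑ j : Fin n, if (j : ℕ) < k then x j else 0

@[fun_prop]
theorem measurable_terminal : Measurable (terminal (D := D)) := measurable_pi_apply _

theorem measurable_partialSum {n : ℕ} (k : ℕ) :
    Measurable fun x : Fin n → ℝ => partialSum x k :=
  Finset.measurable_sum _ fun j _ => by split_ifs <;> fun_prop

theorem partialSum_sub (y : ℕ → ℝ) {n k : ℕ} (hk : k ≤ n) :
    partialSum (fun j : Fin n => y (j + 1) - y j) k = y k - y 0 := by
  rw [partialSum, Fin.sum_univ_eq_sum_range (fun j => if j < k then y (j + 1) - y j else 0) n,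
    ← Finset.sum_range_sub y k, ← Finset.sum_filter]
  refine Finset.sum_congr ?_ fun _ _ => rfl
  ext j
  simp only [Finset.mem_filter, Finset.mem_range]
  omega

theorem sum_fin_sub (y : ℕ → ℝ) (n : ℕ) : ∑ j : Fin n, (y (j + 1) - y j) = y n - y 0 := by
  rw [Fin.sum_univ_eq_sum_range (fun j => y (j + 1) - y j), Finset.sum_range_sub]

theorem restrict_comp_pathUpTo {Y : ℝ≥0 → Ω → ℝ} (hY : ∀ ω, Y 0 ω = 0) {t : ℕ → ℝ≥0} (ht : t 0 = 0)
    {n : ℕ} {I : Finset (Set.Iic D)} {k : I → ℕ} (hk : ∀ i, k i ≤ n)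
    (hkt : ∀ i : I, t (k i) = (i : Set.Iic D)) :
    I.restrict ∘ pathUpTo D Y =
      (fun (x : Fin n → ℝ) i => partialSum x (k i)) ∘ gridIncrements t n Y := by
  funext ω i
  have := partialSum_sub (fun j => Y (t j) ω) (hk i)
  rw [ht, hY, hkt, sub_zero] at this
  exact this.symm

variable [MeasurableSpace Ω]

theorem measurable_pathUpTo {Y : ℝ≥0 → Ω → ℝ} (hY : ∀ t, Measurable (Y t)) :
    Measurable (pathUpTo D Y) :=
  measurable_pi_lambda _ fun s => hY s

theorem measurable_gridIncrements (t : ℕ → ℝ≥0) (n : ℕ) {Y : ℝ≥0 → Ω → ℝ}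
    (hY : ∀ t, Measurable (Y t)) : Measurable (gridIncrements t n Y) :=
  measurable_pi_lambda _ fun _ => (hY _).sub (hY _)

theorem map_gridIncrements {P : Measure Ω} {Y : ℝ≥0 → Ω → ℝ} (hY : ∀ t, Measurable (Y t))
    (hi : HasIndepIncrements Y P) {t : ℕ → ℝ≥0} (ht : Monotone t) (n : ℕ) :
    P.map (gridIncrements t n Y) =
      Measure.pi fun j : Fin n => P.map fun ω => Y (t (j + 1)) ω - Y (t j) ω :=
  ((hi.nat ht).precomp Fin.val_injective).map_fun_eq_pi_map
    fun _ => ((hY _).sub (hY _)).aemeasurable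

variable {Ω₀ Ω₁ : Type*} [MeasurableSpace Ω₀] [MeasurableSpace Ω₁] {P₀ : Measure Ω₀}
  {P₁ : Measure Ω₁} [IsProbabilityMeasure P₀] [IsProbabilityMeasure P₁] {Y₀ : ℝ≥0 → Ω₀ → ℝ}
  {Y₁ : ℝ≥0 → Ω₁ → ℝ} {c d : ℝ}

theorem map_gridIncrements_eq_withDensity (hm₀ : ∀ t, Measurable (Y₀ t))
    (hm₁ : ∀ t, Measurable (Y₁ t)) (hi₀ : HasIndepIncrements Y₀ P₀)
    (hi₁ : HasIndepIncrements Y₁ P₁)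
    (hlaw : ∀ t u : ℝ≥0, P₁.map (fun ω => Y₁ (t + u) ω - Y₁ t ω) =
      (P₀.map fun ω => Y₀ (t + u) ω - Y₀ t ω).withDensity (expDensity c d u))
    {t : ℕ → ℝ≥0} (ht : Monotone t) (n : ℕ) :
    P₁.map (gridIncrements t n Y₁) =
      (P₀.map (gridIncrements t n Y₀)).withDensity
        fun x => expDensity c d (t n - t 0) (∑ j, x j) := by
  have hstep (j : Fin n) : P₁.map (fun ω => Y₁ (t (j + 1)) ω - Y₁ (t j) ω) =
      (P₀.map fun ω => Y₀ (t (j + 1)) ω - Y₀ (t j) ω).withDensity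
        (expDensity c d (t (j + 1) - t j)) := by
    have hle : t j ≤ t (j + 1) := ht (Nat.le_succ _)
    simpa only [add_tsub_cancel_of_le hle, NNReal.coe_sub hle] using hlaw (t j) (t (j + 1) - t j)
  have hprob₀ (j : Fin n) :
      IsProbabilityMeasure (P₀.map fun ω => Y₀ (t (j + 1)) ω - Y₀ (t j) ω) :=
    Measure.isProbabilityMeasure_map ((hm₀ _).sub (hm₀ _)).aemeasurable
  have hprob₁ (j : Fin n) : IsProbabilityMeasure
      ((P₀.map fun ω => Y₀ (t (j + 1)) ω - Y₀ (t j) ω).withDensity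
        (expDensity c d (t (j + 1) - t j))) :=
    hstep j ▸ Measure.isProbabilityMeasure_map ((hm₁ _).sub (hm₁ _)).aemeasurable
  rw [map_gridIncrements hm₁ hi₁ ht, map_gridIncrements hm₀ hi₀ ht]
  simp_rw [hstep]
  rw [pi_withDensity _ fun j => measurable_expDensity _ _ _]
  simp_rw [prod_expDensity, sum_fin_sub (fun j => (t j : ℝ)) n]

theorem exists_grid (I : Finset (Set.Iic D)) : ∃ (t : ℕ → ℝ≥0) (n : ℕ), Monotone t ∧ t 0 = 0 ∧
    t n = D ∧ ∀ i ∈ I, ∃ k ≤ n, t k = i := by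
  classical
  obtain ⟨t, n, ht, h0, hrange⟩ :=
    exists_monotone_nat_enumeration (insert D (I.image Subtype.val))
  have hmem {i : ℝ≥0} (hi : i ∈ insert D (I.image Subtype.val)) : ∃ k ≤ n, t k = i :=
    hrange.symm.subset (Set.mem_insert_of_mem _ hi)
  refine ⟨t, n, ht, h0, le_antisymm ?_ ?_, fun i hi =>
    hmem (Finset.mem_insert_of_mem (Finset.mem_image_of_mem _ hi))⟩
  · have hn := hrange.subset ⟨n, Set.mem_Iic.2 le_rfl, rfl⟩
    simp only [Finset.coe_insert, Finset.coe_image, Set.mem_insert_iff, Set.mem_image] at hn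
    rcases hn with h | h | ⟨i, -, h⟩
    · exact h ▸ bot_le
    · exact h.le
    · exact h ▸ i.2
  · obtain ⟨k, hk, hkD⟩ := hmem (Finset.mem_insert_self _ _)
    exact hkD ▸ ht hk

/-- On a finite set of times, the path is a function of its increments over a grid that ends at
`D`, and so is the terminal value that enters the density. -/
theorem map_pathUpTo_eq_withDensity (hm₀ : ∀ t, Measurable (Y₀ t)) (hm₁ : ∀ t, Measurable (Y₁ t))
    (hz₀ : ∀ ω, Y₀ 0 ω = 0) (hz₁ : ∀ ω, Y₁ 0 ω = 0) (hi₀ : HasIndepIncrements Y₀ P₀)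
    (hi₁ : HasIndepIncrements Y₁ P₁)
    (hlaw : ∀ t u : ℝ≥0, P₁.map (fun ω => Y₁ (t + u) ω - Y₁ t ω) =
      (P₀.map fun ω => Y₀ (t + u) ω - Y₀ t ω).withDensity (expDensity c d u)) :
    P₁.map (pathUpTo D Y₁) =
      (P₀.map (pathUpTo D Y₀)).withDensity fun y => expDensity c d D (terminal y) := by
  have hp₀ := measurable_pathUpTo (D := D) hm₀
  have hp₁ := measurable_pathUpTo (D := D) hm₁
  have : IsProbabilityMeasure (P₁.map (pathUpTo D Y₁)) :=
    Measure.isProbabilityMeasure_map hp₁.aemeasurable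
  refine IsProjectiveLimit.unique (P := fun I => (P₁.map (pathUpTo D Y₁)).map I.restrict)
    (fun I => rfl) fun I => ?_
  obtain ⟨t, n, ht, ht0, htn, htI⟩ := exists_grid I
  choose k hkn hkt using fun i : I => htI i i.2
  have hS : Measurable fun (x : Fin n → ℝ) (i : I) => partialSum x (k i) :=
    measurable_pi_lambda _ fun i => measurable_partialSum _
  have hrestr : Measurable (I.restrict : (Set.Iic D → ℝ) → I → ℝ) := Finset.measurable_restrict I
  have hterm (ω : Ω₀) : ∑ j, gridIncrements t n Y₀ ω j = terminal (pathUpTo D Y₀ ω) := by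
    have := sum_fin_sub (fun j => Y₀ (t j) ω) n
    rwa [ht0, htn, hz₀, sub_zero] at this
  have hgrid : P₁.map (gridIncrements t n Y₁) =
      (P₀.withDensity fun ω => expDensity c d D (terminal (pathUpTo D Y₀ ω))).map
        (gridIncrements t n Y₀) := by
    rw [map_gridIncrements_eq_withDensity hm₀ hm₁ hi₀ hi₁ hlaw ht, ht0, htn, NNReal.coe_zero,
      sub_zero, ← map_withDensity_comp _ (measurable_gridIncrements t n hm₀) (by fun_prop)]
    simp_rw [hterm]
  change _ = (P₁.map (pathUpTo D Y₁)).map I.restrict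
  rw [← map_withDensity_comp _ hp₀ (by fun_prop), Measure.map_map hrestr hp₀,
    Measure.map_map hrestr hp₁, restrict_comp_pathUpTo hz₁ ht0 hkn hkt,
    restrict_comp_pathUpTo hz₀ ht0 hkn hkt,
    ← Measure.map_map hS (measurable_gridIncrements t n hm₁), hgrid,
    Measure.map_map hS (measurable_gridIncrements t n hm₀)]

end Paths

/-! ### Exponential tilting of Gaussian and Poisson laws -/

theorem gaussianReal_add_mul_eq_withDensity (μ c : ℝ) (v : ℝ≥0) :
    gaussianReal (μ + v * c) v = (gaussianReal μ v).withDensity fun x =>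
      ENNReal.ofReal (Real.exp (c * x - (c * μ + v * c ^ 2 / 2))) := by
  rcases eq_or_ne v 0 with rfl | hv
  · simp [dirac_withDensity]
  · rw [gaussianReal_of_var_ne_zero _ hv, gaussianReal_of_var_ne_zero _ hv,
      ← withDensity_mul _ (measurable_gaussianPDF _ _) (by fun_prop)]
    congr 1
    funext x
    rw [Pi.mul_apply, gaussianPDF_def, gaussianPDF_def,
      ← ENNReal.ofReal_mul (gaussianPDFReal_nonneg _ _ _)]
    simp only [gaussianPDFReal]
    rw [mul_assoc _ (Real.exp _) (Real.exp _), ← Real.exp_add]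
    have hv' : (v : ℝ) ≠ 0 := NNReal.coe_ne_zero.2 hv
    congr 3
    field_simp
    ring

theorem poissonMeasure_mul_eq_withDensity {k : ℝ≥0} (hk : 0 < k) (l : ℝ≥0) :
    poissonMeasure (k * l) = (poissonMeasure l).withDensity fun n =>
      ENNReal.ofReal (Real.exp (Real.log k * n - (k - 1) * l)) := by
  refine Measure.ext_of_singleton fun n => ?_
  rw [withDensity_apply _ (measurableSet_singleton n), lintegral_singleton,
    poissonMeasure_singleton, poissonMeasure_singleton, ← ENNReal.ofReal_mul (Real.exp_pos _).le]
  congr 1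
  have hpow : Real.exp (Real.log k * n) = (k : ℝ) ^ n := by
    rw [mul_comm, Real.exp_nat_mul, Real.exp_log (NNReal.coe_pos.2 hk)]
  have hexp : Real.exp (-((k : ℝ) * l)) = Real.exp (-((k - 1 : ℝ) * l)) * Real.exp (-(l : ℝ)) := by
    rw [← Real.exp_add]
    congr 1
    ring
  rw [sub_eq_add_neg, Real.exp_add, hpow, NNReal.coe_mul, hexp, mul_pow]
  ring

/-! ### Likelihood ratios of sample paths -/

namespace BanditGame

variable {G : BanditGame}

@[fun_prop]
theorem measurable_total : Measurable (SamplePath.total (G := G)) :=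
  (measurable_pi_apply _).comp (measurable_fst.comp measurable_subtype_coe)

@[fun_prop]
theorem measurable_jumps : Measurable (SamplePath.jumps (G := G)) :=
  (measurable_pi_apply _).comp (measurable_snd.comp measurable_subtype_coe)

/-- Log-likelihood gain per lump sum, read as `0` if `lam 0 = 0`, in accordance with
`likelihoodRatio`. -/
noncomputable def logJump (G : BanditGame) : ℝ :=
  if G.lam 0 = 0 then 0 else Real.log (G.lam 1 / G.lam 0)

theorem exp_logJump_mul (n : ℕ) : Real.exp (G.logJump * n) =
    (if G.lam 0 = 0 then 1 else (G.lam 1 / G.lam 0 : ℝ)) ^ n := by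
  unfold logJump
  split_ifs with h0
  · simp
  · have h0' : 0 < G.lam 0 := pos_iff_ne_zero.2 h0
    have h1 : 0 < G.lam 1 := h0'.trans_le G.lam_le
    rw [mul_comm, Real.exp_nat_mul, Real.exp_log (by positivity)]

/-- The likelihood of a sample path factors into a Girsanov density of its continuous part and a
density of its jump part. -/
theorem ofReal_likelihoodRatio_inr (y : G.SamplePath) :
    ENNReal.ofReal (likelihoodRatio (.inr y : G.Obs)) =
      expDensity ((G.α 1 - G.α 0) / G.σ ^ 2) ((G.α 1 ^ 2 - G.α 0 ^ 2) / (2 * G.σ ^ 2)) G.Δ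
          (y.total - G.h * y.jumps) *
        expDensity G.logJump (G.lam 1 - G.lam 0) G.Δ y.jumps := by
  have hσ := G.σ_pos.ne'
  rw [expDensity, expDensity, ← ENNReal.ofReal_mul (Real.exp_pos _).le, likelihoodRatio,
    ← exp_logJump_mul, ← Real.exp_add, ← Real.exp_add]
  congr 2
  field_simp
  ring

/-- Numbers of lump sums in a period that do not reveal state `1` with certainty. -/
def inconclusive (G : BanditGame) : Set ℝ := {x | G.lam 0 = 0 → 0 < G.lam 1 → x = 0}

theorem measurableSet_inconclusive : MeasurableSet (inconclusive G) :=
  (MeasurableSet.const _).imp ((MeasurableSet.const _).imp (measurableSet_singleton 0))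

/-- The continuous and the jump part of a sample path. -/
def components (y : G.SamplePath) : (Set.Iic G.Δ → ℝ) × (Set.Iic G.Δ → ℝ) :=
  (fun t => y.1.1 t - G.h * y.1.2 t, fun t => y.1.2 t)

theorem measurable_components : Measurable (components (G := G)) := by
  have hx (t) : Measurable fun y : G.SamplePath => y.1.1 t :=
    (measurable_pi_apply t).comp (measurable_fst.comp measurable_subtype_coe)
  have hj (t) : Measurable fun y : G.SamplePath => (y.1.2 t : ℝ) :=
    measurable_from_top.comp ((measurable_pi_apply t).comp
      (measurable_snd.comp measurable_subtype_coe))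
  exact (measurable_pi_lambda _ fun t => (hx t).sub ((hj t).const_mul _)).prodMk
    (measurable_pi_lambda _ hj)

theorem measurableSpace_samplePath_le_comap_components :
    (inferInstance : MeasurableSpace G.SamplePath) ≤
      MeasurableSpace.comap components inferInstance := by
  let recompose (w : (Set.Iic G.Δ → ℝ) × (Set.Iic G.Δ → ℝ)) :
      (Set.Iic G.Δ → ℝ) × (Set.Iic G.Δ → ℕ) := (fun t => w.1 t + G.h * w.2 t, fun t => ⌊w.2 t⌋₊)
  have hrec : Measurable recompose :=
    (measurable_pi_lambda _ fun t => by fun_prop).prodMk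
      (measurable_pi_lambda _ fun t => Nat.measurable_floor.comp (by fun_prop))
  have hval : (Subtype.val : G.SamplePath → _) = recompose ∘ components := by
    funext y
    simp only [recompose, components, Function.comp, sub_add_cancel, Nat.floor_natCast]
  rintro s ⟨t, ht, rfl⟩
  exact ⟨recompose ⁻¹' t, hrec ht, by rw [hval]; rfl⟩

end BanditGame

/-! ### Laws of sample paths in the two states -/

namespace ArmNoise

open BanditGame

variable {G : BanditGame} {Ω : Type*} [MeasurableSpace Ω] (X : ArmNoise G Ω)

/-- Payoff process of a risky arm net of lump sums. -/
noncomputable def drifted (θ : Fin 2) (t : ℝ≥0) (ω : Ω) : ℝ := G.α θ * t + G.σ * X.Z t ω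

/-- Number of lump sums, as a real number. -/
def counted (θ : Fin 2) (t : ℝ≥0) (ω : Ω) : ℝ := X.J θ t ω

theorem measurable_drifted (θ : Fin 2) (t : ℝ≥0) : Measurable (X.drifted θ t) := by
  have := X.wiener.measurable t
  unfold drifted
  fun_prop

theorem measurable_counted (θ : Fin 2) (t : ℝ≥0) : Measurable (X.counted θ t) :=
  measurable_from_top.comp ((X.poisson θ).measurable t)

theorem drifted_zero (θ : Fin 2) (ω : Ω) : X.drifted θ 0 ω = 0 := by
  simp [drifted, X.wiener.zero]

theorem counted_zero (θ : Fin 2) (ω : Ω) : X.counted θ 0 ω = 0 := by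
  simp [counted, (X.poisson θ).zero]

theorem counted_sub (θ : Fin 2) {t u : ℝ≥0} (h : t ≤ u) (ω : Ω) :
    X.counted θ u ω - X.counted θ t ω = (X.J θ u ω - X.J θ t ω : ℕ) :=
  (Nat.cast_sub ((X.poisson θ).monotone ω h)).symm

theorem hasIndepIncrements_drifted (θ : Fin 2) : HasIndepIncrements (X.drifted θ) X.P := by
  intro n t ht
  have := (X.wiener.hasIndepIncrements n t ht).comp
    (fun i x => G.α θ * ((t i.succ : ℝ) - t i.castSucc) + G.σ * x) fun i => by fun_prop
  refine this.congr fun i => .of_forall fun ω => ?_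
  simp only [Function.comp, drifted]
  ring

theorem hasIndepIncrements_counted (θ : Fin 2) : HasIndepIncrements (X.counted θ) X.P := by
  intro n t ht
  have := ((X.poisson θ).indepIncrements n t ht).comp (fun _ (x : ℕ) => (x : ℝ))
    fun _ => measurable_from_top
  exact this.congr fun i =>
    .of_forall fun ω => (X.counted_sub θ (ht (Fin.castSucc_le_succ i)) ω).symm

theorem map_drifted_sub (θ : Fin 2) (t u : ℝ≥0) :
    X.P.map (fun ω => X.drifted θ (t + u) ω - X.drifted θ t ω) =
      gaussianReal (G.α θ * u) (.mk (G.σ ^ 2) (sq_nonneg _) * u) := by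
  have hlaw := X.wiener.hasLaw_sub (t + u) t
  have hdist : nndist (t + u : ℝ≥0).1 t.1 = u := by
    ext
    change dist ((t + u : ℝ≥0) : ℝ) (t : ℝ) = u
    simp
  have hlaw' := (gaussianReal_const_add (gaussianReal_const_mul hlaw G.σ) (G.α θ * u)).map_eq
  simp only [hdist, mul_zero, zero_add, Pi.sub_apply] at hlaw'
  rw [← hlaw']
  congr 1
  funext ω
  simp only [drifted, NNReal.coe_add]
  ring

theorem map_counted_sub (θ : Fin 2) (t u : ℝ≥0) :
    X.P.map (fun ω => X.counted θ (t + u) ω - X.counted θ t ω) =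
      (poissonMeasure (G.lam θ * u)).map (Nat.cast : ℕ → ℝ) := by
  have hm : Measurable fun ω => X.J θ (t + u) ω - X.J θ t ω :=
    ((X.poisson θ).measurable _).sub ((X.poisson θ).measurable _)
  rw [← ((X.poisson θ).hasLaw_increment t u).map_eq, Measure.map_map measurable_from_top hm]
  congr 1
  funext ω
  exact X.counted_sub θ le_self_add ω

theorem measurable_pathUpTo_drifted (θ : Fin 2) : Measurable (pathUpTo G.Δ (X.drifted θ)) :=
  measurable_pathUpTo (X.measurable_drifted θ)

theorem measurable_pathUpTo_counted (θ : Fin 2) : Measurable (pathUpTo G.Δ (X.counted θ)) :=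
  measurable_pathUpTo (X.measurable_counted θ)

theorem map_pathUpTo_drifted :
    X.P.map (pathUpTo G.Δ (X.drifted 1)) =
      (X.P.map (pathUpTo G.Δ (X.drifted 0))).withDensity fun y =>
        expDensity ((G.α 1 - G.α 0) / G.σ ^ 2) ((G.α 1 ^ 2 - G.α 0 ^ 2) / (2 * G.σ ^ 2)) G.Δ
          (terminal y) := by
  have := X.isProb
  refine map_pathUpTo_eq_withDensity (X.measurable_drifted 0) (X.measurable_drifted 1)
    (X.drifted_zero 0) (X.drifted_zero 1) (X.hasIndepIncrements_drifted 0)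
    (X.hasIndepIncrements_drifted 1) fun t u => ?_
  have hσ := G.σ_pos.ne'
  have htilt := gaussianReal_add_mul_eq_withDensity (G.α 0 * u) ((G.α 1 - G.α 0) / G.σ ^ 2)
    (.mk (G.σ ^ 2) (sq_nonneg _) * u)
  rw [map_drifted_sub, map_drifted_sub]
  convert htilt using 2
  · rw [NNReal.coe_mul, NNReal.coe_mk]
    field_simp
    ring
  · funext x
    rw [expDensity, NNReal.coe_mul, NNReal.coe_mk]
    congr 2
    field_simp
    ring

theorem measure_counted_eq_zero (θ : Fin 2) :
    X.P {ω | X.counted θ G.Δ ω = 0} = ENNReal.ofReal (Real.exp (-(G.lam θ * G.Δ))) := by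
  have hlaw := congrArg (fun μ => μ {0}) ((X.poisson θ).hasLaw_increment 0 G.Δ).map_eq
  simp only [zero_add, (X.poisson θ).zero, tsub_zero, poissonMeasure_singleton, pow_zero,
    Nat.factorial_zero, Nat.cast_one, mul_one, div_one, NNReal.coe_mul] at hlaw
  rw [Measure.map_apply ((X.poisson θ).measurable _) (measurableSet_singleton 0)] at hlaw
  rw [← hlaw]
  congr 1
  ext ω
  exact Nat.cast_eq_zero

theorem pathUpTo_counted_eq_zero {θ : Fin 2} {ω : Ω} (h : X.counted θ G.Δ ω = 0) :
    pathUpTo G.Δ (X.counted θ) ω = 0 := by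
  funext t
  have hle : X.J θ t ω ≤ X.J θ G.Δ ω := (X.poisson θ).monotone ω t.2
  exact Nat.cast_eq_zero.2 (Nat.le_zero.1 (hle.trans (Nat.cast_eq_zero.1 h).le))

theorem ae_terminal_eq_zero {θ : Fin 2} (h : G.lam θ = 0) :
    ∀ᵐ y ∂X.P.map (pathUpTo G.Δ (X.counted θ)), y ∈ terminal ⁻¹' {0} := by
  have := X.isProb
  have hm : MeasurableSet {ω | X.counted θ G.Δ ω = 0} :=
    X.measurable_counted θ _ (measurableSet_singleton 0)
  refine (ae_map_iff (X.measurable_pathUpTo_counted θ).aemeasurable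
    (measurable_terminal (measurableSet_singleton 0))).2 ((prob_compl_eq_zero_iff hm).2 ?_)
  rw [X.measure_counted_eq_zero, h]
  simp

theorem map_pathUpTo_counted_restrict_terminal_zero (θ : Fin 2) :
    (X.P.map (pathUpTo G.Δ (X.counted θ))).restrict (terminal ⁻¹' {0}) =
      ENNReal.ofReal (Real.exp (-(G.lam θ * G.Δ))) • Measure.dirac 0 := by
  have hp := X.measurable_pathUpTo_counted θ
  have hm := measurable_terminal (D := G.Δ) (measurableSet_singleton 0)
  rw [Measure.restrict_map hp hm]
  have hae : pathUpTo G.Δ (X.counted θ) =ᵐ[X.P.restrict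
      (pathUpTo G.Δ (X.counted θ) ⁻¹' (terminal ⁻¹' {0}))] fun _ => 0 := by
    filter_upwards [ae_restrict_mem (hp hm)] with ω hω
    exact X.pathUpTo_counted_eq_zero hω
  rw [Measure.map_congr hae, Measure.map_const, Measure.restrict_apply_univ,
    ← X.measure_counted_eq_zero]
  rfl

theorem map_pathUpTo_counted_of_lam_zero_eq_zero (h0 : G.lam 0 = 0) :
    (X.P.map (pathUpTo G.Δ (X.counted 1))).restrict (terminal ⁻¹' inconclusive G) =
      (X.P.map (pathUpTo G.Δ (X.counted 0))).withDensity fun y =>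
        expDensity G.logJump (G.lam 1 - G.lam 0) G.Δ (terminal y) := by
  have hlaw₁ : (X.P.map (pathUpTo G.Δ (X.counted 1))).restrict (terminal ⁻¹' inconclusive G) =
      (X.P.map (pathUpTo G.Δ (X.counted 1))).restrict (terminal ⁻¹' {0}) := by
    rcases eq_or_ne (G.lam 1) 0 with h1 | h1
    · have huniv : inconclusive G = Set.univ := by simp [inconclusive, h1]
      rw [huniv, Set.preimage_univ, Measure.restrict_univ,
        Measure.restrict_eq_self_of_ae_mem (X.ae_terminal_eq_zero h1)]
    · have hzero : inconclusive G = {0} := by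
        ext x
        simp [inconclusive, h0, pos_iff_ne_zero, h1]
      rw [hzero]
  have hlaw₀ : X.P.map (pathUpTo G.Δ (X.counted 0)) = Measure.dirac 0 := by
    rw [← Measure.restrict_eq_self_of_ae_mem (X.ae_terminal_eq_zero h0),
      X.map_pathUpTo_counted_restrict_terminal_zero, h0]
    simp
  rw [hlaw₁, X.map_pathUpTo_counted_restrict_terminal_zero, hlaw₀,
    dirac_withDensity' (by fun_prop)]
  simp [expDensity, terminal, h0]

theorem map_pathUpTo_counted :
    (X.P.map (pathUpTo G.Δ (X.counted 1))).restrict (terminal ⁻¹' inconclusive G) =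
      (X.P.map (pathUpTo G.Δ (X.counted 0))).withDensity fun y =>
        expDensity G.logJump (G.lam 1 - G.lam 0) G.Δ (terminal y) := by
  have := X.isProb
  rcases eq_or_ne (G.lam 0) 0 with h0 | h0
  · exact X.map_pathUpTo_counted_of_lam_zero_eq_zero h0
  have huniv : inconclusive G = Set.univ := by simp [inconclusive, h0]
  rw [huniv, Set.preimage_univ, Measure.restrict_univ]
  refine map_pathUpTo_eq_withDensity (X.measurable_counted 0) (X.measurable_counted 1)
    (X.counted_zero 0) (X.counted_zero 1) (X.hasIndepIncrements_counted 0)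
    (X.hasIndepIncrements_counted 1) fun t u => ?_
  have h0' : 0 < G.lam 0 := pos_iff_ne_zero.2 h0
  have h1 : 0 < G.lam 1 := h0'.trans_le G.lam_le
  have htilt := poissonMeasure_mul_eq_withDensity (div_pos h1 h0') (G.lam 0 * u)
  rw [← mul_assoc, div_mul_cancel₀ _ h0] at htilt
  rw [map_counted_sub, map_counted_sub, htilt,
    ← map_withDensity_comp _ measurable_from_top (by fun_prop)]
  congr 2
  funext n
  have h0r : (G.lam 0 : ℝ) ≠ 0 := NNReal.coe_ne_zero.2 h0
  rw [expDensity, logJump, if_neg h0, NNReal.coe_mul, NNReal.coe_div]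
  congr 3
  field_simp

theorem indepFun_pathUpTo (θ : Fin 2) :
    IndepFun (pathUpTo G.Δ (X.drifted θ)) (pathUpTo G.Δ (X.counted θ)) X.P :=
  (X.indep θ).comp (φ := fun (z : ℝ≥0 → ℝ) (t : Set.Iic G.Δ) => G.α θ * ((t : ℝ≥0) : ℝ) + G.σ * z t)
    (ψ := fun (j : ℝ≥0 → ℕ) (t : Set.Iic G.Δ) => (j t : ℝ))
    (measurable_pi_lambda _ fun t => by fun_prop)
    (measurable_pi_lambda _ fun t => measurable_from_top.comp (measurable_pi_apply _))

theorem map_components_pathLaw (θ : Fin 2) :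
    (X.pathLaw θ).map components =
      (X.P.map (pathUpTo G.Δ (X.drifted θ))).prod (X.P.map (pathUpTo G.Δ (X.counted θ))) := by
  have := X.isProb
  rw [← (indepFun_iff_map_prod_eq_prod_map_map (X.measurable_pathUpTo_drifted θ).aemeasurable
      (X.measurable_pathUpTo_counted θ).aemeasurable).1 (X.indepFun_pathUpTo θ), pathLaw,
    Measure.map_map measurable_components (X.measurable_samplePath θ)]
  congr 1
  funext ω
  simp only [Function.comp, components, samplePath, cumPayoff, add_sub_cancel_right]
  rfl

/-- A sample path is determined by its two components, which are independent, so the density is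
the product of those of the components. -/
theorem pathLaw_restrict_eq_withDensity :
    (X.pathLaw 1).restrict {y | (y.jumps : ℝ) ∈ inconclusive G} =
      (X.pathLaw 0).withDensity fun y => ENNReal.ofReal (likelihoodRatio (.inr y)) := by
  have := X.isProb
  have hcomp := measurable_components (G := G)
  have hm : MeasurableSet
      (Set.univ ×ˢ (terminal ⁻¹' inconclusive G) : Set ((Set.Iic G.Δ → ℝ) × (Set.Iic G.Δ → ℝ))) :=
    .prod .univ (measurable_terminal measurableSet_inconclusive)
  have hpre : {y : G.SamplePath | (y.jumps : ℝ) ∈ inconclusive G} =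
      components ⁻¹' (Set.univ ×ˢ (terminal ⁻¹' inconclusive G)) := by
    ext y
    simp only [Set.mem_preimage, Set.mem_prod, Set.mem_univ, true_and]
    rfl
  refine eq_of_map_eq_of_comap_le hcomp measurableSpace_samplePath_le_comap_components ?_
  simp_rw [ofReal_likelihoodRatio_inr]
  calc ((X.pathLaw 1).restrict {y | (y.jumps : ℝ) ∈ inconclusive G}).map components
      = (X.P.map (pathUpTo G.Δ (X.drifted 1))).prod
          ((X.P.map (pathUpTo G.Δ (X.counted 1))).restrict (terminal ⁻¹' inconclusive G)) := by
        rw [hpre, ← Measure.restrict_map hcomp hm, X.map_components_pathLaw,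
          ← Measure.prod_restrict, Measure.restrict_univ]
    _ = ((X.pathLaw 0).map components).withDensity fun w =>
          expDensity ((G.α 1 - G.α 0) / G.σ ^ 2) ((G.α 1 ^ 2 - G.α 0 ^ 2) / (2 * G.σ ^ 2)) G.Δ
              (terminal w.1) *
            expDensity G.logJump (G.lam 1 - G.lam 0) G.Δ (terminal w.2) := by
        rw [X.map_components_pathLaw, X.map_pathUpTo_counted, map_pathUpTo_drifted,
          prod_withDensity (by fun_prop) (by fun_prop)]
    _ = _ := (map_withDensity_comp _ hcomp (by fun_prop)).symm

end ArmNoise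

/-! ### Mixtures -/

section Mixture

variable {E F : Type*} [MeasurableSpace E] [MeasurableSpace F] {μ ν : Measure E} {p : unitInterval}

/-- Mixture of two measures with weights `p` and `1 - p`. -/
noncomputable def mixture (p : unitInterval) (μ ν : Measure E) : Measure E :=
  ENNReal.ofReal p • μ + ENNReal.ofReal (1 - p) • ν

theorem ofReal_add_ofReal_one_sub (p : unitInterval) :
    ENNReal.ofReal p + ENNReal.ofReal (1 - p) = 1 := by
  rw [← ENNReal.ofReal_add p.2.1 (sub_nonneg.2 p.2.2)]
  simp

instance isProbabilityMeasure_mixture [IsProbabilityMeasure μ] [IsProbabilityMeasure ν] :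
    IsProbabilityMeasure (mixture p μ ν) :=
  ⟨by simp [mixture, ofReal_add_ofReal_one_sub]⟩

theorem mixture_one (μ ν : Measure E) : mixture 1 μ ν = μ := by simp [mixture]

theorem mixture_zero (μ ν : Measure E) : mixture 0 μ ν = ν := by simp [mixture]

theorem map_mixture {f : E → F} (hf : Measurable f) :
    (mixture p μ ν).map f = mixture p (μ.map f) (ν.map f) := by
  rw [mixture, mixture, Measure.map_add _ _ hf, Measure.map_smul, Measure.map_smul]

theorem mixture_prod [SFinite μ] [SFinite ν] (ρ : Measure F) [SFinite ρ] :
    (mixture p μ ν).prod ρ = mixture p (μ.prod ρ) (ν.prod ρ) := by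
  rw [mixture, mixture, Measure.add_prod, Measure.prod_smul_left, Measure.prod_smul_left]

theorem mixture_mixture_comm (p a : unitInterval) (μ₁ μ₀ ν₁ ν₀ : Measure E) :
    mixture p (mixture a μ₁ μ₀) (mixture a ν₁ ν₀) =
      mixture a (mixture p μ₁ ν₁) (mixture p μ₀ ν₀) := by
  simp only [mixture, smul_add, smul_smul, mul_comm (ENNReal.ofReal a),
    mul_comm (ENNReal.ofReal (1 - a))]
  abel

theorem ae_mixture {P : E → Prop} (hμ : ∀ᵐ x ∂μ, P x) (hν : ∀ᵐ x ∂ν, P x) :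
    ∀ᵐ x ∂mixture p μ ν, P x :=
  ae_add_measure_iff.2 ⟨Measure.ae_smul_measure hμ _, Measure.ae_smul_measure hν _⟩

theorem integral_mixture {f : E → ℝ} (hμ : Integrable f μ) (hν : Integrable f ν) :
    ∫ x, f x ∂mixture p μ ν = p * ∫ x, f x ∂μ + (1 - p) * ∫ x, f x ∂ν := by
  rw [mixture, integral_add_measure (hμ.smul_measure ENNReal.ofReal_ne_top)
      (hν.smul_measure ENNReal.ofReal_ne_top), integral_smul_measure, integral_smul_measure,
    ENNReal.toReal_ofReal p.2.1, ENNReal.toReal_ofReal (sub_nonneg.2 p.2.2), smul_eq_mul,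
    smul_eq_mul]

theorem integrable_of_abs_le [IsFiniteMeasure μ] {f : E → ℝ} (hf : Measurable f) {C : ℝ}
    (hC : ∀ x, |f x| ≤ C) : Integrable f μ :=
  .of_bound hf.aestronglyMeasurable C (.of_forall hC)

theorem abs_integral_le_of_abs_le [IsProbabilityMeasure μ] {f : E → ℝ} {C : ℝ}
    (hC : ∀ x, |f x| ≤ C) : |∫ x, f x ∂μ| ≤ C := by
  simpa using norm_integral_le_of_norm_le_const (μ := μ) (f := f) (.of_forall hC)

end Mixture

/-! ### Likelihood ratios and Bayes' rule -/

section Bayes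

variable {E F : Type*} [MeasurableSpace E] [MeasurableSpace F] {μ₁ μ₀ : Measure E} {A : Set E}
  {L : E → ℝ}

/-- `L` is a likelihood ratio of `μ₁` against `μ₀` off the event `A`, which rules out `μ₀`. -/
structure IsLikelihoodRatio (μ₁ μ₀ : Measure E) (A : Set E) (L : E → ℝ) : Prop where
  measurable : Measurable L
  pos : ∀ x, 0 < L x
  measurableSet : MeasurableSet A
  null : μ₀ A = 0
  restrict_compl : μ₁.restrict Aᶜ = μ₀.withDensity fun x => ENNReal.ofReal (L x)

theorem bayesDenominator_pos (p : unitInterval) {l : ℝ} (hl : 0 < l) :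
    0 < (p : ℝ) * l + (1 - p) := by
  rcases p.2.1.eq_or_lt with hp | hp
  · rw [← hp]
    simp
  · exact add_pos_of_pos_of_nonneg (mul_pos hp hl) (sub_nonneg.2 p.2.2)

namespace IsLikelihoodRatio

theorem dirac (hL : Measurable L) (hpos : ∀ x, 0 < L x) (hA : MeasurableSet A) {x : E}
    (hx : x ∉ A) (hLx : L x = 1) : IsLikelihoodRatio (Measure.dirac x) (Measure.dirac x) A L where
  measurable := hL
  pos := hpos
  measurableSet := hA
  null := by rw [Measure.dirac_apply' _ hA, Set.indicator_of_notMem hx]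
  restrict_compl := by
    rw [dirac_withDensity' (by fun_prop), hLx, ENNReal.ofReal_one, one_smul,
      Measure.restrict_eq_self_of_ae_mem (s := Aᶜ) ((ae_dirac_iff hA.compl).2 hx)]

theorem map {g : F → E} (hg : Measurable g) {ν₁ ν₀ : Measure F} (hL : Measurable L)
    (hpos : ∀ x, 0 < L x) (hA : MeasurableSet A)
    (h : IsLikelihoodRatio ν₁ ν₀ (g ⁻¹' A) fun y => L (g y)) :
    IsLikelihoodRatio (ν₁.map g) (ν₀.map g) A L where
  measurable := hL
  pos := hpos
  measurableSet := hA
  null := by rw [Measure.map_apply hg hA, h.null]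
  restrict_compl := by
    rw [Measure.restrict_map hg hA.compl, Set.preimage_compl, h.restrict_compl,
      ← map_withDensity_comp _ hg (by fun_prop)]

theorem mix {ν₁ ν₀ : Measure E} (hμ : IsLikelihoodRatio μ₁ μ₀ A L)
    (hν : IsLikelihoodRatio ν₁ ν₀ A L) (q : unitInterval) :
    IsLikelihoodRatio (mixture q μ₁ ν₁) (mixture q μ₀ ν₀) A L where
  measurable := hμ.measurable
  pos := hμ.pos
  measurableSet := hμ.measurableSet
  null := by simp [mixture, hμ.null, hν.null]
  restrict_compl := by
    rw [mixture, mixture, Measure.restrict_add, Measure.restrict_smul,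
      Measure.restrict_smul, hμ.restrict_compl, hν.restrict_compl, withDensity_add_measure,
      withDensity_smul_measure, withDensity_smul_measure]

theorem prod_right (ρ : Measure F) [SFinite ρ] [SFinite μ₁]
    (h : IsLikelihoodRatio μ₁ μ₀ A L) :
    IsLikelihoodRatio (μ₁.prod ρ) (μ₀.prod ρ) (Prod.fst ⁻¹' A) fun z => L z.1 where
  measurable := h.measurable.comp measurable_fst
  pos z := h.pos z.1
  measurableSet := measurable_fst h.measurableSet
  null := Measure.quasiMeasurePreserving_fst.preimage_null h.null
  restrict_compl := by
    have hm := h.measurable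
    rw [← Set.preimage_compl, ← Set.prod_univ, ← Measure.prod_restrict, h.restrict_compl,
      Measure.restrict_univ, prod_withDensity_left (by fun_prop)]

theorem pi {ι : Type*} [Fintype ι] {ν₁ ν₀ : ι → Measure E} [∀ i, IsProbabilityMeasure (ν₁ i)]
    [∀ i, IsProbabilityMeasure (ν₀ i)] (h : ∀ i, IsLikelihoodRatio (ν₁ i) (ν₀ i) A L)
    (hL : Measurable L) (hpos : ∀ x, 0 < L x) (hA : MeasurableSet A) :
    IsLikelihoodRatio (Measure.pi ν₁) (Measure.pi ν₀) {x | ∃ i, x i ∈ A}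
      fun x => ∏ i, L (x i) := by
  have hcompl : {x : ι → E | ∃ i, x i ∈ A}ᶜ = Set.univ.pi fun _ => Aᶜ := by
    ext x
    simp
  have hm : MeasurableSet {x : ι → E | ∃ i, x i ∈ A} := by
    rw [← MeasurableSet.compl_iff, hcompl]
    exact .univ_pi fun _ => hA.compl
  refine ⟨by fun_prop, fun x => Finset.prod_pos fun i _ => hpos _, hm, ?_, ?_⟩
  · rw [← prob_compl_eq_one_iff hm, hcompl, Measure.pi_pi]
    exact Finset.prod_eq_one fun i _ => (prob_compl_eq_one_iff hA).2 (h i).null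
  · have (i : ι) : SigmaFinite ((ν₀ i).withDensity fun x => ENNReal.ofReal (L x)) := by
      rw [← (h i).restrict_compl]
      infer_instance
    rw [hcompl, Measure.restrict_pi_pi]
    simp_rw [(h _).restrict_compl]
    rw [pi_withDensity _ fun _ => by fun_prop]
    simp_rw [ENNReal.ofReal_prod_of_nonneg fun _ _ => (hpos _).le]

variable {b : E → unitInterval} {p : unitInterval}

theorem mixture_eq (h : IsLikelihoodRatio μ₁ μ₀ A L) (p : unitInterval) :
    mixture p μ₁ μ₀ =
      μ₀.withDensity (fun x => ENNReal.ofReal (p * L x + (1 - p))) +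
        ENNReal.ofReal p • μ₁.restrict A := by
  have hm := h.measurable
  have hdens : (fun x => ENNReal.ofReal (p * L x + (1 - p))) =
      (ENNReal.ofReal p • fun x => ENNReal.ofReal (L x)) + fun _ => ENNReal.ofReal (1 - p) := by
    funext x
    rw [Pi.add_apply, Pi.smul_apply, smul_eq_mul, ← ENNReal.ofReal_mul p.2.1,
      ← ENNReal.ofReal_add (mul_nonneg p.2.1 (h.pos x).le) (sub_nonneg.2 p.2.2)]
  rw [hdens, withDensity_add_right _ measurable_const, withDensity_const,
    withDensity_smul _ (by fun_prop), ← h.restrict_compl, add_right_comm, ← smul_add,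
    Measure.restrict_compl_add_restrict h.measurableSet, mixture]

/-- Bayes' rule for the hypothesis that makes `A` possible. -/
theorem smul_eq_withDensity (h : IsLikelihoodRatio μ₁ μ₀ A L) (hb : Measurable b)
    (hbA : ∀ x ∈ A, b x = 1) (hbL : ∀ x ∉ A, (b x : ℝ) = p * L x / (p * L x + (1 - p))) :
    ENNReal.ofReal p • μ₁ =
      (mixture p μ₁ μ₀).withDensity fun x => ENNReal.ofReal (b x) := by
  have hm := h.measurable
  have hon : (μ₁.restrict A).withDensity (fun x => ENNReal.ofReal (b x)) = μ₁.restrict A := by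
    refine (withDensity_congr_ae (g := 1) ?_).trans withDensity_one
    filter_upwards [ae_restrict_mem h.measurableSet] with x hx
    simp [hbA x hx]
  have hoff : μ₀.withDensity ((fun x => ENNReal.ofReal (p * L x + (1 - p))) *
        fun x => ENNReal.ofReal (b x)) =
      μ₀.withDensity (ENNReal.ofReal p • fun x => ENNReal.ofReal (L x)) := by
    refine withDensity_congr_ae ?_
    filter_upwards [measure_eq_zero_iff_ae_notMem.1 h.null] with x hx
    have hden := bayesDenominator_pos p (h.pos x)
    rw [Pi.mul_apply, Pi.smul_apply, smul_eq_mul, ← ENNReal.ofReal_mul hden.le,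
      ← ENNReal.ofReal_mul p.2.1, hbL x hx, mul_div_cancel₀ _ hden.ne']
  rw [h.mixture_eq, withDensity_add_measure, withDensity_smul_measure, hon,
    ← withDensity_mul _ (by fun_prop) (by fun_prop), hoff, withDensity_smul _ (by fun_prop),
    ← h.restrict_compl, ← smul_add, Measure.restrict_compl_add_restrict h.measurableSet]

theorem smul_eq_withDensity_one_sub [IsFiniteMeasure μ₁] (h : IsLikelihoodRatio μ₁ μ₀ A L)
    (hb : Measurable b) (hbA : ∀ x ∈ A, b x = 1)
    (hbL : ∀ x ∉ A, (b x : ℝ) = p * L x / (p * L x + (1 - p))) :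
    ENNReal.ofReal (1 - p) • μ₀ =
      (mixture p μ₁ μ₀).withDensity fun x => ENNReal.ofReal (1 - b x) := by
  have hsum : ((fun x => ENNReal.ofReal (b x)) + fun x => ENNReal.ofReal (1 - b x)) = 1 :=
    funext fun x => ofReal_add_ofReal_one_sub (b x)
  have : IsFiniteMeasure (ENNReal.ofReal p • μ₁) :=
    Measure.smul_finite _ ENNReal.ofReal_ne_top
  rw [← Measure.add_right_inj (ENNReal.ofReal p • μ₁)]
  nth_rw 2 [h.smul_eq_withDensity hb hbA hbL]
  rw [← withDensity_add_left (by fun_prop), hsum, withDensity_one, mixture]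

theorem integral_bayes [IsProbabilityMeasure μ₁] [IsProbabilityMeasure μ₀]
    (h : IsLikelihoodRatio μ₁ μ₀ A L) (hb : Measurable b) (hbA : ∀ x ∈ A, b x = 1)
    (hbL : ∀ x ∉ A, (b x : ℝ) = p * L x / (p * L x + (1 - p))) {f₁ f₀ : E → ℝ}
    (h₁ : Measurable f₁) (h₀ : Measurable f₀) {C : ℝ} (hC₁ : ∀ x, |f₁ x| ≤ C)
    (hC₀ : ∀ x, |f₀ x| ≤ C) :
    p * ∫ x, f₁ x ∂μ₁ + (1 - p) * ∫ x, f₀ x ∂μ₀ =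
      ∫ x, (b x * f₁ x + (1 - b x) * f₀ x) ∂mixture p μ₁ μ₀ := by
  have hweighted (w : E → ℝ) (f : E → ℝ) (hw : Measurable w) (hf : Measurable f)
      (hw₀ : ∀ x, 0 ≤ w x) (hw₁ : ∀ x, w x ≤ 1) (hC : ∀ x, |f x| ≤ C) :
      Integrable (fun x => w x * f x) (mixture p μ₁ μ₀) :=
    integrable_of_abs_le (hw.mul hf) fun x => by
      rw [abs_mul, abs_of_nonneg (hw₀ x)]
      exact (mul_le_of_le_one_left (abs_nonneg _) (hw₁ x)).trans (hC x)
  have hdensity (c : ℝ) (hc : 0 ≤ c) (μ : Measure E) (w f : E → ℝ) (hw : Measurable w)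
      (hw₀ : ∀ x, 0 ≤ w x) (heq : ENNReal.ofReal c • μ =
        (mixture p μ₁ μ₀).withDensity fun x => ENNReal.ofReal (w x)) :
      c * ∫ x, f x ∂μ = ∫ x, w x * f x ∂mixture p μ₁ μ₀ := by
    have := integral_smul_measure (μ := μ) f (ENNReal.ofReal c)
    rw [heq, ENNReal.toReal_ofReal hc, integral_withDensity_eq_integral_toReal_smul (by fun_prop)
      (.of_forall fun _ => ENNReal.ofReal_lt_top)] at this
    simpa only [ENNReal.toReal_ofReal (hw₀ _), smul_eq_mul] using this.symm
  rw [hdensity p p.2.1 μ₁ _ f₁ (by fun_prop) (fun x => (b x).2.1)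
      (h.smul_eq_withDensity hb hbA hbL),
    hdensity (1 - p) (sub_nonneg.2 p.2.2) μ₀ _ f₀ (by fun_prop) (fun x => sub_nonneg.2 (b x).2.2)
      (h.smul_eq_withDensity_one_sub hb hbA hbL)]
  exact (integral_add
    (hweighted _ f₁ (by fun_prop) h₁ (fun x => (b x).2.1) (fun x => (b x).2.2) hC₁)
    (hweighted _ f₀ (by fun_prop) h₀ (fun x => sub_nonneg.2 (b x).2.2)
      (fun x => sub_le_self _ (b x).2.1) hC₀)).symm

end IsLikelihoodRatio

end Bayes

namespace BanditGame

variable {G : BanditGame} {Ω : Type*} [MeasurableSpace Ω] (X : ArmNoise G Ω)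

/-! ### Observations of one period -/

@[fun_prop]
theorem measurable_likelihoodRatio : Measurable (likelihoodRatio (G := G)) := by
  refine measurable_fun_sum measurable_const ?_
  have : Measurable fun y : G.SamplePath => (y.jumps : ℝ) :=
    measurable_from_top.comp measurable_jumps
  have hpow : Measurable fun y : G.SamplePath =>
      (if G.lam 0 = 0 then 1 else (G.lam 1 / G.lam 0 : ℝ)) ^ y.jumps :=
    measurable_from_top.comp measurable_jumps
  exact Measurable.mul (by fun_prop) hpow

/-- Observations of one player that reveal state `1` with certainty. -/
def conclusiveObs (G : BanditGame) : Set G.Obs := {o | G.lam 0 = 0 ∧ 0 < G.lam 1 ∧ HasJump o}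

theorem inl_notMem_conclusiveObs (u : Unit) : (.inl u : G.Obs) ∉ conclusiveObs G :=
  fun h => h.2.2

theorem inr_mem_conclusiveObs_iff {y : G.SamplePath} :
    .inr y ∈ conclusiveObs G ↔ (y.jumps : ℝ) ∉ inconclusive G := by
  simp [conclusiveObs, inconclusive, HasJump, pos_iff_ne_zero]

theorem measurableSet_conclusiveObs : MeasurableSet (conclusiveObs G) := by
  refine measurableSet_sum_iff.2 ⟨?_, ?_⟩
  · convert MeasurableSet.empty
    ext u
    simpa using inl_notMem_conclusiveObs u
  · have : Measurable fun y : G.SamplePath => (y.jumps : ℝ) :=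
      measurable_from_top.comp measurable_jumps
    exact (congrArg MeasurableSet (Set.ext fun _ => inr_mem_conclusiveObs_iff)).mpr
      (this measurableSet_inconclusive.compl)

theorem pathLaw_zero_preimage_conclusiveObs :
    X.pathLaw 0 (Sum.inr ⁻¹' conclusiveObs G) = 0 := by
  rw [ArmNoise.pathLaw, Measure.map_apply (X.measurable_samplePath 0)
    (measurable_inr measurableSet_conclusiveObs)]
  by_cases h0 : G.lam 0 = 0
  · refine measure_mono_null (fun ω hω => ?_)
      (ae_of_ae_map (X.measurable_pathUpTo_counted 0).aemeasurable (X.ae_terminal_eq_zero h0))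
    exact fun h => inr_mem_conclusiveObs_iff.1 hω fun _ _ => h
  · simp [conclusiveObs, h0]

theorem isLikelihoodRatio_pathLaw :
    IsLikelihoodRatio (X.pathLaw 1) (X.pathLaw 0) (Sum.inr ⁻¹' conclusiveObs G)
      fun y => likelihoodRatio (.inr y) where
  measurable := measurable_likelihoodRatio.comp measurable_inr
  pos _ := likelihoodRatio_pos _
  measurableSet := measurable_inr measurableSet_conclusiveObs
  null := pathLaw_zero_preimage_conclusiveObs X
  restrict_compl := by
    rw [← X.pathLaw_restrict_eq_withDensity]
    congr 1
    ext y
    exact inr_mem_conclusiveObs_iff.not_left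

/-- Law of the observation about a player who uses the risky arm with probability `q`,
conditional on the state `θ`. -/
noncomputable def obsLaw (θ : Fin 2) (q : unitInterval) : Measure G.Obs :=
  mixture q ((X.pathLaw θ).map .inr) (.dirac (.inl ()))

instance (θ : Fin 2) : IsProbabilityMeasure ((X.pathLaw θ).map (.inr : G.SamplePath → G.Obs)) :=
  Measure.isProbabilityMeasure_map measurable_inr.aemeasurable

instance (θ : Fin 2) (q : unitInterval) : IsProbabilityMeasure (obsLaw X θ q) :=
  isProbabilityMeasure_mixture

theorem obsLaw_one (θ : Fin 2) : obsLaw X θ 1 = (X.pathLaw θ).map .inr := mixture_one _ _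

theorem obsLaw_zero (θ : Fin 2) : obsLaw X θ 0 = .dirac (.inl ()) := mixture_zero _ _

theorem obsLaw_eq_mixture (θ : Fin 2) (q : unitInterval) :
    obsLaw X θ q = mixture q (obsLaw X θ 1) (obsLaw X θ 0) := by
  rw [obsLaw_one, obsLaw_zero, obsLaw]

theorem isLikelihoodRatio_obsLaw (q : unitInterval) :
    IsLikelihoodRatio (obsLaw X 1 q) (obsLaw X 0 q) (conclusiveObs G) likelihoodRatio :=
  (IsLikelihoodRatio.map measurable_inr measurable_likelihoodRatio likelihoodRatio_pos
    measurableSet_conclusiveObs (isLikelihoodRatio_pathLaw X)).mix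
    (.dirac measurable_likelihoodRatio likelihoodRatio_pos measurableSet_conclusiveObs
      (inl_notMem_conclusiveObs ()) rfl) q

section Profile

variable {ι : Type} [Fintype ι]

theorem bayesUpdate_of_mem (p : unitInterval) {o : ι → G.Obs}
    (ho : ∃ i, o i ∈ conclusiveObs G) : bayesUpdate p o = 1 := by
  obtain ⟨i, h0, h1, hi⟩ := ho
  exact if_pos ⟨h0, h1, i, hi⟩

theorem bayesUpdate_of_notMem (p : unitInterval) {o : ι → G.Obs}
    (ho : ¬∃ i, o i ∈ conclusiveObs G) :
    (bayesUpdate p o : ℝ) = p * (∏ i, likelihoodRatio (o i)) /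
      (p * (∏ i, likelihoodRatio (o i)) + (1 - p)) := by
  rw [bayesUpdate, if_neg]
  rintro ⟨h0, h1, i, hi⟩
  exact ho ⟨i, h0, h1, hi⟩

@[fun_prop]
theorem measurable_bayesUpdate :
    Measurable fun x : unitInterval × (ι → G.Obs) => bayesUpdate x.1 x.2 := by
  classical
  have hA : MeasurableSet {x : unitInterval × (ι → G.Obs) | ∃ i, x.2 i ∈ conclusiveObs G} := by
    rw [Set.ofPred_exists]
    exact .iUnion fun i => (by fun_prop : Measurable fun x : unitInterval × (ι → G.Obs) => x.2 i)
      measurableSet_conclusiveObs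
  have hval : (fun x : unitInterval × (ι → G.Obs) => (bayesUpdate x.1 x.2 : ℝ)) =
    fun x : unitInterval × (ι → G.Obs) =>
      if ∃ i, x.2 i ∈ conclusiveObs G then 1
      else x.1 * (∏ i, likelihoodRatio (x.2 i)) /
        (x.1 * (∏ i, likelihoodRatio (x.2 i)) + (1 - x.1)) := by
    funext x
    split_ifs with h
    · rw [bayesUpdate_of_mem _ h, Set.Icc.coe_one]
    · exact bayesUpdate_of_notMem _ h
  refine Measurable.subtype_mk (f := fun x : unitInterval × (ι → G.Obs) =>
    (bayesUpdate x.1 x.2 : ℝ)) (h := fun x => (bayesUpdate x.1 x.2).2) ?_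
  rw [hval]
  exact Measurable.ite hA measurable_const (by fun_prop)

theorem measurable_bayesUpdate_right (p : unitInterval) :
    Measurable fun o : ι → G.Obs => bayesUpdate p o :=
  measurable_bayesUpdate.comp measurable_prodMk_left

/-- Law of the observations about all players who use the mixed actions `q`, conditional on the
state `θ`. -/
noncomputable def stageLaw (θ : Fin 2) (q : ι → unitInterval) : Measure (ι → G.Obs) :=
  Measure.pi fun i => obsLaw X θ (q i)

instance (θ : Fin 2) (q : ι → unitInterval) : IsProbabilityMeasure (stageLaw X θ q) := by
  unfold stageLaw
  infer_instance

theorem isLikelihoodRatio_stageLaw (q : ι → unitInterval) :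
    IsLikelihoodRatio (stageLaw X 1 q) (stageLaw X 0 q) {o | ∃ i, o i ∈ conclusiveObs G}
      fun o => ∏ i, likelihoodRatio (o i) :=
  .pi (fun i => isLikelihoodRatio_obsLaw X (q i)) measurable_likelihoodRatio likelihoodRatio_pos
    measurableSet_conclusiveObs

theorem stageLaw_update [DecidableEq ι] (θ : Fin 2) (q : ι → unitInterval) (n : ι)
    (a : unitInterval) :
    stageLaw X θ (Function.update q n a) =
      mixture a (stageLaw X θ (Function.update q n 1)) (stageLaw X θ (Function.update q n 0)) := by
  refine Measure.pi_eq fun s _ => ?_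
  have hprod (b : unitInterval) : ∏ i, obsLaw X θ (Function.update q n b i) (s i) =
      obsLaw X θ b (s n) * ∏ i ∈ Finset.univ.erase n, obsLaw X θ (q i) (s i) := by
    rw [← Finset.mul_prod_erase _ _ (Finset.mem_univ n), Function.update_self]
    congr 1
    refine Finset.prod_congr rfl fun i hi => ?_
    rw [Function.update_of_ne (Finset.ne_of_mem_erase hi)]
  rw [mixture, Measure.add_apply, Measure.smul_apply, Measure.smul_apply, stageLaw, stageLaw,
    Measure.pi_pi, Measure.pi_pi, hprod, hprod, hprod, obsLaw_eq_mixture X θ a]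
  simp only [mixture, Measure.add_apply, Measure.smul_apply, smul_eq_mul]
  ring

end Profile

/-! ### Pure actions -/

theorem observe_one (v : unitInterval) (y : G.SamplePath) : observe 1 v y = .inr y := by
  simp [observe]

theorem observe_zero (v : unitInterval) (y : G.SamplePath) : observe 0 v y = .inl () := by
  simp [observe]

theorem measurable_observe_of_pure {a : unitInterval} (ha : a = 0 ∨ a = 1) (v : unitInterval) :
    Measurable (observe (G := G) a v) := by
  rcases ha with rfl | rfl
  · simpa only [funext (observe_zero (G := G) v)] using measurable_const
  · simpa only [funext (observe_one (G := G) v)] using measurable_inr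

theorem map_observe_of_pure (θ : Fin 2) {a : unitInterval} (ha : a = 0 ∨ a = 1)
    (v : unitInterval) : (X.pathLaw θ).map (observe a v) = obsLaw X θ a := by
  rcases ha with rfl | rfl
  · simp [funext (observe_zero (G := G) v), obsLaw_zero]
  · rw [funext (observe_one (G := G) v), obsLaw_one]

theorem ae_isRight_obsLaw (θ : Fin 2) {a : unitInterval} (ha : a = 0 ∨ a = 1) :
    ∀ᵐ o ∂obsLaw X θ a, o.isRight ↔ a = 1 := by
  have hm : MeasurableSet {o : G.Obs | o.isRight ↔ a = 1} :=
    measurableSet_sum_iff.2 ⟨by simp, by simp⟩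
  rw [← map_observe_of_pure X θ ha 0,
    ae_map_iff (measurable_observe_of_pure ha 0).aemeasurable hm]
  rcases ha with rfl | rfl
  · simp [observe_zero]
  · simp [observe_one]

section Profile

variable {ι κ : Type} [Fintype ι] [Fintype κ]

theorem stageLaw_of_pure (θ : Fin 2) {q : ι → unitInterval} (hq : ∀ i, q i = 0 ∨ q i = 1) :
    stageLaw X θ q =
      (Measure.pi fun _ : ι => X.pathLaw θ).map fun y i => observe (q i) 0 (y i) := by
  have hlaw (i : ι) := map_observe_of_pure X θ (hq i) 0
  have (i : ι) : IsProbabilityMeasure ((X.pathLaw θ).map (observe (q i) 0)) := by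
    rw [hlaw]
    infer_instance
  rw [stageLaw, Measure.pi_map_pi fun i => (measurable_observe_of_pure (hq i) 0).aemeasurable]
  simp_rw [hlaw]

theorem bayesUpdate_comp (p : unitInterval) {e : κ → ι} (he : Function.Injective e)
    {o : ι → G.Obs} (ho : ∀ i ∉ Set.range e, o i = .inl ()) :
    bayesUpdate p (fun k => o (e k)) = bayesUpdate p o := by
  classical
  have hprod : ∏ k, likelihoodRatio (o (e k)) = ∏ i, likelihoodRatio (o i) := by
    rw [← Finset.prod_image (s := Finset.univ) (g := e) (f := fun i => likelihoodRatio (o i))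
      fun _ _ _ _ h => he h]
    refine Finset.prod_subset (Finset.subset_univ _) fun i _ hi => ?_
    rw [ho i (by simpa using hi), likelihoodRatio]
  have hjump : (∃ k, HasJump (o (e k))) ↔ ∃ i, HasJump (o i) := by
    refine ⟨fun ⟨k, hk⟩ => ⟨e k, hk⟩, fun ⟨i, hi⟩ => ?_⟩
    by_cases h : i ∈ Set.range e
    · obtain ⟨k, rfl⟩ := h
      exact ⟨k, hi⟩
    · rw [ho i h] at hi
      exact hi.elim
  simp only [bayesUpdate, hprod, hjump]

theorem map_pi_comp_of_injective {ι κ E : Type*} [Fintype ι] [Fintype κ] [MeasurableSpace E]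
    (μ : Measure E) [IsProbabilityMeasure μ] {e : κ → ι} (he : Function.Injective e) :
    (Measure.pi fun _ : ι => μ).map (fun y k => y (e k)) = Measure.pi fun _ : κ => μ := by
  have hindep := (iIndepFun_pi (μ := fun _ : ι => μ) (X := fun _ => id)
    fun _ => aemeasurable_id).precomp he
  refine (hindep.map_fun_eq_pi_map fun k => (measurable_pi_apply (e k)).aemeasurable).trans ?_
  congr 1
  funext k
  exact (measurePreserving_eval (fun _ : ι => μ) (e k)).map_eq

theorem measurable_bayesUpdate_inr (p : unitInterval) :
    Measurable fun y : ι → G.SamplePath => bayesUpdate p fun i => (.inr (y i) : G.Obs) :=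
  (measurable_bayesUpdate_right p).comp
    (measurable_pi_lambda _ fun i => measurable_inr.comp (measurable_pi_apply i))

/-- Only the sample paths of the `K` arms in use matter for the posterior. -/
theorem map_bayesUpdate_stageLaw (θ : Fin 2) (p : unitInterval) {q : ι → unitInterval}
    (hq : ∀ i, q i = 0 ∨ q i = 1) {K : ℕ} (hK : Nat.card {i // q i = 1} = K) :
    (stageLaw X θ q).map (bayesUpdate p) = (Measure.pi fun _ : Fin K => X.pathLaw θ).map
      fun y => bayesUpdate p fun i => (.inr (y i) : G.Obs) := by
  let users : Fin K ≃ {i // q i = 1} := (Finite.equivFinOfCardEq hK).symm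
  have hinj : Function.Injective fun k => (users k : ι) :=
    Subtype.val_injective.comp users.injective
  have hobs : Measurable fun (y : ι → G.SamplePath) i => observe (q i) 0 (y i) :=
    measurable_pi_lambda _ fun i =>
      (measurable_observe_of_pure (hq i) 0).comp (measurable_pi_apply i)
  rw [stageLaw_of_pure X θ hq, ← map_pi_comp_of_injective (X.pathLaw θ) hinj,
    Measure.map_map (measurable_bayesUpdate_right p) hobs,
    Measure.map_map (measurable_bayesUpdate_inr p)
      (measurable_pi_lambda _ fun k => measurable_pi_apply (users k : ι))]
  congr 1
  funext y
  rw [Function.comp_apply, ← bayesUpdate_comp p hinj]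
  · simp only [(users _).2, observe_one, Function.comp]
  · intro i hi
    have hi0 : q i = 0 := (hq i).resolve_right fun h => hi ⟨users.symm ⟨i, h⟩, by simp⟩
    rw [hi0, observe_zero]

end Profile

/-! ### Outcomes of one period -/

/-- Outcome of a period: the observations about all players and the next draw of the public
randomization device. -/
abbrev Outcome (G : BanditGame) : Type := (Fin G.N → G.Obs) × unitInterval

/-- Law of the outcome of a period, conditional on the state `θ`. -/
noncomputable def outcomeLaw (θ : Fin 2) (q : Fin G.N → unitInterval) : Measure G.Outcome :=
  (stageLaw X θ q).prod volume

instance (θ : Fin 2) (q : Fin G.N → unitInterval) : IsProbabilityMeasure (outcomeLaw X θ q) := by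
  unfold outcomeLaw
  infer_instance

/-- Law of the outcome of a period at the common belief `p`. -/
noncomputable def mixedOutcomeLaw (p : unitInterval) (q : Fin G.N → unitInterval) :
    Measure G.Outcome :=
  mixture p (outcomeLaw X 1 q) (outcomeLaw X 0 q)

instance (p : unitInterval) (q : Fin G.N → unitInterval) :
    IsProbabilityMeasure (mixedOutcomeLaw X p q) :=
  isProbabilityMeasure_mixture

@[fun_prop]
theorem measurable_bayesUpdate_fst (p : unitInterval) :
    Measurable fun z : G.Outcome => bayesUpdate p z.1 :=
  (measurable_bayesUpdate_right p).comp measurable_fst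

theorem integral_bayes (p : unitInterval) (q : Fin G.N → unitInterval) {f₁ f₀ : G.Outcome → ℝ}
    (h₁ : Measurable f₁) (h₀ : Measurable f₀) {C : ℝ} (hC₁ : ∀ z, |f₁ z| ≤ C)
    (hC₀ : ∀ z, |f₀ z| ≤ C) :
    p * ∫ z, f₁ z ∂(outcomeLaw X 1 q) + (1 - p) * ∫ z, f₀ z ∂(outcomeLaw X 0 q) =
      ∫ z, (bayesUpdate p z.1 * f₁ z + (1 - bayesUpdate p z.1) * f₀ z)
        ∂(mixedOutcomeLaw X p q) :=
  ((isLikelihoodRatio_stageLaw X q).prod_right volume).integral_bayes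
    (measurable_bayesUpdate_fst p) (fun _ => bayesUpdate_of_mem p)
    (fun _ => bayesUpdate_of_notMem p) h₁ h₀ hC₁ hC₀

theorem mixedOutcomeLaw_update (p : unitInterval) (q : Fin G.N → unitInterval) (n : Fin G.N)
    (a : unitInterval) :
    mixedOutcomeLaw X p (Function.update q n a) =
      mixture a (mixedOutcomeLaw X p (Function.update q n 1))
        (mixedOutcomeLaw X p (Function.update q n 0)) := by
  simp only [mixedOutcomeLaw, outcomeLaw]
  rw [stageLaw_update X 1 q n a, stageLaw_update X 0 q n a, mixture_prod, mixture_prod,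
    mixture_mixture_comm]

theorem integral_mixedOutcomeLaw_update (p : unitInterval) (q : Fin G.N → unitInterval)
    (n : Fin G.N) (a : unitInterval) {f : G.Outcome → ℝ} (hf : Measurable f) {C : ℝ}
    (hC : ∀ z, |f z| ≤ C) :
    ∫ z, f z ∂(mixedOutcomeLaw X p (Function.update q n a)) =
      a * ∫ z, f z ∂(mixedOutcomeLaw X p (Function.update q n 1)) +
        (1 - a) * ∫ z, f z ∂(mixedOutcomeLaw X p (Function.update q n 0)) := by
  rw [mixedOutcomeLaw_update,
    integral_mixture (integrable_of_abs_le hf hC) (integrable_of_abs_le hf hC)]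

theorem ae_isRight_mixedOutcomeLaw (p : unitInterval) {q : Fin G.N → unitInterval}
    (hq : ∀ i, q i = 0 ∨ q i = 1) :
    ∀ᵐ z ∂(mixedOutcomeLaw X p q), ∀ i, ((z.1 i).isRight ↔ q i = 1) := by
  have hstate (θ : Fin 2) : ∀ᵐ z ∂(outcomeLaw X θ q), ∀ i, ((z.1 i).isRight ↔ q i = 1) :=
    Measure.quasiMeasurePreserving_fst.ae <| Filter.eventually_all.2 fun i =>
      (Measure.tendsto_eval_ae_ae (μ := fun i => obsLaw X θ (q i)) (i := i)).eventually
        (ae_isRight_obsLaw X θ (hq i))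
  exact ae_mixture (hstate 1) (hstate 0)

theorem map_bayesUpdate_mixedOutcomeLaw (p : unitInterval) {q : Fin G.N → unitInterval}
    (hq : ∀ i, q i = 0 ∨ q i = 1) {K : ℕ} (hK : Nat.card {i // q i = 1} = K) :
    (mixedOutcomeLaw X p q).map (fun z => bayesUpdate p z.1) = beliefLaw X K p := by
  have hstate (θ : Fin 2) : (outcomeLaw X θ q).map (fun z => bayesUpdate p z.1) =
      (stageLaw X θ q).map (bayesUpdate p) := by
    change (outcomeLaw X θ q).map (bayesUpdate p ∘ Prod.fst) = _
    rw [← Measure.map_map (measurable_bayesUpdate_right p) measurable_fst, outcomeLaw,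
      Measure.map_fst_prod, measure_univ, one_smul]
  rw [mixedOutcomeLaw, map_mixture (measurable_bayesUpdate_fst p), hstate, hstate,
    map_bayesUpdate_stageLaw X 1 p hq hK, map_bayesUpdate_stageLaw X 0 p hq hK,
    ← map_mixture (measurable_bayesUpdate_inr p)]
  rfl

theorem integral_mixedOutcomeLaw_of_pure (p : unitInterval) {q : Fin G.N → unitInterval}
    (hq : ∀ i, q i = 0 ∨ q i = 1) {K : ℕ} (hK : Nat.card {i // q i = 1} = K)
    {w : unitInterval → ℝ} (hw : Measurable w) :
    ∫ z, w (bayesUpdate p z.1) ∂(mixedOutcomeLaw X p q) = expect X K w p := by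
  rw [expect, ← map_bayesUpdate_mixedOutcomeLaw X p hq hK,
    integral_map (measurable_bayesUpdate_fst p).aemeasurable hw.aestronglyMeasurable]

end BanditGame

section Product

variable {E F H : Type*} [MeasurableSpace E] [MeasurableSpace F] [MeasurableSpace H]

/-- The sequence with first term `a.1` and remaining terms `a.2`. -/
def seqCons (a : E × (ℕ → E)) : ℕ → E
  | 0 => a.1
  | k + 1 => a.2 k

@[fun_prop]
theorem measurable_seqCons : Measurable (seqCons (E := E)) := by
  refine measurable_pi_lambda _ fun k => ?_
  cases k with
  | zero => exact measurable_fst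
  | succ k => exact (measurable_pi_apply k).comp measurable_snd

omit [MeasurableSpace E] in
open Classical in
theorem seqCons_preimage_pi (s : Finset ℕ) (t : ℕ → Set E) :
    seqCons ⁻¹' Set.pi s t = (if 0 ∈ s then t 0 else Set.univ) ×ˢ
      Set.pi (s.preimage Nat.succ Nat.succ_injective.injOn : Set ℕ) fun k => t (k + 1) := by
  ext ⟨a, d⟩
  rw [Set.mem_preimage, Set.mem_pi, ← Nat.and_forall_add_one]
  by_cases h0 : 0 ∈ s <;> simp [h0, seqCons]

theorem map_seqCons (ν : Measure E) [IsProbabilityMeasure ν] :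
    (ν.prod (Measure.infinitePi fun _ : ℕ => ν)).map seqCons =
      Measure.infinitePi fun _ : ℕ => ν := by
  classical
  refine Measure.eq_infinitePi (μ := fun _ : ℕ => ν) fun s t ht => ?_
  rw [Measure.map_apply measurable_seqCons (.pi s.countable_toSet fun i _ => ht i),
    seqCons_preimage_pi, Measure.prod_prod, Measure.infinitePi_pi _ fun i _ => ht (i + 1)]
  have hs : (s.preimage Nat.succ Nat.succ_injective.injOn).map ⟨_, Nat.succ_injective⟩ =
      s.erase 0 := by
    ext k
    cases k <;> simp
  have htail := Finset.prod_map (s.preimage Nat.succ Nat.succ_injective.injOn)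
    ⟨_, Nat.succ_injective⟩ fun k => ν (t k)
  rw [hs] at htail
  refine (congrArg _ htail.symm).trans ?_
  split_ifs with h0
  · exact Finset.mul_prod_erase s (fun k => ν (t k)) h0
  · rw [measure_univ, one_mul, Finset.erase_eq_of_notMem h0]

theorem map_prod_ite (μ : Measure E) (ν : Measure F) [SFinite ν] {R : Set E}
    [DecidablePred (· ∈ R)] (hR : MeasurableSet R) {f g : F → H} (hf : Measurable f)
    (hg : Measurable g) :
    (μ.prod ν).map (fun e => if e.1 ∈ R then f e.2 else g e.2) =
      μ R • ν.map f + μ Rᶜ • ν.map g := by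
  ext T hT
  have hm : Measurable fun e : E × F => if e.1 ∈ R then f e.2 else g e.2 :=
    .ite (measurable_fst hR) (hf.comp measurable_snd) (hg.comp measurable_snd)
  have hpre : (fun e : E × F => if e.1 ∈ R then f e.2 else g e.2) ⁻¹' T =
      (R ×ˢ (f ⁻¹' T)) ∪ (Rᶜ ×ˢ (g ⁻¹' T)) := by
    ext e
    by_cases he : e.1 ∈ R <;> simp [he]
  have hdisj : Disjoint (R ×ˢ (f ⁻¹' T)) (Rᶜ ×ˢ (g ⁻¹' T)) :=
    Set.Disjoint.set_prod_left disjoint_compl_right _ _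
  rw [Measure.map_apply hm hT, hpre, measure_union hdisj (hR.compl.prod (hg hT)),
    Measure.prod_prod, Measure.prod_prod]
  simp [Measure.map_apply hf hT, Measure.map_apply hg hT]

theorem volume_lt_or_eq_one (q : unitInterval) :
    volume {v : unitInterval | v < q ∨ q = 1} = ENNReal.ofReal q := by
  by_cases hq : q = 1
  · simp [hq]
  · simp only [hq, or_false]
    exact unitInterval.volume_Iio q

open Classical in
theorem map_prod_lt_ite (a : unitInterval) (ν : Measure F) [SFinite ν] {f g : F → H}
    (hf : Measurable f) (hg : Measurable g) :
    ((volume : Measure unitInterval).prod ν).map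
      (fun e => if e.1 < a ∨ a = 1 then f e.2 else g e.2) = mixture a (ν.map f) (ν.map g) := by
  have hR : MeasurableSet {v : unitInterval | v < a ∨ a = 1} := measurableSet_Iio.union (.const _)
  have h := map_prod_ite volume ν hR hf hg
  rwa [prob_compl_eq_one_sub hR, volume_lt_or_eq_one, ← ENNReal.ofReal_one,
    ← ENNReal.ofReal_sub _ a.2.1] at h

end Product

namespace BanditGame

variable {G : BanditGame} {Ω : Type*} [MeasurableSpace Ω] (X : ArmNoise G Ω)

/-! ### The outcome of a period as a function of the random draws -/

@[fun_prop]
theorem measurable_observe {E : Type*} [MeasurableSpace E] {q v : E → unitInterval}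
    {y : E → G.SamplePath} (hq : Measurable q) (hv : Measurable v) (hy : Measurable y) :
    Measurable fun e => observe (q e) (v e) (y e) :=
  .ite ((measurableSet_lt hv hq).union (hq (measurableSet_singleton 1)))
    (measurable_inr.comp hy) measurable_const

theorem map_observe (θ : Fin 2) (q : unitInterval) :
    ((volume : Measure unitInterval).prod (X.pathLaw θ)).map (fun e => observe q e.1 e.2) =
      obsLaw X θ q := by
  have h := map_prod_lt_ite q (X.pathLaw θ) (f := (.inr : G.SamplePath → G.Obs))
    (g := fun _ => .inl ()) measurable_inr measurable_const
  rwa [Measure.map_const, measure_univ, one_smul] at h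

theorem map_observe_pi {ι : Type} [Fintype ι] (θ : Fin 2) (q : ι → unitInterval) :
    ((Measure.pi fun _ : ι => (volume : Measure unitInterval)).prod
      (Measure.pi fun _ : ι => X.pathLaw θ)).map (fun e i => observe (q i) (e.1 i) (e.2 i)) =
        stageLaw X θ q := by
  have hobs (i : ι) : Measurable fun e : unitInterval × G.SamplePath =>
    observe (q i) e.1 e.2 := by fun_prop
  have hpi := Measure.pi_map_pi (μ := fun _ : ι => (volume : Measure unitInterval).prod
    (X.pathLaw θ)) (hμ := fun i => by rw [map_observe]; infer_instance)
    fun i => (hobs i).aemeasurable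
  simp_rw [map_observe] at hpi
  rw [stageLaw, ← hpi, ← (measurePreserving_arrowProdEquivProdArrow unitInterval G.SamplePath ι
    (fun _ => volume) fun _ => X.pathLaw θ).map_eq,
    Measure.map_map (by fun_prop) (MeasurableEquiv.measurable _)]
  rfl

/-- Outcome of a period under the mixed actions `q`, as a function of the random draws. -/
noncomputable def outcomeOf (q : Fin G.N → unitInterval) (d : G.Draws) : G.Outcome :=
  (fun n => observe (q n) (d.1 n) (d.2.1 n), d.2.2)

@[fun_prop]
theorem measurable_outcomeOf {E : Type*} [MeasurableSpace E] {q : E → Fin G.N → unitInterval}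
    {d : E → G.Draws} (hq : Measurable q) (hd : Measurable d) :
    Measurable fun e => outcomeOf (q e) (d e) := by
  unfold outcomeOf
  fun_prop

/-- Law of the random draws of one period, conditional on the state `θ`. -/
noncomputable def periodLaw (θ : Fin 2) : Measure G.Draws :=
  (Measure.pi fun _ : Fin G.N => (volume : Measure unitInterval)).prod
    ((Measure.pi fun _ : Fin G.N => X.pathLaw θ).prod (volume : Measure unitInterval))

instance (θ : Fin 2) : IsProbabilityMeasure (periodLaw X θ) := by
  unfold periodLaw
  infer_instance

instance (θ : Fin 2) : IsProbabilityMeasure (drawsLaw X θ) :=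
  inferInstanceAs (IsProbabilityMeasure (Measure.infinitePi fun _ : ℕ => periodLaw X θ))

theorem map_seqCons_periodLaw (θ : Fin 2) :
    ((periodLaw X θ).prod (drawsLaw X θ)).map seqCons = drawsLaw X θ :=
  map_seqCons (periodLaw X θ)

theorem map_outcomeOf (θ : Fin 2) (q : Fin G.N → unitInterval) :
    (periodLaw X θ).map (outcomeOf q) = outcomeLaw X θ q := by
  have hobs : Measurable fun (e : (Fin G.N → unitInterval) × (Fin G.N → G.SamplePath)) n =>
    observe (q n) (e.1 n) (e.2 n) := by fun_prop
  rw [outcomeLaw, ← map_observe_pi, ← Measure.map_id (μ := (volume : Measure unitInterval)),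
    Measure.map_prod_map _ _ hobs measurable_id, Measure.map_id, periodLaw,
    ← (measurePreserving_prodAssoc _ _ _).map_eq,
    Measure.map_map (by fun_prop) (MeasurableEquiv.measurable _)]
  rfl

/-! ### Play from one decision node to the next -/

/-- The decision node that follows `x` after the outcome `z`. -/
def nextNode {t : ℕ} (x : G.Node t) (z : G.Outcome) : G.Node (t + 1) :=
  (Fin.snoc x.1 (x.2, z.1), z.2)

@[fun_prop]
theorem measurable_nextNode {E : Type*} [MeasurableSpace E] {t : ℕ} {x : E → G.Node t}
    {z : E → G.Outcome} (hx : Measurable x) (hz : Measurable z) :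
    Measurable fun e => nextNode (x e) (z e) := by
  refine Measurable.prodMk (measurable_pi_lambda _ fun i => ?_) (measurable_snd.comp hz)
  induction i using Fin.lastCases with
  | last =>
    simp only [Fin.snoc_last]
    fun_prop
  | cast i =>
    simp only [Fin.snoc_castSucc]
    fun_prop

@[simp]
theorem belief_nextNode (p : unitInterval) {t : ℕ} (x : G.Node t) (z : G.Outcome) :
    belief p (nextNode x z).1 = bayesUpdate (belief p x.1) z.1 := by
  simp only [nextNode, belief, Fin.init_snoc, Fin.snoc_last]

@[fun_prop]
theorem measurable_belief (p : unitInterval) (t : ℕ) :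
    Measurable fun g : G.Hist t => belief p g := by
  induction t with
  | zero => exact measurable_const
  | succ t ih =>
    have hinit : Measurable fun g : G.Hist (t + 1) => (Fin.init g : G.Hist t) :=
      measurable_pi_lambda _ fun i => measurable_pi_apply _
    exact measurable_bayesUpdate.comp ((ih.comp hinit).prodMk
      (measurable_snd.comp (measurable_pi_apply (Fin.last t))))

/-- Probabilities of the risky action prescribed by the profile `σ` at the node `x`. -/
def actions (σ : Fin G.N → G.Strategy) {t : ℕ} (x : G.Node t) : Fin G.N → unitInterval :=
  fun n => (σ n).act t x

@[fun_prop]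
theorem measurable_act (τ : G.Strategy) {t : ℕ} : Measurable (τ.act t) := τ.measurable_act t

@[fun_prop]
theorem measurable_actions (σ : Fin G.N → G.Strategy) (t : ℕ) :
    Measurable fun x : G.Node t => actions σ x :=
  measurable_pi_lambda _ fun n => (σ n).measurable_act t

theorem play_succ (σ : Fin G.N → G.Strategy) {t : ℕ} (x : G.Node t) (d : ℕ → G.Draws) (ℓ : ℕ) :
    play σ x d (ℓ + 1) = nextNode (play σ x d ℓ) (outcomeOf (actions σ (play σ x d ℓ)) (d ℓ)) :=
  rfl

@[fun_prop]
theorem measurable_play (σ : Fin G.N → G.Strategy) (t ℓ : ℕ) :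
    Measurable fun e : G.Node t × (ℕ → G.Draws) => play σ e.1 e.2 ℓ := by
  induction ℓ with
  | zero => exact measurable_fst
  | succ ℓ ih =>
    simp_rw [play_succ]
    fun_prop

/-- The two nodes have equal but not definitionally equal lengths, whence the dependent pairs. -/
theorem sigma_play_succ (σ : Fin G.N → G.Strategy) {t : ℕ} (x : G.Node t) (d : ℕ → G.Draws)
    (ℓ : ℕ) :
    (⟨t + (ℓ + 1), play σ x d (ℓ + 1)⟩ : Σ t, G.Node t) =
      ⟨t + 1 + ℓ, play σ (nextNode x (outcomeOf (actions σ x) (d 0))) (fun k => d (k + 1)) ℓ⟩ := by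
  induction ℓ with
  | zero => rfl
  | succ ℓ ih =>
    let step : (Σ t, G.Node t) → Σ t, G.Node t := fun z =>
      ⟨z.1 + 1, nextNode z.2 (outcomeOf (actions σ z.2) (d (ℓ + 1)))⟩
    exact congrArg step ih

theorem act_play_succ (σ : Fin G.N → G.Strategy) (τ : G.Strategy) {t : ℕ} (x : G.Node t)
    (d : ℕ → G.Draws) (ℓ : ℕ) :
    τ.act (t + (ℓ + 1)) (play σ x d (ℓ + 1)) = τ.act (t + 1 + ℓ)
      (play σ (nextNode x (outcomeOf (actions σ x) (d 0))) (fun k => d (k + 1)) ℓ) :=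
  congrArg (fun z : Σ t, G.Node t => τ.act z.1 z.2) (sigma_play_succ σ x d ℓ)

theorem play_congr {σ σ' : Fin G.N → G.Strategy} {t : ℕ}
    (h : ∀ n t', t ≤ t' → (σ n).act t' = (σ' n).act t') (x : G.Node t) (d : ℕ → G.Draws) (ℓ : ℕ) :
    play σ x d ℓ = play σ' x d ℓ := by
  induction ℓ with
  | zero => rfl
  | succ ℓ ih =>
    have : actions σ (play σ' x d ℓ) = actions σ' (play σ' x d ℓ) := by
      funext n
      simp only [actions, h n (t + ℓ) (Nat.le_add_right _ _)]
    rw [play_succ, play_succ, ih, this]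

/-! ### Recursive structure of payoffs -/

theorem δ_pos : 0 < G.δ := Real.exp_pos _

theorem δ_lt_one : G.δ < 1 :=
  Real.exp_lt_one_iff.2 (mul_neg_of_neg_of_pos (neg_neg_of_pos G.r_pos) (NNReal.coe_pos.2 G.Δ_pos))

/-- Expected flow payoff in state `θ` of the mixed action `a`. -/
def flow (θ : Fin 2) (a : unitInterval) : ℝ := (1 - a) * G.s + a * G.mState θ

/-- A bound for all flow payoffs. -/
def payoffBound (G : BanditGame) : ℝ := max |G.s| (max |G.mState 0| |G.mState 1|)

theorem abs_convex_comb_le (a : unitInterval) {u v C : ℝ} (hu : |u| ≤ C) (hv : |v| ≤ C) :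
    |(1 - a) * u + a * v| ≤ C :=
  abs_le.2 <| (convex_Icc (-C) C) (abs_le.1 hu) (abs_le.1 hv) (sub_nonneg.2 a.2.2) a.2.1
    (sub_add_cancel _ _)

theorem abs_mState_le (θ : Fin 2) : |G.mState θ| ≤ G.payoffBound := by
  fin_cases θ
  · exact (le_max_left _ _).trans (le_max_right _ _)
  · exact (le_max_right _ _).trans (le_max_right _ _)

theorem abs_flow_le (θ : Fin 2) (a : unitInterval) : |G.flow θ a| ≤ G.payoffBound :=
  abs_convex_comb_le a (le_max_left _ _) (abs_mState_le θ)

theorem payoffBound_nonneg : 0 ≤ G.payoffBound := (abs_nonneg _).trans (le_max_left _ _)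

@[fun_prop]
theorem measurable_flow (θ : Fin 2) : Measurable (G.flow θ) := by
  unfold flow
  fun_prop

/-- Realized discounted flow payoffs. -/
noncomputable def discounted (θ : Fin 2) (σ : Fin G.N → G.Strategy) {t : ℕ} (x : G.Node t)
    (n : Fin G.N) (d : ℕ → G.Draws) : ℝ :=
  (1 - G.δ) * ∑' ℓ : ℕ, G.δ ^ ℓ * G.flow θ ((σ n).act (t + ℓ) (play σ x d ℓ))

theorem statePayoff_eq (θ : Fin 2) (σ : Fin G.N → G.Strategy) {t : ℕ} (x : G.Node t)
    (n : Fin G.N) : statePayoff X θ σ x n = ∫ d, discounted θ σ x n d ∂(drawsLaw X θ) := rfl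

theorem norm_discounted_flow_le (θ : Fin 2) (a : unitInterval) (ℓ : ℕ) :
    ‖G.δ ^ ℓ * G.flow θ a‖ ≤ G.δ ^ ℓ * G.payoffBound := by
  rw [norm_mul, Real.norm_of_nonneg (pow_nonneg δ_pos.le _)]
  exact mul_le_mul_of_nonneg_left (abs_flow_le θ _) (pow_nonneg δ_pos.le _)

theorem summable_flow (θ : Fin 2) (a : ℕ → unitInterval) :
    Summable fun ℓ => G.δ ^ ℓ * G.flow θ (a ℓ) :=
  .of_norm_bounded ((summable_geometric_of_lt_one δ_pos.le δ_lt_one).mul_right _)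
    fun ℓ => norm_discounted_flow_le θ (a ℓ) ℓ

theorem abs_discounted_le (θ : Fin 2) (σ : Fin G.N → G.Strategy) {t : ℕ} (x : G.Node t)
    (n : Fin G.N) (d : ℕ → G.Draws) : |discounted θ σ x n d| ≤ G.payoffBound := by
  have hδ : 0 < 1 - G.δ := sub_pos.2 δ_lt_one
  have hsum := tsum_of_norm_bounded
    ((hasSum_geometric_of_lt_one (δ_pos (G := G)).le δ_lt_one).mul_right G.payoffBound)
    fun ℓ => norm_discounted_flow_le θ ((σ n).act (t + ℓ) (play σ x d ℓ)) ℓ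
  rw [discounted, abs_mul, abs_of_pos hδ]
  calc _ ≤ (1 - G.δ) * ((1 - G.δ)⁻¹ * G.payoffBound) := mul_le_mul_of_nonneg_left hsum hδ.le
    _ = G.payoffBound := mul_inv_cancel_left₀ hδ.ne' _

theorem measurable_discounted (θ : Fin 2) (σ : Fin G.N → G.Strategy) {t : ℕ} (n : Fin G.N)
    {E : Type*} [MeasurableSpace E] {x : E → G.Node t} {d : E → ℕ → G.Draws} (hx : Measurable x)
    (hd : Measurable d) : Measurable fun e => discounted θ σ (x e) n (d e) := by
  have hplay (ℓ : ℕ) : Measurable fun e => play σ (x e) (d e) ℓ :=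
    (measurable_play σ t ℓ).comp (hx.prodMk hd)
  refine Measurable.const_mul (measurable_of_tendsto_metrizable (f := fun k (e : E) =>
    ∑ ℓ ∈ Finset.range k, G.δ ^ ℓ * G.flow θ ((σ n).act (t + ℓ) (play σ (x e) (d e) ℓ)))
    (fun k => Finset.measurable_sum _ fun ℓ _ => (((measurable_flow θ).comp
      (((σ n).measurable_act (t + ℓ)).comp (hplay ℓ))).const_mul _)) ?_) _
  exact tendsto_pi_nhds.2 fun e => (summable_flow θ _).hasSum.tendsto_sum_nat

theorem abs_statePayoff_le (θ : Fin 2) (σ : Fin G.N → G.Strategy) {t : ℕ} (x : G.Node t)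
    (n : Fin G.N) : |statePayoff X θ σ x n| ≤ G.payoffBound :=
  abs_integral_le_of_abs_le fun d => abs_discounted_le θ σ x n d

@[fun_prop]
theorem measurable_statePayoff (θ : Fin 2) (σ : Fin G.N → G.Strategy) (t : ℕ) (n : Fin G.N) :
    Measurable fun x : G.Node t => statePayoff X θ σ x n :=
  (measurable_discounted θ σ n measurable_fst
    measurable_snd).stronglyMeasurable.integral_prod_right'.measurable

theorem discounted_seqCons (θ : Fin 2) (σ : Fin G.N → G.Strategy) {t : ℕ} (x : G.Node t)
    (n : Fin G.N) (e : G.Draws × (ℕ → G.Draws)) :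
    discounted θ σ x n (seqCons e) = (1 - G.δ) * G.flow θ (actions σ x n) +
      G.δ * discounted θ σ (nextNode x (outcomeOf (actions σ x) e.1)) n e.2 := by
  have hplay (ℓ : ℕ) : play σ (nextNode x (outcomeOf (actions σ x) (seqCons e 0)))
      (fun k => seqCons e (k + 1)) ℓ =
        play σ (nextNode x (outcomeOf (actions σ x) e.1)) e.2 ℓ := rfl
  rw [discounted, (summable_flow θ _).tsum_eq_zero_add, discounted]
  simp_rw [act_play_succ, hplay, pow_succ', mul_assoc, tsum_mul_left]
  rw [pow_zero, one_mul, mul_add, mul_left_comm]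
  rfl

theorem statePayoff_eq_integral_prod (θ : Fin 2) (σ : Fin G.N → G.Strategy) {t : ℕ}
    (x : G.Node t) (n : Fin G.N) :
    statePayoff X θ σ x n =
      ∫ e, discounted θ σ x n (seqCons e) ∂((periodLaw X θ).prod (drawsLaw X θ)) := by
  have hmeas : Measurable fun d => discounted θ σ x n d :=
    measurable_discounted θ σ n measurable_const measurable_id
  rw [← integral_map (by fun_prop) hmeas.aestronglyMeasurable, map_seqCons_periodLaw,
    statePayoff_eq]

theorem statePayoff_recursion (θ : Fin 2) (σ : Fin G.N → G.Strategy) {t : ℕ} (x : G.Node t)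
    (n : Fin G.N) :
    statePayoff X θ σ x n = (1 - G.δ) * G.flow θ (actions σ x n) +
      G.δ * ∫ z, statePayoff X θ σ (nextNode x z) n ∂(outcomeLaw X θ (actions σ x)) := by
  have hint : Integrable (fun e : G.Draws × (ℕ → G.Draws) =>
      discounted θ σ (nextNode x (outcomeOf (actions σ x) e.1)) n e.2)
        ((periodLaw X θ).prod (drawsLaw X θ)) :=
    integrable_of_abs_le (measurable_discounted θ σ n (by fun_prop) measurable_snd)
      fun e => abs_discounted_le θ σ _ n e.2
  have hcont : ∫ z, statePayoff X θ σ (nextNode x z) n ∂(outcomeLaw X θ (actions σ x)) =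
      ∫ d, statePayoff X θ σ (nextNode x (outcomeOf (actions σ x) d)) n ∂(periodLaw X θ) := by
    rw [← map_outcomeOf]
    exact integral_map (by fun_prop) (by fun_prop : Measurable _).aestronglyMeasurable
  rw [statePayoff_eq_integral_prod, integral_congr_ae (.of_forall (discounted_seqCons θ σ x n)),
    integral_add (integrable_const _) (hint.const_mul _), integral_const_mul, integral_const_mul,
    integral_prod _ hint, integral_const, probReal_univ, one_smul, hcont]
  rfl

theorem abs_payoffAt_le (p : unitInterval) (σ : Fin G.N → G.Strategy) {t : ℕ} (x : G.Node t)
    (n : Fin G.N) : |payoffAt X p σ x n| ≤ G.payoffBound := by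
  rw [payoffAt, add_comm]
  exact abs_convex_comb_le _ (abs_statePayoff_le X 0 σ x n) (abs_statePayoff_le X 1 σ x n)

@[fun_prop]
theorem measurable_payoffAt (p : unitInterval) (σ : Fin G.N → G.Strategy) (t : ℕ) (n : Fin G.N) :
    Measurable fun x : G.Node t => payoffAt X p σ x n := by
  unfold payoffAt
  fun_prop

/-- Expected flow payoff of the mixed action `a` at the belief `p`. -/
def beliefFlow (p a : unitInterval) : ℝ := (1 - a) * G.s + a * G.m p

/-- Expected payoff of player `n` at the belief `p` if the mixed actions `q` are used for one period
and the outcome `z` of that period is followed by the continuation payoff `f z`. -/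
noncomputable def stageValue (p : unitInterval) (q : Fin G.N → unitInterval) (n : Fin G.N)
    (f : G.Outcome → ℝ) : ℝ :=
  (1 - G.δ) * G.beliefFlow p (q n) + G.δ * ∫ z, f z ∂(mixedOutcomeLaw X p q)

theorem payoffAt_eq_stageValue (p : unitInterval) (σ : Fin G.N → G.Strategy) {t : ℕ}
    (x : G.Node t) (n : Fin G.N) :
    payoffAt X p σ x n = stageValue X (belief p x.1) (actions σ x) n
      fun z => payoffAt X p σ (nextNode x z) n := by
  have hbayes := integral_bayes X (belief p x.1) (actions σ x)
    (f₁ := fun z => statePayoff X 1 σ (nextNode x z) n)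
    (f₀ := fun z => statePayoff X 0 σ (nextNode x z) n) (by fun_prop) (by fun_prop)
    (fun z => abs_statePayoff_le X 1 σ _ n) (fun z => abs_statePayoff_le X 0 σ _ n)
  simp only [stageValue, payoffAt, belief_nextNode]
  rw [← hbayes, statePayoff_recursion, statePayoff_recursion X 0]
  simp only [beliefFlow, flow, m]
  ring

theorem payoffAt_congr (p : unitInterval) {σ σ' : Fin G.N → G.Strategy} {t : ℕ}
    (h : ∀ n t', t ≤ t' → (σ n).act t' = (σ' n).act t') (x : G.Node t) (n : Fin G.N) :
    payoffAt X p σ x n = payoffAt X p σ' x n := by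
  have hstate (θ : Fin 2) : statePayoff X θ σ x n = statePayoff X θ σ' x n := by
    simp only [statePayoff, play_congr h, h n _ (Nat.le_add_right t _)]
  rw [payoffAt, payoffAt, hstate, hstate]

end BanditGame

/-- `f` is measurable and bounded by `C` in absolute value. -/
structure IsBddMeasurable {E : Type*} [MeasurableSpace E] (C : ℝ) (f : E → ℝ) : Prop where
  measurable : Measurable f
  abs_le : ∀ x, |f x| ≤ C

namespace IsBddMeasurable

variable {E F : Type*} [MeasurableSpace E] [MeasurableSpace F] {C : ℝ} {f : E → ℝ}

theorem comp (hf : IsBddMeasurable C f) {g : F → E} (hg : Measurable g) :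
    IsBddMeasurable C fun x => f (g x) :=
  ⟨hf.measurable.comp hg, fun x => hf.abs_le (g x)⟩

theorem integrable (hf : IsBddMeasurable C f) {μ : Measure E} [IsFiniteMeasure μ] :
    Integrable f μ :=
  integrable_of_abs_le hf.measurable hf.abs_le

theorem neg (hf : IsBddMeasurable C f) : IsBddMeasurable C fun x => -f x :=
  ⟨hf.measurable.neg, fun x => (abs_neg (f x)).trans_le (hf.abs_le x)⟩

theorem sub (hf : IsBddMeasurable C f) {C' : ℝ} {g : E → ℝ} (hg : IsBddMeasurable C' g) :
    IsBddMeasurable (C + C') fun x => f x - g x :=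
  ⟨hf.measurable.sub hg.measurable, fun x =>
    (abs_sub _ _).trans (add_le_add (hf.abs_le x) (hg.abs_le x))⟩

theorem of_tendsto {g : ℕ → E → ℝ} (hg : ∀ n, IsBddMeasurable C (g n))
    (h : ∀ x, Filter.Tendsto (fun n => g n x) .atTop (nhds (f x))) : IsBddMeasurable C f :=
  ⟨measurable_of_tendsto_metrizable (fun n => (hg n).measurable) (tendsto_pi_nhds.2 h),
    fun x => le_of_tendsto (h x).abs (.of_forall fun n => (hg n).abs_le x)⟩

end IsBddMeasurable

namespace BanditGame

variable {G : BanditGame} {Ω : Type*} [MeasurableSpace Ω] (X : ArmNoise G Ω)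

/-! ### Values of one period -/

theorem abs_m_le (p : unitInterval) : |G.m p| ≤ G.payoffBound := by
  rw [m, add_comm]
  exact abs_convex_comb_le p (abs_mState_le 0) (abs_mState_le 1)

theorem abs_beliefFlow_le (p a : unitInterval) : |G.beliefFlow p a| ≤ G.payoffBound :=
  abs_convex_comb_le a (le_max_left _ _) (abs_m_le p)

theorem abs_discounted_sum_le {u v C : ℝ} (hu : |u| ≤ C) (hv : |v| ≤ C) :
    |(1 - G.δ) * u + G.δ * v| ≤ C :=
  abs_convex_comb_le ⟨G.δ, δ_pos.le, δ_lt_one.le⟩ hu hv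

section StageValue

variable {X} (p : unitInterval) (q : Fin G.N → unitInterval) (n : Fin G.N) {f g : G.Outcome → ℝ}
  {C C' : ℝ}

theorem stageValue_mono (hf : IsBddMeasurable C f) (hg : IsBddMeasurable C' g)
    (h : ∀ z, f z ≤ g z) : stageValue X p q n f ≤ stageValue X p q n g :=
  add_le_add_right (mul_le_mul_of_nonneg_left
    (integral_mono hf.integrable hg.integrable h) δ_pos.le) _

theorem stageValue_congr_ae (h : f =ᵐ[mixedOutcomeLaw X p q] g) :
    stageValue X p q n f = stageValue X p q n g := by
  rw [stageValue, stageValue, integral_congr_ae h]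

theorem stageValue_sub_stageValue (hf : IsBddMeasurable C f) (hg : IsBddMeasurable C' g) :
    stageValue X p q n f - stageValue X p q n g =
      G.δ * ∫ z, (f z - g z) ∂(mixedOutcomeLaw X p q) := by
  rw [stageValue, stageValue, integral_sub hf.integrable hg.integrable]
  ring

theorem stageValue_update (hf : IsBddMeasurable C f) (a : unitInterval) :
    stageValue X p (Function.update q n a) n f =
      a * stageValue X p (Function.update q n 1) n f +
        (1 - a) * stageValue X p (Function.update q n 0) n f := by
  simp only [stageValue, Function.update_self, beliefFlow,
    integral_mixedOutcomeLaw_update X p q n a hf.measurable hf.abs_le, Set.Icc.coe_one,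
    Set.Icc.coe_zero]
  ring

end StageValue

/-! ### Pure actions as degenerate mixed actions -/

/-- The degenerate mixed action that corresponds to `k ∈ {0, 1}`. -/
def binaryAct (k : ℕ) : unitInterval := if k = 1 then 1 else 0

@[simp]
theorem binaryAct_zero : binaryAct 0 = 0 := rfl

@[simp]
theorem binaryAct_one : binaryAct 1 = 1 := rfl

theorem binaryAct_eq_zero_or_one (k : ℕ) : binaryAct k = 0 ∨ binaryAct k = 1 := by
  unfold binaryAct
  split_ifs <;> simp

theorem binaryAct_eq_one_iff {k : ℕ} : binaryAct k = 1 ↔ k = 1 := by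
  unfold binaryAct
  split_ifs with h <;> simp [h]

theorem exists_binaryAct {a : unitInterval} (ha : a = 0 ∨ a = 1) :
    ∃ k ∈ ({0, 1} : Set ℕ), a = binaryAct k := by
  rcases ha with rfl | rfl
  exacts [⟨0, by simp, rfl⟩, ⟨1, by simp, rfl⟩]

theorem beliefFlow_binaryAct (p : unitInterval) {k : ℕ} (hk : k ∈ ({0, 1} : Set ℕ)) :
    G.beliefFlow p (binaryAct k) = (1 - k) * G.s + k * G.m p := by
  rcases hk with rfl | rfl <;> simp [beliefFlow]

/-- The mixed actions of a profile in which player `i` plays `k` and all others play `κ`. -/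
def unilateral (κ : ℕ) (i : Fin G.N) (k : ℕ) : Fin G.N → unitInterval :=
  Function.update (fun _ => binaryAct κ) i (binaryAct k)

theorem unilateral_self (κ : ℕ) (i : Fin G.N) : unilateral κ i κ = fun _ => binaryAct κ :=
  Function.update_eq_self _ _

theorem unilateral_apply (κ k : ℕ) (i j : Fin G.N) :
    unilateral κ i k j = binaryAct (if j = i then k else κ) := by
  rw [unilateral, Function.update_apply]
  split_ifs <;> rfl

theorem unilateral_eq_zero_or_one (κ k : ℕ) (i j : Fin G.N) :
    unilateral κ i k j = 0 ∨ unilateral κ i k j = 1 := by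
  rw [unilateral_apply]
  exact binaryAct_eq_zero_or_one _

theorem card_unilateral_eq_one {κ k : ℕ} (hκ : κ ∈ ({0, 1} : Set ℕ)) (hk : k ∈ ({0, 1} : Set ℕ))
    (i : Fin G.N) : Nat.card {j // unilateral κ i k j = 1} = (G.N - 1) * κ + k := by
  have hind (j : Fin G.N) : (if unilateral κ i k j = 1 then 1 else 0) = if j = i then k else κ := by
    simp only [unilateral_apply, binaryAct_eq_one_iff]
    rcases hκ with rfl | rfl <;> rcases hk with rfl | rfl <;> split_ifs <;> simp_all
  classical
  rw [Nat.card_eq_fintype_card, Fintype.card_subtype, Finset.card_filter]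
  simp only [hind]
  rw [← Finset.sum_erase_add _ _ (Finset.mem_univ i), if_pos rfl,
    Finset.sum_congr rfl fun j hj => if_neg (Finset.ne_of_mem_erase hj), Finset.sum_const,
    Finset.card_erase_of_mem (Finset.mem_univ i), Finset.card_univ, Fintype.card_fin, smul_eq_mul]

theorem oneStep_eq_stageValue (p : unitInterval) {κ k : ℕ} (hκ : κ ∈ ({0, 1} : Set ℕ))
    (hk : k ∈ ({0, 1} : Set ℕ)) (i : Fin G.N) {w : unitInterval → ℝ} (hw : Measurable w) :
    oneStep X k ((G.N - 1) * κ + k) w p =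
      stageValue X p (unilateral κ i k) i fun z => w (bayesUpdate p z.1) := by
  rw [stageValue, integral_mixedOutcomeLaw_of_pure X p (unilateral_eq_zero_or_one κ k i)
    (card_unilateral_eq_one hκ hk i) hw, unilateral, Function.update_self,
    beliefFlow_binaryAct p hk, oneStep]

theorem one_le_N (G : BanditGame) : 1 ≤ G.N := one_le_two.trans G.two_le_N

/-- A reference player, at whom the common payoffs of symmetric profiles are read off. -/
def player (G : BanditGame) : Fin G.N := ⟨0, G.one_le_N⟩

theorem N_sub_one_mul_add (G : BanditGame) (κ : ℕ) : (G.N - 1) * κ + κ = G.N * κ := by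
  rw [← Nat.succ_mul, Nat.succ_eq_add_one, Nat.sub_add_cancel G.one_le_N]

theorem oneStep_comply_eq_stageValue (p : unitInterval) {κ : ℕ} (hκ : κ ∈ ({0, 1} : Set ℕ))
    (i : Fin G.N) {w : unitInterval → ℝ} (hw : Measurable w) :
    oneStep X κ (G.N * κ) w p =
      stageValue X p (fun _ => binaryAct κ) i fun z => w (bayesUpdate p z.1) := by
  rw [← N_sub_one_mul_add, oneStep_eq_stageValue X p hκ hκ i hw, unilateral_self]

variable {X}

theorem oneStep_le_bestReply (p : unitInterval) (κ : ℕ) {k : ℕ} (hk : k ∈ ({0, 1} : Set ℕ))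
    (w : unitInterval → ℝ) : oneStep X k ((G.N - 1) * κ + k) w p ≤ bestReply X κ w p := by
  rcases hk with rfl | rfl
  exacts [le_max_left _ _, le_max_right _ _]

end BanditGame

/-! ### Extrema over sets of binary actions -/

section BinaryExtrema

open Classical in
/-- The maximum of `f` over a nonempty set `S ⊆ {0, 1}`. -/
noncomputable def binaryMax (S : Set ℕ) (f : ℕ → ℝ) : ℝ :=
  if 0 ∈ S then if 1 ∈ S then max (f 0) (f 1) else f 0 else f 1

/-- The minimum of `f` over a nonempty set `S ⊆ {0, 1}`. -/
noncomputable def binaryMin (S : Set ℕ) (f : ℕ → ℝ) : ℝ := -binaryMax S fun k => -f k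

variable {S T : Set ℕ}

theorem isGreatest_binaryMax (hS : S ⊆ {0, 1}) (hne : S.Nonempty) (f : ℕ → ℝ) :
    IsGreatest (f '' S) (binaryMax S f) := by
  obtain rfl | rfl | rfl : S = {0} ∨ S = {1} ∨ S = {0, 1} :=
    (Set.subset_pair_iff_eq.1 hS).resolve_left hne.ne_empty
  · simp [binaryMax]
  · simp [binaryMax]
  · simpa [binaryMax, Set.image_pair] using isGreatest_pair (a := f 0) (b := f 1)

theorem isLeast_binaryMin (hS : S ⊆ {0, 1}) (hne : S.Nonempty) (f : ℕ → ℝ) :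
    IsLeast (f '' S) (binaryMin S f) := by
  obtain ⟨⟨k, hk, hkf⟩, hub⟩ := isGreatest_binaryMax hS hne fun k => -f k
  refine ⟨⟨k, hk, by rw [binaryMin, ← hkf, neg_neg]⟩, ?_⟩
  rintro _ ⟨j, hj, rfl⟩
  exact neg_le.1 (hub ⟨j, hj, rfl⟩)

theorem binaryMax_le_binaryMax (hST : S ⊆ T) (hT : T ⊆ {0, 1}) (hne : S.Nonempty) {f g : ℕ → ℝ}
    (h : ∀ k, f k ≤ g k) : binaryMax S f ≤ binaryMax T g := by
  obtain ⟨k, hk, hkf⟩ := (isGreatest_binaryMax (hST.trans hT) hne f).1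
  rw [← hkf]
  exact (h k).trans ((isGreatest_binaryMax hT (hne.mono hST) g).2 ⟨k, hST hk, rfl⟩)

theorem binaryMin_le_binaryMin (hST : S ⊆ T) (hT : T ⊆ {0, 1}) (hne : S.Nonempty) {f g : ℕ → ℝ}
    (h : ∀ k, f k ≤ g k) : binaryMin T f ≤ binaryMin S g :=
  neg_le_neg (binaryMax_le_binaryMax hST hT hne fun k => neg_le_neg (h k))

theorem isBddMeasurable_binaryMax {E : Type*} [MeasurableSpace E] {S : E → Set ℕ} {f : ℕ → E → ℝ}
    {C : ℝ} (hS : ∀ k, MeasurableSet {e | k ∈ S e})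
    (hf : ∀ k ∈ ({0, 1} : Set ℕ), IsBddMeasurable C (f k)) :
    IsBddMeasurable C fun e => binaryMax (S e) fun k => f k e := by
  have h0 := hf 0 (by simp)
  have h1 := hf 1 (by simp)
  refine ⟨.ite (hS 0) (.ite (hS 1) (h0.measurable.max h1.measurable) h0.measurable) h1.measurable,
    fun e => ?_⟩
  unfold binaryMax
  split_ifs
  exacts [abs_max_le_max_abs_abs.trans (max_le (h0.abs_le e) (h1.abs_le e)), h0.abs_le e,
    h1.abs_le e]

theorem isBddMeasurable_binaryMin {E : Type*} [MeasurableSpace E] {S : E → Set ℕ} {f : ℕ → E → ℝ}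
    {C : ℝ} (hS : ∀ k, MeasurableSet {e | k ∈ S e})
    (hf : ∀ k ∈ ({0, 1} : Set ℕ), IsBddMeasurable C (f k)) :
    IsBddMeasurable C fun e => binaryMin (S e) fun k => f k e :=
  (isBddMeasurable_binaryMax hS fun k hk => (hf k hk).neg).neg

theorem tendsto_binaryMax (S : Set ℕ) {f : ℕ → ℕ → ℝ} {g : ℕ → ℝ}
    (h : ∀ k, Filter.Tendsto (fun n => f n k) .atTop (nhds (g k))) :
    Filter.Tendsto (fun n => binaryMax S (f n)) .atTop (nhds (binaryMax S g)) := by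
  unfold binaryMax
  split_ifs
  exacts [(h 0).max (h 1), h 0, h 1]

theorem tendsto_binaryMin (S : Set ℕ) {f : ℕ → ℕ → ℝ} {g : ℕ → ℝ}
    (h : ∀ k, Filter.Tendsto (fun n => f n k) .atTop (nhds (g k))) :
    Filter.Tendsto (fun n => binaryMin S (f n)) .atTop (nhds (binaryMin S g)) :=
  (tendsto_binaryMax S fun k => (h k).neg).neg

end BinaryExtrema

theorem eventually_eq_iInter_of_antitone {α : Type*} {S : ℕ → Set α} (hfin : (S 0).Finite)
    (hS : Antitone S) : ∀ᶠ n in .atTop, S n = ⋂ j, S j := by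
  have hmem : ∀ k ∈ S 0, ∀ᶠ n in Filter.atTop, k ∈ S n → ∀ j, k ∈ S j := by
    intro k _
    by_cases hk : ∀ j, k ∈ S j
    · exact .of_forall fun _ _ => hk
    · obtain ⟨j, hj⟩ := not_forall.1 hk
      filter_upwards [Filter.eventually_ge_atTop j] with n hn hkn
      exact (hj (hS hn hkn)).elim
  filter_upwards [hfin.eventually_all.2 hmem] with n hn
  exact Set.Subset.antisymm (fun k hk => Set.mem_iInter.2 (hn k (hS n.zero_le hk) hk))
    (Set.iInter_subset _ n)

namespace BanditGame

variable {G : BanditGame} {Ω : Type*} [MeasurableSpace Ω] (X : ArmNoise G Ω)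

/-! ### The operators in the functional equations -/

theorem beliefLaw_eq_map_mixture (K : ℕ) (p : unitInterval) :
    beliefLaw X K p = (mixture p (Measure.pi fun _ : Fin K => X.pathLaw 1)
      (Measure.pi fun _ : Fin K => X.pathLaw 0)).map
        fun y => bayesUpdate p fun i => (.inr (y i) : G.Obs) :=
  rfl

instance (K : ℕ) (p : unitInterval) : IsProbabilityMeasure (beliefLaw X K p) := by
  rw [beliefLaw_eq_map_mixture]
  exact Measure.isProbabilityMeasure_map (measurable_bayesUpdate_inr p).aemeasurable

theorem expect_eq_integral_pathLaw (K : ℕ) {w : unitInterval → ℝ} {C : ℝ}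
    (hw : IsBddMeasurable C w) (p : unitInterval) :
    expect X K w p =
      p * ∫ y, w (bayesUpdate p fun i => (.inr (y i) : G.Obs))
          ∂(Measure.pi fun _ : Fin K => X.pathLaw 1) +
        (1 - p) * ∫ y, w (bayesUpdate p fun i => (.inr (y i) : G.Obs))
          ∂(Measure.pi fun _ : Fin K => X.pathLaw 0) := by
  have hy := hw.comp (measurable_bayesUpdate_inr (G := G) (ι := Fin K) p)
  rw [expect, beliefLaw_eq_map_mixture,
    integral_map (measurable_bayesUpdate_inr p).aemeasurable hw.measurable.aestronglyMeasurable,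
    integral_mixture hy.integrable hy.integrable]

theorem measurable_expect (K : ℕ) {w : unitInterval → ℝ} {C : ℝ} (hw : IsBddMeasurable C w) :
    Measurable (expect X K w) := by
  have hf : Measurable fun e : unitInterval × (Fin K → G.SamplePath) =>
      w (bayesUpdate e.1 fun i => (.inr (e.2 i) : G.Obs)) :=
    hw.measurable.comp (measurable_bayesUpdate.comp (measurable_fst.prodMk
      (measurable_pi_lambda _ fun i => measurable_inr.comp
        ((measurable_pi_apply i).comp measurable_snd))))
  have hint (θ : Fin 2) : Measurable fun p : unitInterval =>
      ∫ y, w (bayesUpdate p fun i => (.inr (y i) : G.Obs))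
        ∂(Measure.pi fun _ : Fin K => X.pathLaw θ) :=
    hf.stronglyMeasurable.integral_prod_right'.measurable
  simp_rw [funext (expect_eq_integral_pathLaw X K hw)]
  exact (measurable_subtype_coe.mul (hint 1)).add
    ((measurable_const.sub measurable_subtype_coe).mul (hint 0))

variable {X}

section Operators

variable {C C' : ℝ} {w w' wbar wlow wbar' wlow' : unitInterval → ℝ}

theorem oneStep_mono (k K : ℕ) (p : unitInterval) (hw : IsBddMeasurable C w)
    (hw' : IsBddMeasurable C' w') (h : ∀ q, w q ≤ w' q) :
    oneStep X k K w p ≤ oneStep X k K w' p :=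
  add_le_add_right (mul_le_mul_of_nonneg_left
    (integral_mono hw.integrable hw'.integrable h) δ_pos.le) _

theorem bestReply_mono (κ : ℕ) (p : unitInterval) (hw : IsBddMeasurable C w)
    (hw' : IsBddMeasurable C' w') (h : ∀ q, w q ≤ w' q) :
    bestReply X κ w p ≤ bestReply X κ w' p :=
  max_le_max (oneStep_mono _ _ p hw hw' h) (oneStep_mono _ _ p hw hw' h)

theorem enforceable_mono (p : unitInterval) (hb : IsBddMeasurable C wbar)
    (hb' : IsBddMeasurable C' wbar') (hl : IsBddMeasurable C wlow)
    (hl' : IsBddMeasurable C' wlow') (hbar : ∀ q, wbar q ≤ wbar' q)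
    (hlow : ∀ q, wlow' q ≤ wlow q) :
    enforceable X wbar wlow p ⊆ enforceable X wbar' wlow' p := fun κ hκ =>
  ⟨hκ.1, (bestReply_mono κ p hl' hl hlow).trans (hκ.2.trans (oneStep_mono _ _ p hb hb' hbar))⟩

theorem enforceable_subset (wbar wlow : unitInterval → ℝ) (p : unitInterval) :
    enforceable X wbar wlow p ⊆ {0, 1} := fun _ h => h.1

theorem measurable_oneStep (k K : ℕ) (hw : IsBddMeasurable C w) :
    Measurable (oneStep X k K w) := by
  have hexpect := measurable_expect X K hw
  unfold oneStep m
  fun_prop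

theorem measurable_bestReply (κ : ℕ) (hw : IsBddMeasurable C w) :
    Measurable (bestReply X κ w) :=
  (measurable_oneStep _ _ hw).max (measurable_oneStep _ _ hw)

theorem measurableSet_enforceable (κ : ℕ) (hb : IsBddMeasurable C wbar)
    (hl : IsBddMeasurable C' wlow) : MeasurableSet {p | κ ∈ enforceable X wbar wlow p} :=
  (MeasurableSet.const _).inter
    (measurableSet_le (measurable_bestReply κ hl) (measurable_oneStep κ _ hb))

theorem isBddMeasurable_oneStep {k : ℕ} (hk : k ∈ ({0, 1} : Set ℕ)) (K : ℕ)
    (hC : G.payoffBound ≤ C) (hw : IsBddMeasurable C w) :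
    IsBddMeasurable C (oneStep X k K w) := by
  refine ⟨measurable_oneStep k K hw, fun p => ?_⟩
  rw [oneStep, ← beliefFlow_binaryAct p hk]
  exact abs_discounted_sum_le ((abs_beliefFlow_le p _).trans hC)
    (abs_integral_le_of_abs_le hw.abs_le)

theorem isBddMeasurable_bestReply (κ : ℕ) (hC : G.payoffBound ≤ C) (hw : IsBddMeasurable C w) :
    IsBddMeasurable C (bestReply X κ w) :=
  ⟨measurable_bestReply κ hw, fun p => abs_max_le_max_abs_abs.trans
    (max_le ((isBddMeasurable_oneStep (by simp) _ hC hw).abs_le p)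
      ((isBddMeasurable_oneStep (by simp) _ hC hw).abs_le p))⟩

theorem tendsto_oneStep (k K : ℕ) (p : unitInterval) {w : ℕ → unitInterval → ℝ}
    {v : unitInterval → ℝ} (hw : ∀ n, IsBddMeasurable C (w n))
    (h : ∀ q, Filter.Tendsto (fun n => w n q) .atTop (nhds (v q))) :
    Filter.Tendsto (fun n => oneStep X k K (w n) p) .atTop (nhds (oneStep X k K v p)) := by
  have hexpect : Filter.Tendsto (fun n => expect X K (w n) p) .atTop (nhds (expect X K v p)) :=
    tendsto_integral_of_dominated_convergence (fun _ => C)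
      (fun n => (hw n).measurable.aestronglyMeasurable) (integrable_const C)
      (fun n => .of_forall (hw n).abs_le) (.of_forall h)
  exact (hexpect.const_mul _).const_add _

theorem tendsto_bestReply (κ : ℕ) (p : unitInterval) {w : ℕ → unitInterval → ℝ}
    {v : unitInterval → ℝ} (hw : ∀ n, IsBddMeasurable C (w n))
    (h : ∀ q, Filter.Tendsto (fun n => w n q) .atTop (nhds (v q))) :
    Filter.Tendsto (fun n => bestReply X κ (w n) p) .atTop (nhds (bestReply X κ v p)) :=
  (tendsto_oneStep _ _ p hw h).max (tendsto_oneStep _ _ p hw h)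

end Operators

/-! ### Iterating the functional equations -/

variable (X)

/-- The operator on pairs `(w̄, w̲)` given by the right-hand sides of the functional equations. -/
noncomputable def bellman (w : (unitInterval → ℝ) × (unitInterval → ℝ)) :
    (unitInterval → ℝ) × (unitInterval → ℝ) :=
  (fun p => binaryMax (enforceable X w.1 w.2 p) fun κ => oneStep X κ (G.N * κ) w.1 p,
    fun p => binaryMin (enforceable X w.1 w.2 p) fun κ => bestReply X κ w.2 p)

/-- Iterates of `bellman`, from constant bounds for all payoffs. -/
noncomputable def approx : ℕ → (unitInterval → ℝ) × (unitInterval → ℝ)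
  | 0 => (fun _ => G.payoffBound, fun _ => -G.payoffBound)
  | n + 1 => bellman X (approx n)

/-- Pointwise limit of the iterates `approx`. -/
noncomputable def approxLimit : (unitInterval → ℝ) × (unitInterval → ℝ) :=
  (fun p => ⨅ n, (approx X n).1 p, fun p => ⨆ n, (approx X n).2 p)

/-- The iterates `approx` extremize over nonempty sets, so that they carry no junk values. -/
def ApproxEnforceable : Prop :=
  ∀ n p, (enforceable X (approx X n).1 (approx X n).2 p).Nonempty

variable {X}

theorem isBddMeasurable_bellman {w : (unitInterval → ℝ) × (unitInterval → ℝ)} {C : ℝ}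
    (hC : G.payoffBound ≤ C) (hbar : IsBddMeasurable C w.1) (hlow : IsBddMeasurable C w.2) :
    IsBddMeasurable C (bellman X w).1 ∧ IsBddMeasurable C (bellman X w).2 :=
  have hS := fun κ => measurableSet_enforceable (X := X) κ hbar hlow
  ⟨isBddMeasurable_binaryMax hS fun _ hκ => isBddMeasurable_oneStep hκ _ hC hbar,
    isBddMeasurable_binaryMin hS fun κ _ => isBddMeasurable_bestReply κ hC hlow⟩

theorem isSolution_of_bellman_eq {w : (unitInterval → ℝ) × (unitInterval → ℝ)} {C : ℝ}
    (hbar : IsBddMeasurable C w.1) (hlow : IsBddMeasurable C w.2)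
    (hne : ∀ p, (enforceable X w.1 w.2 p).Nonempty) (h : bellman X w = w) :
    IsSolution X w.1 w.2 where
  measurable_bar := hbar.measurable
  measurable_low := hlow.measurable
  bounded_bar := ⟨C, hbar.abs_le⟩
  bounded_low := ⟨C, hlow.abs_le⟩
  eq_bar p := by
    have hp : (bellman X w).1 p = w.1 p := by rw [h]
    rw [← hp]
    exact isGreatest_binaryMax (enforceable_subset _ _ p) (hne p) _
  eq_low p := by
    have hp : (bellman X w).2 p = w.2 p := by rw [h]
    rw [← hp]
    exact isLeast_binaryMin (enforceable_subset _ _ p) (hne p) _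

theorem isBddMeasurable_approx (n : ℕ) :
    IsBddMeasurable G.payoffBound (approx X n).1 ∧
      IsBddMeasurable G.payoffBound (approx X n).2 := by
  induction n with
  | zero =>
    have hconst : IsBddMeasurable G.payoffBound fun _ : unitInterval => G.payoffBound :=
      ⟨measurable_const, fun _ => (abs_of_nonneg payoffBound_nonneg).le⟩
    exact ⟨hconst, hconst.neg⟩
  | succ n ih => exact isBddMeasurable_bellman le_rfl ih.1 ih.2

theorem approxLimit_le (n : ℕ) (p : unitInterval) : (approxLimit X).1 p ≤ (approx X n).1 p :=
  ciInf_le ⟨-G.payoffBound, Set.forall_mem_range.2 fun n =>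
    (abs_le.1 ((isBddMeasurable_approx n).1.abs_le p)).1⟩ n

theorem le_approxLimit (n : ℕ) (p : unitInterval) : (approx X n).2 p ≤ (approxLimit X).2 p :=
  le_ciSup (f := fun n => (approx X n).2 p) ⟨G.payoffBound, Set.forall_mem_range.2 fun n =>
    (abs_le.1 ((isBddMeasurable_approx n).2.abs_le p)).2⟩ n

namespace ApproxEnforceable

variable (h : ApproxEnforceable X)
include h

theorem approx_succ_le (n : ℕ) :
    (∀ p, (approx X (n + 1)).1 p ≤ (approx X n).1 p) ∧
      ∀ p, (approx X n).2 p ≤ (approx X (n + 1)).2 p := by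
  induction n with
  | zero =>
    have h1 := isBddMeasurable_approx (X := X) 1
    exact ⟨fun p => (abs_le.1 (h1.1.abs_le p)).2, fun p => (abs_le.1 (h1.2.abs_le p)).1⟩
  | succ n ih =>
    have h0 := isBddMeasurable_approx (X := X) n
    have h1 := isBddMeasurable_approx (X := X) (n + 1)
    have hsub (p : unitInterval) := enforceable_mono (X := X) p h1.1 h0.1 h1.2 h0.2 ih.1 ih.2
    exact ⟨fun p => binaryMax_le_binaryMax (hsub p) (enforceable_subset _ _ p) (h (n + 1) p)
        fun κ => oneStep_mono κ _ p h1.1 h0.1 ih.1,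
      fun p => binaryMin_le_binaryMin (hsub p) (enforceable_subset _ _ p) (h (n + 1) p)
        fun κ => bestReply_mono κ p h0.2 h1.2 ih.2⟩

theorem tendsto_approx_fst (p : unitInterval) :
    Filter.Tendsto (fun n => (approx X n).1 p) .atTop (nhds ((approxLimit X).1 p)) :=
  tendsto_atTop_ciInf (antitone_nat_of_succ_le fun n => (h.approx_succ_le n).1 p)
    ⟨_, Set.forall_mem_range.2 fun n => approxLimit_le n p⟩

theorem tendsto_approx_snd (p : unitInterval) :
    Filter.Tendsto (fun n => (approx X n).2 p) .atTop (nhds ((approxLimit X).2 p)) :=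
  tendsto_atTop_ciSup (monotone_nat_of_le_succ fun n => (h.approx_succ_le n).2 p)
    ⟨_, Set.forall_mem_range.2 fun n => le_approxLimit n p⟩

theorem isBddMeasurable_approxLimit :
    IsBddMeasurable G.payoffBound (approxLimit X).1 ∧
      IsBddMeasurable G.payoffBound (approxLimit X).2 :=
  ⟨.of_tendsto (fun n => (isBddMeasurable_approx n).1) h.tendsto_approx_fst,
    .of_tendsto (fun n => (isBddMeasurable_approx n).2) h.tendsto_approx_snd⟩

theorem tendsto_oneStep_approx (k K : ℕ) (p : unitInterval) :
    Filter.Tendsto (fun n => oneStep X k K (approx X n).1 p) .atTop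
      (nhds (oneStep X k K (approxLimit X).1 p)) :=
  tendsto_oneStep k K p (fun n => (isBddMeasurable_approx n).1) h.tendsto_approx_fst

theorem tendsto_bestReply_approx (κ : ℕ) (p : unitInterval) :
    Filter.Tendsto (fun n => bestReply X κ (approx X n).2 p) .atTop
      (nhds (bestReply X κ (approxLimit X).2 p)) :=
  tendsto_bestReply κ p (fun n => (isBddMeasurable_approx n).2) h.tendsto_approx_snd

theorem antitone_enforceable_approx (p : unitInterval) :
    Antitone fun n => enforceable X (approx X n).1 (approx X n).2 p :=
  antitone_nat_of_succ_le fun n =>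
    have h0 := isBddMeasurable_approx (X := X) n
    have h1 := isBddMeasurable_approx (X := X) (n + 1)
    enforceable_mono p h1.1 h0.1 h1.2 h0.2 (h.approx_succ_le n).1 (h.approx_succ_le n).2

theorem iInter_enforceable_approx (p : unitInterval) :
    ⋂ n, enforceable X (approx X n).1 (approx X n).2 p =
      enforceable X (approxLimit X).1 (approxLimit X).2 p := by
  refine Set.Subset.antisymm (fun κ hκ => ?_) (Set.subset_iInter fun n => ?_)
  · rw [Set.mem_iInter] at hκ
    exact ⟨(hκ 0).1, le_of_tendsto_of_tendsto' (h.tendsto_bestReply_approx κ p)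
      (h.tendsto_oneStep_approx κ _ p) fun n => (hκ n).2⟩
  · exact enforceable_mono p h.isBddMeasurable_approxLimit.1 (isBddMeasurable_approx n).1
      h.isBddMeasurable_approxLimit.2 (isBddMeasurable_approx n).2 (approxLimit_le n)
      (le_approxLimit n)

theorem eventually_enforceable_approx_eq (p : unitInterval) :
    ∀ᶠ n in .atTop, enforceable X (approx X n).1 (approx X n).2 p =
      enforceable X (approxLimit X).1 (approxLimit X).2 p := by
  rw [← h.iInter_enforceable_approx p]
  exact eventually_eq_iInter_of_antitone ((Set.toFinite _).subset (enforceable_subset _ _ p))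
    (h.antitone_enforceable_approx p)

theorem enforceable_approxLimit_nonempty (p : unitInterval) :
    (enforceable X (approxLimit X).1 (approxLimit X).2 p).Nonempty := by
  obtain ⟨n, hn⟩ := (h.eventually_enforceable_approx_eq p).exists
  exact hn ▸ h n p

/-- The sets of enforceable actions are constant from some iterate on, so the extrema over them
pass to the limit. -/
theorem bellman_approxLimit : bellman X (approxLimit X) = approxLimit X := by
  ext p
  · refine tendsto_nhds_unique ((tendsto_binaryMax _ fun κ =>
      h.tendsto_oneStep_approx κ (G.N * κ) p).congr' ?_)
      ((Filter.tendsto_add_atTop_iff_nat 1).2 (h.tendsto_approx_fst p))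
    filter_upwards [h.eventually_enforceable_approx_eq p] with n hn
    rw [← hn]
    rfl
  · refine tendsto_nhds_unique ((tendsto_binaryMin _ fun κ =>
      h.tendsto_bestReply_approx κ p).congr' ?_)
      ((Filter.tendsto_add_atTop_iff_nat 1).2 (h.tendsto_approx_snd p))
    filter_upwards [h.eventually_enforceable_approx_eq p] with n hn
    rw [← hn]
    rfl

theorem isSolution_approxLimit : IsSolution X (approxLimit X).1 (approxLimit X).2 :=
  isSolution_of_bellman_eq h.isBddMeasurable_approxLimit.1 h.isBddMeasurable_approxLimit.2
    h.enforceable_approxLimit_nonempty h.bellman_approxLimit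

end ApproxEnforceable

end BanditGame

namespace BanditGame

variable {G : BanditGame} {Ω : Type*} [MeasurableSpace Ω] {X : ArmNoise G Ω}

/-! ### Bounds for equilibrium payoffs -/

/-- The strategy that plays `a` in period `t` and otherwise follows `τ`. -/
def deviateAt (τ : G.Strategy) (t : ℕ) (a : unitInterval) : G.Strategy where
  act t' x := if t' = t then a else τ.act t' x
  measurable_act t' := by
    split_ifs
    · exact measurable_const
    · exact τ.measurable_act t'

theorem deviateAt_act_self (τ : G.Strategy) {t : ℕ} (a : unitInterval) (x : G.Node t) :
    (deviateAt τ t a).act t x = a := if_pos rfl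

theorem deviateAt_act_of_ne (τ : G.Strategy) {t t' : ℕ} (a : unitInterval) (h : t' ≠ t) :
    (deviateAt τ t a).act t' = τ.act t' := funext fun _ => if_neg h

theorem actions_update (σ : Fin G.N → G.Strategy) (i : Fin G.N) (τ : G.Strategy) {t : ℕ}
    (x : G.Node t) :
    actions (Function.update σ i τ) x = Function.update (actions σ x) i (τ.act t x) :=
  funext fun j => Function.apply_update (fun _ ρ => ρ.act t x) σ i τ j

theorem payoffAt_deviateAt (p : unitInterval) (σ : Fin G.N → G.Strategy) {t : ℕ} (x : G.Node t)
    (i : Fin G.N) (a : unitInterval) :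
    payoffAt X p (Function.update σ i (deviateAt (σ i) t a)) x i =
      stageValue X (belief p x.1) (Function.update (actions σ x) i a) i
        fun z => payoffAt X p σ (nextNode x z) i := by
  have h (n : Fin G.N) (t' : ℕ) (ht : t + 1 ≤ t') :
      (Function.update σ i (deviateAt (σ i) t a) n).act t' = (σ n).act t' := by
    rcases eq_or_ne n i with rfl | hn
    · rw [Function.update_self, deviateAt_act_of_ne _ _ (Nat.ne_of_gt ht)]
    · rw [Function.update_of_ne hn]
  rw [payoffAt_eq_stageValue, actions_update, deviateAt_act_self]
  simp_rw [payoffAt_congr X p h]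

theorem isBddMeasurable_payoffAt_nextNode (p : unitInterval) (σ : Fin G.N → G.Strategy) {t : ℕ}
    (x : G.Node t) (i : Fin G.N) :
    IsBddMeasurable G.payoffBound fun z => payoffAt X p σ (nextNode x z) i :=
  ⟨by fun_prop, fun _ => abs_payoffAt_le X p σ _ i⟩

theorem isBddMeasurable_comp_bayesUpdate {C : ℝ} {w : unitInterval → ℝ}
    (hw : IsBddMeasurable C w) (p : unitInterval) :
    IsBddMeasurable C fun z : G.Outcome => w (bayesUpdate p z.1) :=
  hw.comp (measurable_bayesUpdate_fst p)

namespace IsPureSSE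

variable {p : unitInterval} {σ : Fin G.N → G.Strategy} (hσ : IsPureSSE X p σ)
include hσ

theorem exists_actions_eq {t : ℕ} (x : G.Node t) :
    ∃ κ ∈ ({0, 1} : Set ℕ), actions σ x = fun _ => binaryAct κ := by
  obtain ⟨κ, hκ, hact⟩ := exists_binaryAct (hσ.2 G.player t x)
  exact ⟨κ, hκ, funext fun j => (hσ.1.2 j G.player t x).trans hact⟩

theorem exists_enforceable {wbar wlow : unitInterval → ℝ} {C : ℝ} (hb : IsBddMeasurable C wbar)
    (hl : IsBddMeasurable C wlow) {t : ℕ} (x : G.Node t) (i : Fin G.N)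
    (hbar : ∀ y : G.Node (t + 1), payoffAt X p σ y i ≤ wbar (belief p y.1))
    (hlow : ∀ y : G.Node (t + 1), wlow (belief p y.1) ≤ payoffAt X p σ y i) :
    ∃ κ ∈ enforceable X wbar wlow (belief p x.1),
      bestReply X κ wlow (belief p x.1) ≤ payoffAt X p σ x i ∧
        payoffAt X p σ x i ≤ oneStep X κ (G.N * κ) wbar (belief p x.1) := by
  obtain ⟨κ, hκ, hact⟩ := hσ.exists_actions_eq x
  have hpay := isBddMeasurable_payoffAt_nextNode (X := X) p σ x i
  have hupper : payoffAt X p σ x i ≤ oneStep X κ (G.N * κ) wbar (belief p x.1) := by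
    rw [oneStep_comply_eq_stageValue X _ hκ i hb.measurable, payoffAt_eq_stageValue, hact]
    exact stageValue_mono _ _ _ hpay (isBddMeasurable_comp_bayesUpdate hb _) fun z =>
      belief_nextNode p x z ▸ hbar (nextNode x z)
  have hdev (k : ℕ) (hk : k ∈ ({0, 1} : Set ℕ)) :
      oneStep X k ((G.N - 1) * κ + k) wlow (belief p x.1) ≤ payoffAt X p σ x i := by
    refine le_trans ?_ (hσ.1.1 t x i (deviateAt (σ i) t (binaryAct k)))
    rw [payoffAt_deviateAt, hact, oneStep_eq_stageValue X _ hκ hk i hl.measurable]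
    exact stageValue_mono _ _ _ (isBddMeasurable_comp_bayesUpdate hl _) hpay fun z =>
      belief_nextNode p x z ▸ hlow (nextNode x z)
  have hbest : bestReply X κ wlow (belief p x.1) ≤ payoffAt X p σ x i :=
    max_le (hdev 0 (by simp)) (hdev 1 (by simp))
  exact ⟨κ, ⟨hκ, hbest.trans hupper⟩, hbest, hupper⟩

theorem payoffAt_mem_Icc_approx (n : ℕ) {t : ℕ} (x : G.Node t) (i : Fin G.N) :
    payoffAt X p σ x i ∈
      Set.Icc ((approx X n).2 (belief p x.1)) ((approx X n).1 (belief p x.1)) := by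
  induction n generalizing t with
  | zero => exact abs_le.1 (abs_payoffAt_le X p σ x i)
  | succ n ih =>
    obtain ⟨κ, hκ, hlow, hbar⟩ := hσ.exists_enforceable (isBddMeasurable_approx n).1
      (isBddMeasurable_approx n).2 x i (fun y => (ih y).2) fun y => (ih y).1
    have hmin := isLeast_binaryMin (enforceable_subset _ _ _) ⟨κ, hκ⟩
      fun κ => bestReply X κ (approx X n).2 (belief p x.1)
    have hmax := isGreatest_binaryMax (enforceable_subset _ _ _) ⟨κ, hκ⟩
      fun κ => oneStep X κ (G.N * κ) (approx X n).1 (belief p x.1)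
    exact ⟨(hmin.2 ⟨κ, hκ, rfl⟩).trans hlow, hbar.trans (hmax.2 ⟨κ, hκ, rfl⟩)⟩

theorem payoffAt_mem_Icc_approxLimit {t : ℕ} (x : G.Node t) (i : Fin G.N) :
    payoffAt X p σ x i ∈
      Set.Icc ((approxLimit X).2 (belief p x.1)) ((approxLimit X).1 (belief p x.1)) :=
  ⟨ciSup_le fun n => (hσ.payoffAt_mem_Icc_approx n x i).1,
    le_ciInf fun n => (hσ.payoffAt_mem_Icc_approx n x i).2⟩

theorem payoff_mem_Icc_approxLimit (i : Fin G.N) :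
    payoff X p σ i ∈ Set.Icc ((approxLimit X).2 p) ((approxLimit X).1 p) := by
  refine (convex_Icc _ _).integral_mem isClosed_Icc
    (.of_forall fun u => hσ.payoffAt_mem_Icc_approxLimit (Fin.elim0, u) i) ?_
  exact integrable_of_abs_le (by fun_prop) fun u => abs_payoffAt_le X p σ _ i

end IsPureSSE

theorem approxEnforceable_of_forall_exists_isPureSSE (hex : ∀ p, ∃ σ, IsPureSSE X p σ) :
    ApproxEnforceable X := by
  intro n p
  obtain ⟨σ, hσ⟩ := hex p
  obtain ⟨κ, hκ, -⟩ := hσ.exists_enforceable (isBddMeasurable_approx n).1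
    (isBddMeasurable_approx n).2 (((Fin.elim0 : G.Hist 0), 0) : G.Node 0) G.player
    (fun y => (hσ.payoffAt_mem_Icc_approx n y _).2)
    fun y => (hσ.payoffAt_mem_Icc_approx n y _).1
  exact ⟨κ, hκ⟩

theorem pureSSEPayoffs_subset_Icc_approxLimit (p : unitInterval) :
    pureSSEPayoffs X p ⊆ Set.Icc ((approxLimit X).2 p) ((approxLimit X).1 p) := by
  rintro v ⟨σ, hσ, hv⟩
  rw [← hv G.player]
  exact hσ.payoff_mem_Icc_approxLimit G.player

end BanditGame

open Classical in
theorem integral_prod_lt_ite {E : Type*} [MeasurableSpace E] (a : unitInterval) (ν : Measure E)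
    [IsProbabilityMeasure ν] {C : ℝ} {f g : E → ℝ} (hf : IsBddMeasurable C f)
    (hg : IsBddMeasurable C g) :
    ∫ z, (if z.2 < a ∨ a = 1 then f z.1 else g z.1) ∂(ν.prod (volume : Measure unitInterval)) =
      a * ∫ x, f x ∂ν + (1 - a) * ∫ x, g x ∂ν := by
  have hm : Measurable fun e : unitInterval × E => if e.1 < a ∨ a = 1 then f e.2 else g e.2 :=
    .ite ((measurableSet_lt measurable_fst measurable_const).union (.const _))
      (hf.measurable.comp measurable_snd) (hg.measurable.comp measurable_snd)
  have hmap {h : E → ℝ} (hh : IsBddMeasurable C h) : Integrable id (ν.map h) :=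
    (integrable_map_measure aestronglyMeasurable_id hh.measurable.aemeasurable).2 hh.integrable
  calc _ = ∫ e, id (if e.1 < a ∨ a = 1 then f e.2 else g e.2)
          ∂((volume : Measure unitInterval).prod ν) :=
        integral_prod_swap fun e : unitInterval × E => id (if e.1 < a ∨ a = 1 then f e.2 else g e.2)
    _ = ∫ x, id x ∂(mixture a (ν.map f) (ν.map g)) := by
        rw [← map_prod_lt_ite a ν hf.measurable hg.measurable,
          integral_map hm.aemeasurable aestronglyMeasurable_id]
    _ = _ := by
        rw [integral_mixture (hmap hf) (hmap hg),
          integral_map hf.measurable.aemeasurable aestronglyMeasurable_id,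
          integral_map hg.measurable.aemeasurable aestronglyMeasurable_id]
        rfl

namespace BanditGame

variable {G : BanditGame} {Ω : Type*} [MeasurableSpace Ω] {X : ArmNoise G Ω}

/-! ### Verification of continuation values -/

section Verification

variable {p : unitInterval} {σ : Fin G.N → G.Strategy} {C : ℝ} {V : (t : ℕ) → G.Node t → ℝ}
  (hV : ∀ t, IsBddMeasurable C (V t))
include hV

theorem le_δ_pow_mul_of_le_δ_mul_integral
    (h : ∀ (t : ℕ) (x : G.Node t), V t x ≤
      G.δ * ∫ z, V (t + 1) (nextNode x z) ∂(mixedOutcomeLaw X (belief p x.1) (actions σ x)))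
    (j : ℕ) {t : ℕ} (x : G.Node t) : V t x ≤ G.δ ^ j * C := by
  induction j generalizing t with
  | zero => simpa using (abs_le.1 ((hV t).abs_le x)).2
  | succ j ih =>
    have hint := ((hV (t + 1)).comp (g := nextNode x) (by fun_prop)).integrable
      (μ := mixedOutcomeLaw X (belief p x.1) (actions σ x))
    have hle := integral_mono hint (integrable_const _) fun z => ih (nextNode x z)
    rw [integral_const, probReal_univ, one_smul] at hle
    calc V t x ≤ G.δ * (G.δ ^ j * C) := (h t x).trans (mul_le_mul_of_nonneg_left hle δ_pos.le)
      _ = G.δ ^ (j + 1) * C := by rw [pow_succ', mul_assoc]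

theorem nonpos_of_le_δ_mul_integral
    (h : ∀ (t : ℕ) (x : G.Node t), V t x ≤
      G.δ * ∫ z, V (t + 1) (nextNode x z) ∂(mixedOutcomeLaw X (belief p x.1) (actions σ x)))
    {t : ℕ} (x : G.Node t) : V t x ≤ 0 := by
  have hlim := (tendsto_pow_atTop_nhds_zero_of_lt_one (δ_pos (G := G)).le δ_lt_one).mul_const C
  rw [zero_mul] at hlim
  exact ge_of_tendsto' hlim fun j => le_δ_pow_mul_of_le_δ_mul_integral hV h j x

theorem payoffAt_le_of_stageValue_le {n : Fin G.N}
    (h : ∀ (t : ℕ) (x : G.Node t), stageValue X (belief p x.1) (actions σ x) n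
      (fun z => V (t + 1) (nextNode x z)) ≤ V t x) {t : ℕ} (x : G.Node t) :
    payoffAt X p σ x n ≤ V t x := by
  have hpay (t : ℕ) : IsBddMeasurable G.payoffBound fun x : G.Node t => payoffAt X p σ x n :=
    ⟨by fun_prop, fun x => abs_payoffAt_le X p σ x n⟩
  refine sub_nonpos.1 (nonpos_of_le_δ_mul_integral (X := X) (p := p) (σ := σ)
    (fun t => (hpay t).sub (hV t)) (fun t x => ?_) x)
  rw [← stageValue_sub_stageValue _ _ n ((hpay _).comp (by fun_prop))
    ((hV _).comp (by fun_prop)), payoffAt_eq_stageValue]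
  exact sub_le_sub_left (h t x) _

theorem le_payoffAt_of_le_stageValue {n : Fin G.N}
    (h : ∀ (t : ℕ) (x : G.Node t), V t x ≤ stageValue X (belief p x.1) (actions σ x) n
      (fun z => V (t + 1) (nextNode x z))) {t : ℕ} (x : G.Node t) :
    V t x ≤ payoffAt X p σ x n := by
  have hpay (t : ℕ) : IsBddMeasurable G.payoffBound fun x : G.Node t => payoffAt X p σ x n :=
    ⟨by fun_prop, fun x => abs_payoffAt_le X p σ x n⟩
  refine sub_nonpos.1 (nonpos_of_le_δ_mul_integral (X := X) (p := p) (σ := σ)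
    (fun t => (hV t).sub (hpay t)) (fun t x => ?_) x)
  rw [← stageValue_sub_stageValue _ _ n ((hV _).comp (by fun_prop))
    ((hpay _).comp (by fun_prop)), payoffAt_eq_stageValue]
  exact sub_le_sub_right (h t x) _

end Verification

open Classical in
theorem stageValue_lt_ite (p : unitInterval) (q : Fin G.N → unitInterval) (n : Fin G.N)
    (a : unitInterval) {C : ℝ} {f g : (Fin G.N → G.Obs) → ℝ} (hf : IsBddMeasurable C f)
    (hg : IsBddMeasurable C g) :
    stageValue X p q n (fun z => if z.2 < a ∨ a = 1 then f z.1 else g z.1) =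
      a * stageValue X p q n (fun z => f z.1) + (1 - a) * stageValue X p q n (fun z => g z.1) := by
  have : IsProbabilityMeasure (mixture p (stageLaw X 1 q) (stageLaw X 0 q)) :=
    isProbabilityMeasure_mixture
  have hprod : mixedOutcomeLaw X p q =
      (mixture p (stageLaw X 1 q) (stageLaw X 0 q)).prod volume := (mixture_prod volume).symm
  simp only [stageValue, hprod, integral_prod_lt_ite a _ hf hg, integral_fun_fst, probReal_univ,
    one_smul]
  ring

/-! ### Two-state automata -/

/-- A symmetric strategy profile with a good state `true` and a bad state `false`: in state `b` and
at belief `q` all players use the pure action `act b q`; the next state is bad if some player does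
not, and otherwise it is good with probability `prob b q`. -/
structure Automaton where
  act : Bool → unitInterval → ℕ
  prob : Bool → unitInterval → unitInterval
  measurable_act : ∀ b, Measurable (act b)
  measurable_prob : ∀ b, Measurable (prob b)

namespace Automaton

variable (A : Automaton)

open Classical in
/-- The next state, given the outcome of the current period. -/
noncomputable def transition (b : Bool) (q : unitInterval) (z : G.Outcome) : Bool :=
  decide ((∀ i, (z.1 i).isRight ↔ A.act b q = 1) ∧ (z.2 < A.prob b q ∨ A.prob b q = 1))

/-- The state at a node, starting from the state `b₀` and the belief `p`. -/
noncomputable def stateAt (b₀ : Bool) (p : unitInterval) : {t : ℕ} → G.Node t → Bool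
  | 0, _ => b₀
  | t + 1, x =>
    A.transition (G := G) (stateAt b₀ p (t := t) (Fin.init x.1, (x.1 (Fin.last t)).1))
      (belief p (Fin.init x.1)) ((x.1 (Fin.last t)).2, x.2)

@[simp]
theorem stateAt_nextNode (b₀ : Bool) (p : unitInterval) {t : ℕ} (x : G.Node t) (z : G.Outcome) :
    A.stateAt b₀ p (nextNode x z) = A.transition (A.stateAt b₀ p x) (belief p x.1) z := by
  simp only [nextNode, stateAt, Fin.init_snoc, Fin.snoc_last]

theorem measurable_transition :
    Measurable fun e : Bool × unitInterval × G.Outcome => A.transition e.1 e.2.1 e.2.2 := by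
  refine measurable_from_prod_countable_right fun b => measurable_to_bool ?_
  have hact : MeasurableSet {e : unitInterval × G.Outcome | A.act b e.1 = 1} :=
    ((A.measurable_act b).comp measurable_fst) (measurableSet_singleton 1)
  have hright : MeasurableSet {o : G.Obs | o.isRight} := measurableSet_sum_iff.2 ⟨by simp, by simp⟩
  have hobs (i : Fin G.N) : MeasurableSet {e : unitInterval × G.Outcome | (e.2.1 i).isRight} :=
    (by fun_prop : Measurable fun e : unitInterval × G.Outcome => e.2.1 i) hright
  have hcomply : MeasurableSet
      {e : unitInterval × G.Outcome | ∀ i, (e.2.1 i).isRight ↔ A.act b e.1 = 1} :=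
    measurableSet_setOfPred.2 <| .forall fun i =>
      (measurableSet_setOfPred.1 (hobs i)).iff (measurableSet_setOfPred.1 hact)
  have hprob : Measurable fun e : unitInterval × G.Outcome => A.prob b e.1 :=
    (A.measurable_prob b).comp measurable_fst
  have hcoin := (measurableSet_lt (measurable_snd.comp measurable_snd) hprob).union
    (hprob (measurableSet_singleton 1))
  convert hcomply.inter hcoin
  ext e
  simp [transition]

theorem measurable_stateAt (b₀ : Bool) (p : unitInterval) (t : ℕ) :
    Measurable fun x : G.Node t => A.stateAt b₀ p x := by
  induction t with
  | zero => exact measurable_const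
  | succ t ih =>
    have hinit : Measurable fun x : G.Node (t + 1) => (Fin.init x.1 : G.Hist t) :=
      measurable_pi_lambda _ fun i => (measurable_pi_apply _).comp measurable_fst
    have hlast : Measurable fun x : G.Node (t + 1) => x.1 (Fin.last t) := by fun_prop
    exact A.measurable_transition.comp ((ih.comp (hinit.prodMk hlast.fst)).prodMk
      (((measurable_belief p t).comp hinit).prodMk (hlast.snd.prodMk measurable_snd)))

/-- The strategy of each player. -/
noncomputable def strategy (b₀ : Bool) (p : unitInterval) : G.Strategy where
  act _ x := binaryAct (A.act (A.stateAt b₀ p x) (belief p x.1))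
  measurable_act t := by
    have h : Measurable fun e : Bool × unitInterval => binaryAct (A.act e.1 e.2) :=
      measurable_from_prod_countable_right fun b =>
        (measurable_of_countable binaryAct).comp (A.measurable_act b)
    exact h.comp ((A.measurable_stateAt b₀ p t).prodMk (by fun_prop))

theorem actions_strategy (b₀ : Bool) (p : unitInterval) {t : ℕ} (x : G.Node t) :
    actions (fun _ => A.strategy b₀ p) x =
      fun _ => binaryAct (A.act (A.stateAt b₀ p x) (belief p x.1)) := rfl

/-- `A` has the value `v b` in state `b`, and supports its actions by the threat of moving to the
bad state. -/
structure Supports (X : ArmNoise G Ω) (v : Bool → unitInterval → ℝ) : Prop where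
  act_mem : ∀ b q, A.act b q ∈ ({0, 1} : Set ℕ)
  bestReply_le : ∀ b q, bestReply X (A.act b q) (v false) q ≤ v b q
  promise : ∀ b q, A.prob b q * oneStep X (A.act b q) (G.N * A.act b q) (v true) q +
    (1 - A.prob b q) * oneStep X (A.act b q) (G.N * A.act b q) (v false) q = v b q

namespace Supports

variable {A} {v : Bool → unitInterval → ℝ} (hA : A.Supports X v) {C : ℝ}
  (hv : ∀ b, IsBddMeasurable C (v b))

include hv in
theorem isBddMeasurable_uncurry : IsBddMeasurable C fun e : Bool × unitInterval => v e.1 e.2 :=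
  ⟨measurable_from_prod_countable_right fun b => (hv b).measurable,
    fun e => (hv e.1).abs_le e.2⟩

include hv in
theorem isBddMeasurable_continuation (A : Automaton) (b : Bool) (q : unitInterval) :
    IsBddMeasurable C fun z : G.Outcome => v (A.transition b q z) (bayesUpdate q z.1) :=
  (isBddMeasurable_uncurry hv).comp ((A.measurable_transition.comp
    (measurable_const.prodMk (measurable_const.prodMk measurable_id))).prodMk
    (measurable_bayesUpdate_fst q))

include hA hv

theorem stageValue_comply (b : Bool) (q : unitInterval) (i : Fin G.N) :
    stageValue X q (fun _ => binaryAct (A.act b q)) i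
      (fun z => v (A.transition b q z) (bayesUpdate q z.1)) = v b q := by
  classical
  have hcoin : (fun z => v (A.transition b q z) (bayesUpdate q z.1))
      =ᵐ[mixedOutcomeLaw X q fun _ => binaryAct (A.act b q)] fun z =>
        if z.2 < A.prob b q ∨ A.prob b q = 1 then v true (bayesUpdate q z.1)
        else v false (bayesUpdate q z.1) := by
    filter_upwards [ae_isRight_mixedOutcomeLaw X q fun _ => binaryAct_eq_zero_or_one (A.act b q)]
      with z hz
    have hcomply (i : Fin G.N) : (z.1 i).isRight ↔ A.act b q = 1 :=
      (hz i).trans binaryAct_eq_one_iff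
    by_cases hu : z.2 < A.prob b q ∨ A.prob b q = 1
    · rw [if_pos hu, transition, decide_eq_true ⟨hcomply, hu⟩]
    · rw [if_neg hu, transition, decide_eq_false fun h => hu h.2]
  have hbayes (b' : Bool) : IsBddMeasurable C fun o : Fin G.N → G.Obs => v b' (bayesUpdate q o) :=
    (hv b').comp (measurable_bayesUpdate_right q)
  have hmem := hA.act_mem b q
  rw [stageValue_congr_ae _ _ _ hcoin, stageValue_lt_ite _ _ _ _ (hbayes true) (hbayes false),
    ← oneStep_comply_eq_stageValue X q hmem i (hv true).measurable,
    ← oneStep_comply_eq_stageValue X q hmem i (hv false).measurable, hA.promise]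

theorem stageValue_unilateral_le (b : Bool) (q : unitInterval) (i : Fin G.N) {k : ℕ}
    (hk : k ∈ ({0, 1} : Set ℕ)) :
    stageValue X q (unilateral (A.act b q) i k) i
      (fun z => v (A.transition b q z) (bayesUpdate q z.1)) ≤ v b q := by
  rcases eq_or_ne k (A.act b q) with rfl | hne
  · rw [unilateral_self]
    exact (hA.stageValue_comply hv b q i).le
  have hbad : (fun z => v (A.transition b q z) (bayesUpdate q z.1))
      =ᵐ[mixedOutcomeLaw X q (unilateral (A.act b q) i k)]
        fun z => v false (bayesUpdate q z.1) := by
    filter_upwards [ae_isRight_mixedOutcomeLaw X q (unilateral_eq_zero_or_one (A.act b q) k i)]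
      with z hz
    have hdetect : ¬((z.1 i).isRight ↔ A.act b q = 1) := by
      rw [hz i, unilateral_apply, if_pos rfl, binaryAct_eq_one_iff]
      rcases hk with rfl | rfl <;> rcases hA.act_mem b q with h | h <;> simp_all
    rw [transition, decide_eq_false fun h => hdetect (h.1 i)]
  rw [stageValue_congr_ae _ _ _ hbad,
    ← oneStep_eq_stageValue X q (hA.act_mem b q) hk i (hv false).measurable]
  exact (oneStep_le_bestReply q (A.act b q) hk _).trans (hA.bestReply_le b q)

theorem stageValue_deviate_le (b : Bool) (q : unitInterval) (i : Fin G.N) (a : unitInterval) :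
    stageValue X q (Function.update (fun _ => binaryAct (A.act b q)) i a) i
      (fun z => v (A.transition b q z) (bayesUpdate q z.1)) ≤ v b q := by
  have hsafe := hA.stageValue_unilateral_le hv b q i (k := 0) (by simp)
  have hrisky := hA.stageValue_unilateral_le hv b q i (k := 1) (by simp)
  rw [stageValue_update q _ i (isBddMeasurable_continuation hv A b q)]
  calc _ ≤ a * v b q + (1 - a) * v b q :=
        add_le_add (mul_le_mul_of_nonneg_left hrisky a.2.1)
          (mul_le_mul_of_nonneg_left hsafe (sub_nonneg.2 a.2.2))
    _ = v b q := by ring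

variable (b₀ : Bool) (p : unitInterval)

omit hA in
theorem isBddMeasurable_value (A : Automaton) (t : ℕ) :
    IsBddMeasurable C fun x : G.Node t => v (A.stateAt b₀ p x) (belief p x.1) :=
  (isBddMeasurable_uncurry hv).comp ((A.measurable_stateAt b₀ p t).prodMk (by fun_prop))

theorem payoffAt_update_le (i : Fin G.N) (τ : G.Strategy) {t : ℕ} (x : G.Node t) :
    payoffAt X p (Function.update (fun _ => A.strategy b₀ p) i τ) x i ≤
      v (A.stateAt b₀ p x) (belief p x.1) := by
  refine payoffAt_le_of_stageValue_le (V := fun t x => v (A.stateAt b₀ p x) (belief p x.1))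
    (isBddMeasurable_value hv b₀ p A) (fun t x => ?_) x
  simp only [stateAt_nextNode, belief_nextNode, actions_update, actions_strategy]
  exact hA.stageValue_deviate_le hv _ _ i _

theorem payoffAt_eq (i : Fin G.N) {t : ℕ} (x : G.Node t) :
    payoffAt X p (fun _ => A.strategy b₀ p) x i = v (A.stateAt b₀ p x) (belief p x.1) := by
  refine le_antisymm ?_ (le_payoffAt_of_le_stageValue
    (V := fun t x => v (A.stateAt b₀ p x) (belief p x.1)) (isBddMeasurable_value hv b₀ p A)
    (fun t x => ?_) x)
  · simpa only [Function.update_eq_self] using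
      hA.payoffAt_update_le hv b₀ p i (A.strategy b₀ p) x
  · simp only [stateAt_nextNode, belief_nextNode, actions_strategy]
    exact (hA.stageValue_comply hv _ _ i).ge

theorem isPureSSE : IsPureSSE X p fun _ => A.strategy b₀ p := by
  refine ⟨⟨fun t x i τ => ?_, fun _ _ _ _ => rfl⟩, fun _ _ _ => binaryAct_eq_zero_or_one _⟩
  rw [hA.payoffAt_eq hv b₀ p i x]
  exact hA.payoffAt_update_le hv b₀ p i τ x

theorem mem_pureSSEPayoffs : v b₀ p ∈ pureSSEPayoffs X p := by
  refine ⟨_, hA.isPureSSE hv b₀ p, fun i => ?_⟩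
  simp only [payoff, hA.payoffAt_eq hv b₀ p i, stateAt, belief, integral_const, probReal_univ,
    one_smul]

end Supports

end Automaton

end BanditGame

/-- The probability of `b` under which a lottery between `a` and `b` has mean `x`; it is `0 / 0 = 0`
if `a = b`. -/
noncomputable def lotteryProb (a b x : ℝ) : ℝ := (x - a) / (b - a)

theorem lotteryProb_mem_Icc {a b x : ℝ} (hx : x ∈ Set.Icc a b) :
    lotteryProb a b x ∈ Set.Icc (0 : ℝ) 1 :=
  ⟨div_nonneg (sub_nonneg.2 hx.1) (sub_nonneg.2 (hx.1.trans hx.2)),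
    div_le_one_of_le₀ (sub_le_sub_right hx.2 a) (sub_nonneg.2 (hx.1.trans hx.2))⟩

theorem lotteryProb_mul_add {a b x : ℝ} (hx : x ∈ Set.Icc a b) :
    lotteryProb a b x * b + (1 - lotteryProb a b x) * a = x := by
  rcases eq_or_ne a b with rfl | hab
  · linarith [hx.1, hx.2]
  · have : b - a ≠ 0 := sub_ne_zero.2 hab.symm
    rw [lotteryProb]
    field_simp
    ring

namespace BanditGame

variable {G : BanditGame} {Ω : Type*} [MeasurableSpace Ω] {X : ArmNoise G Ω}

theorem measurable_oneStep_comply {w : unitInterval → ℝ} {C : ℝ} (hw : IsBddMeasurable C w)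
    {f : unitInterval → ℕ} (hf : Measurable f) :
    Measurable fun q => oneStep X (f q) (G.N * f q) w q := by
  have hstep : Measurable fun e : ℕ × unitInterval => oneStep X e.1 (G.N * e.1) w e.2 :=
    measurable_from_prod_countable_right fun k => measurable_oneStep k (G.N * k) hw
  exact hstep.comp (g := fun e : ℕ × unitInterval => oneStep X e.1 (G.N * e.1) w e.2)
    (f := fun q => (f q, q)) (hf.prodMk measurable_id)

/-! ### Solutions as payoffs of automata -/

namespace IsSolution

variable {wbar wlow : unitInterval → ℝ}

theorem exists_isBddMeasurable (h : IsSolution X wbar wlow) :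
    ∃ C, IsBddMeasurable C wbar ∧ IsBddMeasurable C wlow := by
  obtain ⟨C₁, h₁⟩ := h.bounded_bar
  obtain ⟨C₂, h₂⟩ := h.bounded_low
  exact ⟨max C₁ C₂, ⟨h.measurable_bar, fun p => (h₁ p).trans (le_max_left _ _)⟩,
    ⟨h.measurable_low, fun p => (h₂ p).trans (le_max_right _ _)⟩⟩

theorem low_le_bar (h : IsSolution X wbar wlow) (p : unitInterval) : wlow p ≤ wbar p := by
  obtain ⟨⟨κ, hκ, -⟩, hub⟩ := h.eq_bar p
  exact ((h.eq_low p).2 ⟨κ, hκ, rfl⟩).trans (hκ.2.trans (hub ⟨κ, hκ, rfl⟩))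

variable (X wbar wlow) in
open Classical in
/-- The action that the automaton of a solution prescribes: in the good state one that attains the
maximum defining `wbar`, in the bad state one that attains the minimum defining `wlow`. -/
noncomputable def extremalAct : Bool → unitInterval → ℕ
  | true, q => if 0 ∈ enforceable X wbar wlow q ∧ oneStep X 0 (G.N * 0) wbar q = wbar q
      then 0 else 1
  | false, q => if 0 ∈ enforceable X wbar wlow q ∧ bestReply X 0 wlow q = wlow q then 0 else 1

theorem extremalAct_true (h : IsSolution X wbar wlow) (q : unitInterval) :
    extremalAct X wbar wlow true q ∈ enforceable X wbar wlow q ∧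
      oneStep X (extremalAct X wbar wlow true q) (G.N * extremalAct X wbar wlow true q) wbar q =
        wbar q := by
  rw [extremalAct]
  split_ifs with h0
  · exact h0
  · obtain ⟨κ, hκ, e⟩ := (h.eq_bar q).1
    rcases hκ.1 with rfl | rfl
    exacts [(h0 ⟨hκ, e⟩).elim, ⟨hκ, e⟩]

theorem extremalAct_false (h : IsSolution X wbar wlow) (q : unitInterval) :
    extremalAct X wbar wlow false q ∈ enforceable X wbar wlow q ∧
      bestReply X (extremalAct X wbar wlow false q) wlow q = wlow q := by
  rw [extremalAct]
  split_ifs with h0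
  · exact h0
  · obtain ⟨κ, hκ, e⟩ := (h.eq_low q).1
    rcases hκ.1 with rfl | rfl
    exacts [(h0 ⟨hκ, e⟩).elim, ⟨hκ, e⟩]

theorem measurable_extremalAct (h : IsSolution X wbar wlow) (b : Bool) :
    Measurable (extremalAct X wbar wlow b) := by
  classical
  obtain ⟨C, hbar, hlow⟩ := h.exists_isBddMeasurable
  have h0 := measurableSet_enforceable (X := X) 0 hbar hlow
  cases b
  · exact .ite (h0.inter (measurableSet_eq_fun (measurable_bestReply 0 hlow) h.measurable_low))
      measurable_const measurable_const
  · exact .ite (h0.inter (measurableSet_eq_fun (measurable_oneStep 0 _ hbar) h.measurable_bar))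
      measurable_const measurable_const

theorem low_mem_Icc_oneStep (h : IsSolution X wbar wlow) (q : unitInterval) :
    wlow q ∈ Set.Icc
      (oneStep X (extremalAct X wbar wlow false q) (G.N * extremalAct X wbar wlow false q) wlow q)
      (oneStep X (extremalAct X wbar wlow false q) (G.N * extremalAct X wbar wlow false q) wbar q)
    := by
  obtain ⟨hmem, heq⟩ := h.extremalAct_false q
  have hcomply := oneStep_le_bestReply (X := X) q (extremalAct X wbar wlow false q) hmem.1 wlow
  rw [N_sub_one_mul_add, heq] at hcomply
  exact ⟨hcomply, heq.ge.trans hmem.2⟩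

variable (X wbar wlow) in
/-- The probability of returning from the bad to the good state after compliance. -/
noncomputable def forgiveness (q : unitInterval) : ℝ :=
  lotteryProb
    (oneStep X (extremalAct X wbar wlow false q) (G.N * extremalAct X wbar wlow false q) wlow q)
    (oneStep X (extremalAct X wbar wlow false q) (G.N * extremalAct X wbar wlow false q) wbar q)
    (wlow q)

theorem measurable_forgiveness (h : IsSolution X wbar wlow) :
    Measurable (forgiveness X wbar wlow) := by
  obtain ⟨C, hbar, hlow⟩ := h.exists_isBddMeasurable
  have hact := h.measurable_extremalAct false
  exact (h.measurable_low.sub (measurable_oneStep_comply hlow hact)).div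
    ((measurable_oneStep_comply hbar hact).sub (measurable_oneStep_comply hlow hact))

/-- The automaton whose payoffs in the good and the bad state are `wbar` and `wlow`. -/
noncomputable def automaton (h : IsSolution X wbar wlow) : Automaton where
  act := extremalAct X wbar wlow
  prob
    | true => fun _ => 1
    | false => fun q =>
      ⟨forgiveness X wbar wlow q, lotteryProb_mem_Icc (h.low_mem_Icc_oneStep q)⟩
  measurable_act := h.measurable_extremalAct
  measurable_prob b := by
    cases b
    exacts [h.measurable_forgiveness.subtype_mk, measurable_const]

theorem automaton_supports (h : IsSolution X wbar wlow) :
    h.automaton.Supports X fun b => bif b then wbar else wlow where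
  act_mem b q := by
    cases b
    exacts [(h.extremalAct_false q).1.1, (h.extremalAct_true q).1.1]
  bestReply_le b q := by
    cases b
    exacts [(h.extremalAct_false q).2.le,
      (h.extremalAct_true q).1.2.trans (h.extremalAct_true q).2.le]
  promise b q := by
    cases b
    · exact lotteryProb_mul_add (h.low_mem_Icc_oneStep q)
    · change ((1 : unitInterval) : ℝ) * _ + (1 - ((1 : unitInterval) : ℝ)) * _ = wbar q
      rw [Set.Icc.coe_one, one_mul, sub_self, zero_mul, add_zero]
      exact (h.extremalAct_true q).2

theorem mem_pureSSEPayoffs (h : IsSolution X wbar wlow) (p : unitInterval) :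
    wbar p ∈ pureSSEPayoffs X p ∧ wlow p ∈ pureSSEPayoffs X p := by
  obtain ⟨C, hbar, hlow⟩ := h.exists_isBddMeasurable
  have hv (b : Bool) : IsBddMeasurable C (bif b then wbar else wlow) := by
    cases b
    exacts [hlow, hbar]
  exact ⟨h.automaton_supports.mem_pureSSEPayoffs hv true p,
    h.automaton_supports.mem_pureSSEPayoffs hv false p⟩

theorem mem_Icc_Winf_Wsup (h : IsSolution X wbar wlow) (p : unitInterval) :
    Winf X p ≤ wlow p ∧ wbar p ≤ Wsup X p :=
  ⟨csInf_le ⟨_, fun _ hv => (pureSSEPayoffs_subset_Icc_approxLimit p hv).1⟩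
      (h.mem_pureSSEPayoffs p).2,
    le_csSup ⟨_, fun _ hv => (pureSSEPayoffs_subset_Icc_approxLimit p hv).2⟩
      (h.mem_pureSSEPayoffs p).1⟩

end IsSolution

theorem ApproxEnforceable.Wsup_eq_Winf_eq (h : ApproxEnforceable X) :
    Wsup X = (approxLimit X).1 ∧ Winf X = (approxLimit X).2 :=
  ⟨funext fun p => IsGreatest.csSup_eq ⟨(h.isSolution_approxLimit.mem_pureSSEPayoffs p).1,
      fun _ hv => (pureSSEPayoffs_subset_Icc_approxLimit p hv).2⟩,
    funext fun p => IsLeast.csInf_eq ⟨(h.isSolution_approxLimit.mem_pureSSEPayoffs p).2,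
      fun _ hv => (pureSSEPayoffs_subset_Icc_approxLimit p hv).1⟩⟩

theorem ApproxEnforceable.isSolution_Wsup_Winf (h : ApproxEnforceable X) :
    IsSolution X (Wsup X) (Winf X) := by
  rw [h.Wsup_eq_Winf_eq.1, h.Wsup_eq_Winf_eq.2]
  exact h.isSolution_approxLimit

end BanditGame

/-- If the discrete game admits a pure-strategy SSE for every prior belief, then the best and
worst pure-strategy SSE payoffs solve the coupled functional equations, and they bound every
bounded measurable solution. -/
theorem proposition10 (G : BanditGame) {Ω : Type*} [MeasurableSpace Ω] (X : ArmNoise G Ω)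
    (hex : ∀ p : unitInterval, ∃ σ, BanditGame.IsPureSSE X p σ) :
    BanditGame.IsSolution X (BanditGame.Wsup X) (BanditGame.Winf X) ∧
    ∀ wbar wlow : unitInterval → ℝ, BanditGame.IsSolution X wbar wlow →
      ∀ p, BanditGame.Winf X p ≤ wlow p ∧ wlow p ≤ wbar p ∧ wbar p ≤ BanditGame.Wsup X p :=
  ⟨(BanditGame.approxEnforceable_of_forall_exists_isPureSSE hex).isSolution_Wsup_Winf,
    fun _ _ h p => ⟨(h.mem_Icc_Winf_Wsup p).1, h.low_le_bar p, (h.mem_Icc_Winf_Wsup p).2⟩⟩
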